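/- Generalized jump condition (surface balance) on a moving singular surface in $\mathbb R^3$. **Setting.** Let $T>0$, let $\mathcal U\subseteq\mathbb R^2$ be open and let $\Phi:\,]0,T[\,\times\,\mathcal U\to\mathbb R^3$ be of class $C^2$, such that the tangent vectors $\tau_\alpha=\partial\Phi/\partial u_\alpha$ ($\alpha=1,2$) are everywhere linearly independent and $(t,u)\mapsto(t,\Phi(t,u))$ is a homeomorphism onto its image. Let $\Sigma(t)=\Phi(t,\mathcal U)$, $\nu_\Sigma=\tau_1\times\tau_2/|\tau_1\times\tau_2|$, $g_{\alpha\beta}=\tau_\alpha\cdot\tau_\beta$ with inverse $g^{\alpha\beta}$ and $dS=|\tau_1\times\tau_2|\,du$. Let $w=\partial_t\Phi$ be the velocity of the surface points and $w_\nu=w\cdot\nu_\Sigma$. For a vector field $a$ on the surface let $a^\parallel=a-(a\cdot\nu_\Sigma)\nu_\Sigma$ and $\nabla_\Sigma\cdot a=g^{\alpha\beta}\,\partial_{u_\alpha}a\cdot\tau_\beta$. The mean curvature is $\kappa_M=\frac12 g^{\alpha\beta}\,\partial_{u_\beta}\tau_\alpha\cdot\nu_\Sigma$. For each $t\in\,]0,T[$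 let $V_1(t)$, $V_2(t)$ and $\Sigma(t)$ be pairwise disjoint with union $\Omega(t)\subseteq\mathbb R^3$, such that the space-time sets $\{(t,x):x\in V_i(t)\}$ ($i=1,2$) and $\{(t,x):x\in\Omega(t)\}$ are open, and let $\nu_\Sigma$ point from $V_1(t)$ into $V_2(t)$. A function on $\{(t,x):x\in V_1(t)\cup V_2(t)\}$ is called piecewise $C^k$ if on either side of the surface it is $C^k$ up to the surface, i.e. near each point of that side or of the surface it coincides on that side with a function that is $C^k$ around the point. Write $[\![f]\!]=f_2-f_1$ on $\Sigma(t)$, where $f_i$ is the limit of $f(t,\cdot)$ from $V_i(t)$. The particles move by homeomorphisms $\chi^t:\mathbb R^3\to\mathbb R^3$, $t\in[0,T]$, with $\chi^0=\mathrm{id}$, such that $\chi^t(y)$ and $(\chi^t)^{-1}(x)$ are jointly continuous and are piecewise $C^1$ (for $\chi$: with respect to the pulled back regions and surface in the variables $(t,y)$); their velocity is $v$, that is $\partial_t\chi^t(y)=v(t,\chi^t(y))$ whenever $\chi^t(y)\in V_1(t)\cup V_2(t)$. The velocity $v$ and the volume density $\psi$ are piecewise $C^1$; the volume flux $j$ and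 the volume source $\xi$ are piecewise $C^0$. On the surface there are a density $\psi_\Sigma$ which is $C^1$ as a function of $(t,u)$, and, for each $t$, a flux $j_\Sigma$ which is $C^1$ and a source $\xi_\Sigma$ which is continuous as functions of $u$. **Hypothesis (integral balance law).** At time $t\in\,]0,T[$, a control volume is a bounded open set $\mathcal V(t)$ with $\overline{\mathcal V(t)}\subset\Omega(t)$ whose boundary $\mathcal S$ consists of finitely many smooth ($C^1$) pieces and which contains the singular surface piece $\Sigma_{\mathcal V}(t)=\mathcal V(t)\cap\Sigma(t)=\Phi(t,D)$, where $D$ is open, $\overline D$ is a compact subset of $\mathcal U$, $\overline{\mathcal V(t)}\cap\Sigma(t)=\Phi(t,\overline D)$, and $\partial D$ consists of finitely many smooth ($C^1$) curves. For $s$ near $t$ let $\mathcal V(s)=\chi^s[(\chi^t)^{-1}[\mathcal V(t)]]$ be the material volume, $\mathcal V_i(s)=\mathcal V(s)\cap V_i(s)$, and let $\Sigma_{\mathcal V}(s)=\Phi(s,D)$ be the surface piece transported by the flow of the surface. Suppose that for every $t\in\,]0,T[$ and every such control volume the derivative at $s=t$ exists and $$\frac{d}{ds}\Big|_{s=t}\Big(\int_{\mathcal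 V_1(s)\cup\mathcal V_2(s)}\psi\,dV+\int_{\Sigma_{\mathcal V}(s)}\psi_\Sigma\,dS\Big)=-\int_{\mathcal S}j\cdot\nu\,dS-\int_{\partial\Sigma_{\mathcal V}(t)}j_\Sigma\cdot\nu_{\partial\Sigma}\,dl+\int_{\mathcal V_1(t)\cup\mathcal V_2(t)}\xi\,dV+\int_{\Sigma_{\mathcal V}(t)}\xi_\Sigma\,dS ,$$ where $\nu$ is the outer unit normal of $\mathcal V(t)$ and $\nu_{\partial\Sigma}$ is the outer unit conormal, tangential to $\Sigma(t)$ and normal to $\partial\Sigma_{\mathcal V}(t)$. **Conclusion.** At every $t\in\,]0,T[$ and every point $x=\Phi(t,u)\in\Sigma(t)$, $$\mathring\psi_\Sigma+\psi_\Sigma\,\nabla_\Sigma\cdot w+\nabla_\Sigma\cdot j_\Sigma^\parallel-\xi_\Sigma=[\![\psi]\!]\,w_\nu-[\![\psi v+j]\!]\cdot\nu_\Sigma ,$$ where $\mathring\psi_\Sigma(t,\Phi(t,u))=\frac{\partial}{\partial t}\big[\psi_\Sigma(t,\Phi(t,u))\big]$ is the Lagrangian time derivative. If moreover $\psi_\Sigma$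 is given as a function of $(t,x)$ in the surrounding space and is differentiable at $(t,x)$ (for instance smooth near the surface), then, with $\psi_\nu=\nabla_x\psi_\Sigma\cdot\nu_\Sigma$, $$\frac{\partial}{\partial t}\psi_\Sigma+\nabla_\Sigma\cdot(\psi_\Sigma w^\parallel)+(\psi_\nu-2\kappa_M\psi_\Sigma)\,w_\nu+\nabla_\Sigma\cdot j_\Sigma^\parallel-\xi_\Sigma=[\![\psi]\!]\,w_\nu-[\![\psi v+j]\!]\cdot\nu_\Sigma .$$ -/

import Mathlib

open Set Filter Topology MeasureTheory

noncomputable section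

namespace SurfaceBalance

/-- Physical space. -/
abbrev E3 : Type := EuclideanSpace ℝ (Fin 3)

/-- The plane of surface parameters. -/
abbrev P2 : Type := EuclideanSpace ℝ (Fin 2)

/-- The vector product of `ℝ³`. -/
def cross (a b : E3) : E3 := WithLp.toLp 2 (crossProduct a.ofLp b.ofLp)

/-- The partial derivative with respect to the parameter of index `α`. -/
def pd {F : Type*} [NormedAddCommGroup F] [NormedSpace ℝ F] (α : Fin 2) (f : P2 → F) (u : P2) : F :=
  fderiv ℝ f u (EuclideanSpace.single α 1)

/-! ### Geometry of one parametrized surface `X : U → ℝ³`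

Quantities on the surface are written as functions of the parameter `u`. -/

/-- Tangent vectors `τ_α = ∂X/∂u_α`. -/
def tangent (X : P2 → E3) (α : Fin 2) (u : P2) : E3 := pd α X u

/-- `τ₁ × τ₂`. -/
def normalVec (X : P2 → E3) (u : P2) : E3 := cross (tangent X 0 u) (tangent X 1 u)

/-- The unit normal `ν = τ₁ × τ₂ / |τ₁ × τ₂|`. -/
def unitNormal (X : P2 → E3) (u : P2) : E3 := ‖normalVec X u‖⁻¹ • normalVec X u

/-- The area density `√g = |τ₁ × τ₂|`, so that `dS = √g du¹ du²`. -/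
def areaDensity (X : P2 → E3) (u : P2) : ℝ := ‖normalVec X u‖

/-- The metric tensor `g_{αβ} = τ_α · τ_β`. -/
def metric (X : P2 → E3) (u : P2) : Matrix (Fin 2) (Fin 2) ℝ :=
  Matrix.of fun α β => inner ℝ (tangent X α u) (tangent X β u)

/-- The surface divergence `∇_Σ · a = g^{αβ} ∂a/∂u_α · τ_β` of a vector field along the surface. -/
def surfDiv (X : P2 → E3) (a : P2 → E3) (u : P2) : ℝ :=
  ∑ α : Fin 2, ∑ β : Fin 2, (metric X u)⁻¹ α β * inner ℝ (pd α a u) (tangent X β u)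

/-- The tangential part `a - (a · ν) ν` of a vector field along the surface. -/
def tangentialPart (X : P2 → E3) (a : P2 → E3) (u : P2) : E3 :=
  a u - inner ℝ (a u) (unitNormal X u) • unitNormal X u

/-- The mean curvature `κ_M = ½ g^{αβ} b_{αβ}` with `b_{αβ} = ∂τ_α/∂u_β · ν`. -/
def meanCurvature (X : P2 → E3) (u : P2) : ℝ :=
  (1 / 2) * ∑ α : Fin 2, ∑ β : Fin 2,
    (metric X u)⁻¹ α β * inner ℝ (pd β (tangent X α) u) (unitNormal X u)

/-- The surface integral over the piece `X(D)`; the integrand is a function on space. -/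
def surfaceIntegral (X : P2 → E3) (D : Set P2) (f : E3 → ℝ) : ℝ :=
  ∫ u in D, f (X u) * areaDensity X u

/-! ### One-sided limits -/

/-- The limit of `f` at `x` along the set `V`. -/
def sideLimit {F : Type*} [TopologicalSpace F] [Nonempty F] (V : Set E3) (f : E3 → F) (x : E3) : F :=
  limUnder (𝓝[V] x) f

/-- The jump `⟦f⟧ = f₂ - f₁` at `x`, where `f_i` is the limit from `V_i`. -/
def jump {F : Type*} [NormedAddCommGroup F] (V₁ V₂ : Set E3) (f : E3 → F) (x : E3) : F :=
  sideLimit V₂ f x - sideLimit V₁ f x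

/-- `f` is of class `C^k` on the open space-time region `Q` up to the part `S` of its boundary:
near every point of `Q ∪ S` it coincides on `Q` with a function which is `C^k` around that point. -/
def SmoothUpTo {F : Type*} [NormedAddCommGroup F] [NormedSpace ℝ F] (k : ℕ)
    (Q S : Set (ℝ × E3)) (f : ℝ × E3 → F) : Prop :=
  ∀ p ∈ Q ∪ S, ∃ g : ℝ × E3 → F, ContDiffAt ℝ k g p ∧ f =ᶠ[𝓝[Q] p] g

/-! ### The moving singular surface -/

/-- The space-time region of a family of subsets of space, for times in `]0,T[`. -/
def spaceTime (T : ℝ) (V : ℝ → Set E3) : Set (ℝ × E3) := {p | p.1 ∈ Ioo 0 T ∧ p.2 ∈ V p.1}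

/-- The surfaces `Σ(t) = Φ(t, U)` form a smoothly moving embedded surface which, at each time `t` of
`]0,T[`, separates an open region into the open sets `V₁ t` and `V₂ t`; the unit normal points from
`V₁ t` into `V₂ t`. -/
structure IsSingularSurface (T : ℝ) (U : Set P2) (Φ : ℝ → P2 → E3) (V₁ V₂ : ℝ → Set E3) :
    Prop where
  isOpen_param : IsOpen U
  smooth : ContDiffOn ℝ 2 (fun p : ℝ × P2 => Φ p.1 p.2) (Ioo 0 T ×ˢ U)
  immersion : ∀ t ∈ Ioo 0 T, ∀ u ∈ U, LinearIndependent ℝ (fun α => tangent (Φ t) α u)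
  embedding : IsEmbedding
    ((Ioo 0 T ×ˢ U).domRestrict (fun p : ℝ × P2 => ((p.1, Φ p.1 p.2) : ℝ × E3)))
  isOpen₁ : IsOpen (spaceTime T V₁)
  isOpen₂ : IsOpen (spaceTime T V₂)
  isOpen_region : IsOpen (spaceTime T fun t => V₁ t ∪ Φ t '' U ∪ V₂ t)
  disjoint₁₂ : ∀ t ∈ Ioo 0 T, Disjoint (V₁ t) (V₂ t)
  disjoint₁ : ∀ t ∈ Ioo 0 T, Disjoint (V₁ t) (Φ t '' U)
  disjoint₂ : ∀ t ∈ Ioo 0 T, Disjoint (V₂ t) (Φ t '' U)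
  normal_direction : ∀ t ∈ Ioo 0 T, ∀ u ∈ U, ∀ᶠ l in 𝓝[>] (0 : ℝ),
    Φ t u + l • unitNormal (Φ t) u ∈ V₂ t ∧ Φ t u - l • unitNormal (Φ t) u ∈ V₁ t

/-- The velocity `w = ∂Φ/∂t` of the surface points, as a function of the parameter. -/
def surfVelocity (Φ : ℝ → P2 → E3) (t : ℝ) (u : P2) : E3 := deriv (fun s => Φ s u) t

/-- The normal velocity `w_ν = w · ν_Σ`. -/
def normalVelocity (Φ : ℝ → P2 → E3) (t : ℝ) (u : P2) : ℝ :=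
  inner ℝ (surfVelocity Φ t u) (unitNormal (Φ t) u)

/-- A volume field, i.e. a function of time and space, which is `C^k` on either side of the surface
up to the surface. -/
def IsPiecewiseSmooth {F : Type*} [NormedAddCommGroup F] [NormedSpace ℝ F] (k : ℕ) (T : ℝ)
    (U : Set P2) (Φ : ℝ → P2 → E3) (V₁ V₂ : ℝ → Set E3) (f : ℝ → E3 → F) : Prop :=
  SmoothUpTo k (spaceTime T V₁) (spaceTime T fun t => Φ t '' U) (fun p => f p.1 p.2) ∧
  SmoothUpTo k (spaceTime T V₂) (spaceTime T fun t => Φ t '' U) (fun p => f p.1 p.2)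

/-! ### The motion of the particles -/

/-- `χ` is a motion with velocity field `v`: a continuous family of homeomorphisms of space which
starts at the identity, whose trajectories have the velocity `v` off the surface, and which
together with its inverse is `C¹` on either side of the surface up to the surface (for `χ` in the
variables `(t, y)`, where `y` is the initial position of the particle). -/
structure IsMotion (T : ℝ) (U : Set P2) (Φ : ℝ → P2 → E3) (V₁ V₂ : ℝ → Set E3)
    (χ : ℝ → E3 ≃ₜ E3) (v : ℝ → E3 → E3) : Prop where
  initial : ∀ y, χ 0 y = y
  continuous : ContinuousOn (fun p : ℝ × E3 => χ p.1 p.2) (Icc 0 T ×ˢ univ)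
  continuous_symm : ContinuousOn (fun p : ℝ × E3 => (χ p.1).symm p.2) (Icc 0 T ×ˢ univ)
  velocity : ∀ t ∈ Ioo 0 T, ∀ y, χ t y ∈ V₁ t ∪ V₂ t →
    HasDerivAt (fun s => χ s y) (v t (χ t y)) t
  smooth₁ : SmoothUpTo 1 (spaceTime T fun t => χ t ⁻¹' V₁ t)
    (spaceTime T fun t => χ t ⁻¹' (Φ t '' U)) (fun p => χ p.1 p.2)
  smooth₂ : SmoothUpTo 1 (spaceTime T fun t => χ t ⁻¹' V₂ t)
    (spaceTime T fun t => χ t ⁻¹' (Φ t '' U)) (fun p => χ p.1 p.2)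
  smooth_symm : IsPiecewiseSmooth 1 T U Φ V₁ V₂ (fun t x => (χ t).symm x)

/-! ### Control volumes -/

/-- The boundary of the set `K` consists of finitely many smooth pieces `b i (closure (O i))`,
parametrized so that `τ₁ × τ₂` is an outward normal of `K`. -/
structure PiecewiseSmoothBoundary (K : Set E3) where
  m : ℕ
  O : Fin m → Set P2
  b : Fin m → P2 → E3
  isOpen : ∀ i, IsOpen (O i)
  isBounded : ∀ i, Bornology.IsBounded (O i)
  null_frontier : ∀ i, volume (frontier (O i)) = 0
  smooth : ∀ i, ∀ q ∈ closure (O i), ContDiffAt ℝ 1 (b i) q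
  injOn : ∀ i, InjOn (b i) (O i)
  immersion : ∀ i, ∀ q ∈ O i, LinearIndependent ℝ (fun α => tangent (b i) α q)
  disjoint : Pairwise fun i k => Disjoint (b i '' O i) (b k '' O k)
  cover : frontier K = ⋃ i, b i '' closure (O i)
  outward : ∀ i, ∀ q ∈ O i, ∀ᶠ l in 𝓝[>] (0 : ℝ),
    b i q + l • unitNormal (b i) q ∉ K ∧ b i q - l • unitNormal (b i) q ∈ K

/-- The flux `∫_{∂K} F · ν dS` through the boundary, `ν` the outer unit normal. -/
def PiecewiseSmoothBoundary.flux {K : Set E3} (B : PiecewiseSmoothBoundary K) (F : E3 → E3) : ℝ :=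
  ∑ i, ∫ q in B.O i, inner ℝ (F (B.b i q)) (unitNormal (B.b i) q) * areaDensity (B.b i) q

/-- Rotation of the parameter plane by a right angle, counter-clockwise. -/
def rotate (a : P2) : P2 := !₂[-(a 1), a 0]

/-- The boundary of the plane set `D` consists of finitely many smooth curves, run through so that
`D` is on the left. -/
structure PiecewiseSmoothBoundaryCurve (D : Set P2) where
  n : ℕ
  γ : Fin n → ℝ → P2
  smooth : ∀ k, ∀ s ∈ Icc (0 : ℝ) 1, ContDiffAt ℝ 1 (γ k) s
  injOn : ∀ k, InjOn (γ k) (Ioo 0 1)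
  regular : ∀ k, ∀ s ∈ Ioo (0 : ℝ) 1, deriv (γ k) s ≠ 0
  disjoint : Pairwise fun i k => Disjoint (γ i '' Ioo 0 1) (γ k '' Ioo 0 1)
  cover : frontier D = ⋃ k, γ k '' Icc 0 1
  onLeft : ∀ k, ∀ s ∈ Ioo (0 : ℝ) 1, ∀ᶠ l in 𝓝[>] (0 : ℝ),
    γ k s + l • rotate (deriv (γ k) s) ∈ D ∧ γ k s - l • rotate (deriv (γ k) s) ∉ D

/-- The flux `∫_{∂Σ} F · ν_{∂Σ} dl` through the boundary curve of the surface piece `X(D)`. The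
outer conormal is `ν_{∂Σ} = τ × ν_Σ`, and `τ dl` is the derivative of the curve `X ∘ γ`. -/
def PiecewiseSmoothBoundaryCurve.flux {D : Set P2} (C : PiecewiseSmoothBoundaryCurve D)
    (X : P2 → E3) (F : E3 → E3) : ℝ :=
  ∑ k, ∫ s in (0 : ℝ)..1, inner ℝ (F (X (C.γ k s)))
    (cross (deriv (fun r => X (C.γ k r)) s) (unitNormal X (C.γ k s)))

/-- `K` is a control volume inside the region `V₁ ∪ X(U) ∪ V₂`: a bounded open set with piecewise
smooth boundary, whose closure lies in the region, and which the surface `X(U)` meets in the piece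
`X(D)`, where `D` has a piecewise smooth boundary. -/
structure ControlVolume (X : P2 → E3) (U : Set P2) (V₁ V₂ : Set E3) (K : Set E3) where
  isOpen : IsOpen K
  isBounded : Bornology.IsBounded K
  closure_subset : closure K ⊆ V₁ ∪ X '' U ∪ V₂
  boundary : PiecewiseSmoothBoundary K
  D : Set P2
  isOpen_piece : IsOpen D
  isCompact_closure_piece : IsCompact (closure D)
  closure_piece_subset : closure D ⊆ U
  inter_surface : K ∩ X '' U = X '' D
  closure_inter_surface : closure K ∩ X '' U = X '' closure D
  curve : PiecewiseSmoothBoundaryCurve D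

/-- The integral balance law at time `t` for the material volume `V(s) = χ^s[R]`, which at time `t` is
the control volume `C` with singular surface piece `Φ(t, D)`: the time derivative of
`∫_{V₁ ∪ V₂} ψ dV + ∫_Σ ψ_Σ dS` is
`- ∫_{∂V} j · ν dS - ∫_{∂Σ} j_Σ · ν_{∂Σ} dl + ∫_{V₁ ∪ V₂} ξ dV + ∫_Σ ξ_Σ dS`.
The surface piece is transported by the flow of the surface, i.e. it is `Φ(s, D)` at time `s`. -/
def IntegralBalance (U : Set P2) (Φ : ℝ → P2 → E3) (V₁ V₂ : ℝ → Set E3) (χ : ℝ → E3 ≃ₜ E3)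
    (ψ ξ : ℝ → E3 → ℝ) (j : ℝ → E3 → E3) (ψS ξS : ℝ → E3 → ℝ) (jS : ℝ → E3 → E3)
    (t : ℝ) (R : Set E3) (C : ControlVolume (Φ t) U (V₁ t) (V₂ t) (χ t '' R)) : Prop :=
  HasDerivAt
    (fun s => (∫ x in (χ s '' R) ∩ (V₁ s ∪ V₂ s), ψ s x) + surfaceIntegral (Φ s) C.D (ψS s))
    (-C.boundary.flux (j t) - C.curve.flux (Φ t) (jS t)
      + (∫ x in (χ t '' R) ∩ (V₁ t ∪ V₂ t), ξ t x) + surfaceIntegral (Φ t) C.D (ξS t)) t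

end SurfaceBalance

end

/-!
The balance law is applied to flat curvilinear boxes around a point `x₀ = Φ t u₀` of the surface.
With `n` the unit normal at `x₀`, the map `chart Φ u₀ n (s, q) = Φ s (u₀ + (q₀, q₁)) + q₂ • n` is for
each time `s` near `t` a diffeomorphism of a neighbourhood of `0` which flattens the surface: the two
sides are `q₂ < 0` and `q₂ > 0` (`exists_isChart`; the inverse function theorem in space-time, the
embedding property and a connectedness argument). The control volume (`pillboxVolume`) is the image
at time `t` of the box with half side lengths `ε, ε, δ ε`; its six faces and the four sides of the
square which it cuts out of the surface are smooth.

Every term of the balance law is `c · 4 ε²` for some constant `c`, up to an error which is at most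
`C δ ε²` once `ε` is small, depending on `δ` (`IsApprox`). The constants on the two sides of the
balance law are therefore equal (`IsApprox.unique`), which is the jump condition multiplied by the
area density of the surface at `u₀`.

* The volume content (`volume_term`). A particle near `x₀` moves Lipschitz continuously in time, and
  as long as it stays on one side of the surface, its third coordinate changes at the rate
  `v · n - w_ν` (`IsMotion.normal_displacement`). Hence the part of the material volume on one side
  lies between two boxes whose thickness changes at this rate, up to `O(δ |s - t|)`, and whose lateral
  faces move by `O(|s - t|)`, which does not matter since they are thin (`materialPart_sandwich`). This
  avoids the transport theorem for a region whose boundary need not stay smooth.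
* The surface content (`square_integral_rate`), with `∂ₜ √g = √g ∇_Σ · w` (`hasDerivAt_areaDensity`).
* The volume flux (`isApprox_box_flux`). Only the top and the bottom face contribute, and they give
  the jump of `j · n`.
* The surface flux (`isApprox_squareFlux`). The flux through the boundary curve is the integral of a
  1-form along the sides of a square, and its limit is the exterior derivative of the 1-form, which is
  `√g ∇_Σ · j_Σ^∥` (`pd_fluxForm_sub`).
* The volume source is negligible (`isApprox_source`), and the surface source contributes its value.

The form with the partial time derivative follows by the chain rule (`lagrangian_eq_eulerian`), since
`∇_Σ · ν = - 2 κ_M` and `w = w^∥ + w_ν ν`.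
-/

noncomputable section

namespace SurfaceBalance

/-! ### Vector algebra -/

lemma inner_eq_sum (a b : E3) : inner ℝ a b = a 0 * b 0 + a 1 * b 1 + a 2 * b 2 := by
  simp [PiLp.inner_apply, Fin.sum_univ_three, mul_comm]

@[simp] lemma cross_apply_zero (a b : E3) : cross a b 0 = a 1 * b 2 - a 2 * b 1 := by
  simp [cross, crossProduct]

@[simp] lemma cross_apply_one (a b : E3) : cross a b 1 = a 2 * b 0 - a 0 * b 2 := by
  simp [cross, crossProduct]

@[simp] lemma cross_apply_two (a b : E3) : cross a b 2 = a 0 * b 1 - a 1 * b 0 := by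
  simp [cross, crossProduct]

lemma ext_three {a b : E3} (h0 : a 0 = b 0) (h1 : a 1 = b 1) (h2 : a 2 = b 2) : a = b := by
  ext i; fin_cases i <;> assumption

/-- The vector product as a continuous bilinear map. -/
def crossL : E3 →L[ℝ] E3 →L[ℝ] E3 :=
  LinearMap.toContinuousBilinearMap (LinearMap.mk₂ ℝ cross
    (fun a b c => ext_three (by simp; ring) (by simp; ring) (by simp; ring))
    (fun r a b => ext_three (by simp; ring) (by simp; ring) (by simp; ring))
    (fun a b c => ext_three (by simp; ring) (by simp; ring) (by simp; ring))
    (fun r a b => ext_three (by simp; ring) (by simp; ring) (by simp; ring)))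

@[simp] lemma crossL_apply (a b : E3) : crossL a b = cross a b := rfl

lemma cross_add_left (a b c : E3) : cross (a + b) c = cross a c + cross b c := by
  simp [← crossL_apply]

lemma cross_smul_left (r : ℝ) (a b : E3) : cross (r • a) b = r • cross a b := by
  simp [← crossL_apply]
lemma cross_smul_right (r : ℝ) (a b : E3) : cross a (r • b) = r • cross a b := by
  simp [← crossL_apply]

lemma inner_cross_cyclic (a b c : E3) : inner ℝ (cross a b) c = inner ℝ a (cross b c) := by
  simp [inner_eq_sum]; ring

lemma inner_cross_swap (a b c : E3) : inner ℝ a (cross b c) = - inner ℝ a (cross c b) := by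
  simp [inner_eq_sum]; ring

lemma inner_cross_rotate (a b c : E3) : inner ℝ a (cross b c) = inner ℝ b (cross c a) := by
  simp [inner_eq_sum]; ring

lemma cross_swap (a b : E3) : cross a b = - cross b a :=
  ext_three (by simp; ring) (by simp; ring) (by simp; ring)

lemma inner_cross_left_self (a b : E3) : inner ℝ a (cross a b) = 0 := by
  simp [inner_eq_sum]; ring

lemma inner_cross_right_self (a b : E3) : inner ℝ b (cross a b) = 0 := by
  simp [inner_eq_sum]; ring

lemma cross_cross (a b c : E3) : cross a (cross b c) = inner ℝ a c • b - inner ℝ a b • c := by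
  apply ext_three <;> simp [inner_eq_sum] <;> ring

lemma norm_sq_cross (a b : E3) :
    ‖cross a b‖ ^ 2 = inner ℝ a a * inner ℝ b b - inner ℝ a b * inner ℝ a b := by
  rw [← real_inner_self_eq_norm_sq]; simp only [inner_eq_sum, cross_apply_zero, cross_apply_one, cross_apply_two]; ring

/-- The vector product of two vectors orthogonal to a unit vector `ν` is a multiple of `ν`. -/
lemma cross_eq_smul_of_orthogonal {ν a b : E3} (hν : ‖ν‖ = 1) (ha : inner ℝ ν a = 0)
    (hb : inner ℝ ν b = 0) : cross a b = inner ℝ ν (cross a b) • ν := by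
  have h1 : cross ν (cross ν (cross a b)) = 0 := by
    rw [cross_cross ν a b, ha, hb]; simp [← crossL_apply]
  rw [cross_cross, real_inner_self_eq_norm_sq, hν] at h1
  simpa [sub_eq_zero, eq_comm] using h1

lemma linearIndependent_pair_cross {a : Fin 2 → E3} (h : LinearIndependent ℝ a) :
    cross (a 0) (a 1) ≠ 0 := by
  intro h0
  have key : ∀ w : E3, inner ℝ (a 1) w • a 0 + (-inner ℝ (a 0) w) • a 1 = 0 := by
    intro w
    have := cross_cross w (a 0) (a 1)
    rw [h0] at this
    simp only [← crossL_apply, map_zero] at this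
    rw [real_inner_comm, real_inner_comm w (a 0), neg_smul, ← sub_eq_add_neg]; exact this.symm
  have h2 := Fintype.linearIndependent_iff.1 h ![inner ℝ (a 1) (a 1), -inner ℝ (a 0) (a 1)]
    (by simpa [Fin.sum_univ_two] using key (a 1)) 0
  exact h.ne_zero 1 (inner_self_eq_zero.1 h2)

/-! ### Differentiation along the surface -/

lemma pd_inner {f g : P2 → E3} {u : P2} (α : Fin 2) (hf : DifferentiableAt ℝ f u)
    (hg : DifferentiableAt ℝ g u) :
    pd α (fun u => inner ℝ (f u) (g u)) u
      = inner ℝ (pd α f u) (g u) + inner ℝ (f u) (pd α g u) := by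
  simp only [pd]; rw [fderiv_inner_apply ℝ hf hg, add_comm]

lemma hasFDerivAt_cross {E : Type*} [NormedAddCommGroup E] [NormedSpace ℝ E] {f g : E → E3}
    {x : E} {f' g' : E →L[ℝ] E3} (hf : HasFDerivAt f f' x) (hg : HasFDerivAt g g' x) :
    HasFDerivAt (fun y => cross (f y) (g y))
      (crossL.precompR E (f x) g' + crossL.precompL E f' (g x)) x :=
  crossL.hasFDerivAt_of_bilinear hf hg

lemma pd_cross {f g : P2 → E3} {u : P2} (α : Fin 2) (hf : DifferentiableAt ℝ f u)
    (hg : DifferentiableAt ℝ g u) :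
    pd α (fun u => cross (f u) (g u)) u = cross (pd α f u) (g u) + cross (f u) (pd α g u) := by
  simp only [pd]
  rw [(hasFDerivAt_cross hf.hasFDerivAt hg.hasFDerivAt).fderiv]
  simp [add_comm]

lemma pd_smul {c : P2 → ℝ} {f : P2 → E3} {u : P2} (α : Fin 2) (hc : DifferentiableAt ℝ c u)
    (hf : DifferentiableAt ℝ f u) :
    pd α (fun u => c u • f u) u = pd α c u • f u + c u • pd α f u := by
  simp only [pd]
  rw [fderiv_fun_smul hc hf]; simp [add_comm]

lemma pd_sub {f g : P2 → E3} {u : P2} (α : Fin 2) (hf : DifferentiableAt ℝ f u)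
    (hg : DifferentiableAt ℝ g u) :
    pd α (fun u => f u - g u) u = pd α f u - pd α g u := by
  simp only [pd]; rw [fderiv_fun_sub hf hg]; rfl

lemma contDiffAt_cross {E : Type*} [NormedAddCommGroup E] [NormedSpace ℝ E] {f g : E → E3}
    {x : E} {k : WithTop ℕ∞} (hf : ContDiffAt ℝ k f x) (hg : ContDiffAt ℝ k g x) :
    ContDiffAt ℝ k (fun y => cross (f y) (g y)) x :=
  crossL.isBoundedBilinearMap.contDiff.contDiffAt.comp x (hf.prodMk hg)

/-- The surface divergence in terms of the vector product: the reciprocal tangent vectors are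
`τ₂ × N / |N|²` and `N × τ₁ / |N|²` with `N = τ₁ × τ₂`. -/
lemma surfDiv_eq (X a : P2 → E3) (u : P2) :
    surfDiv X a u = (‖normalVec X u‖ ^ 2)⁻¹ *
      (inner ℝ (pd 0 a u) (cross (tangent X 1 u) (normalVec X u))
        + inner ℝ (pd 1 a u) (cross (normalVec X u) (tangent X 0 u))) := by
  have hdet : (metric X u).det = ‖normalVec X u‖ ^ 2 := by
    rw [normalVec, norm_sq_cross, Matrix.det_fin_two]
    simp [metric, real_inner_comm]
  have h1 : cross (normalVec X u) (tangent X 0 u)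
      = inner ℝ (tangent X 0 u) (tangent X 0 u) • tangent X 1 u
        - inner ℝ (tangent X 0 u) (tangent X 1 u) • tangent X 0 u := by
    rw [cross_swap, normalVec, cross_cross]; simp
  have h2 : cross (tangent X 1 u) (normalVec X u)
      = inner ℝ (tangent X 1 u) (tangent X 1 u) • tangent X 0 u
        - inner ℝ (tangent X 0 u) (tangent X 1 u) • tangent X 1 u := by
    rw [normalVec, cross_cross, real_inner_comm (tangent X 0 u)]
  rw [surfDiv, Matrix.inv_def, hdet, h1, h2, Matrix.adjugate_fin_two]
  simp [Fin.sum_univ_two, metric, inner_sub_right, inner_smul_right, real_inner_comm]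
  ring

lemma normalVec_ne_zero {X : P2 → E3} {u : P2}
    (h : LinearIndependent ℝ (fun α => tangent X α u)) : normalVec X u ≠ 0 :=
  linearIndependent_pair_cross h

lemma norm_unitNormal {X : P2 → E3} {u : P2} (h : normalVec X u ≠ 0) : ‖unitNormal X u‖ = 1 := by
  rw [unitNormal, norm_smul, norm_inv, norm_norm, inv_mul_cancel₀ (norm_ne_zero_iff.2 h)]

lemma normalVec_eq_smul {X : P2 → E3} {u : P2} :
    normalVec X u = areaDensity X u • unitNormal X u := by
  by_cases h : normalVec X u = 0
  · simp [areaDensity, h]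
  · rw [unitNormal, areaDensity, smul_smul, mul_inv_cancel₀ (norm_ne_zero_iff.2 h), one_smul]

lemma inner_tangent_unitNormal (X : P2 → E3) (α : Fin 2) (u : P2) :
    inner ℝ (tangent X α u) (unitNormal X u) = 0 := by
  rw [unitNormal, inner_smul_right, normalVec]
  fin_cases α
  · simp [inner_cross_left_self]
  · simp [inner_cross_right_self]

lemma areaDensity_mul_surfDiv {X : P2 → E3} {u : P2} (a : P2 → E3) (h : normalVec X u ≠ 0) :
    areaDensity X u * surfDiv X a u =
      inner ℝ (pd 0 a u) (cross (tangent X 1 u) (unitNormal X u))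
        + inner ℝ (pd 1 a u) (cross (unitNormal X u) (tangent X 0 u)) := by
  have h' : ‖normalVec X u‖ ≠ 0 := norm_ne_zero_iff.2 h
  rw [surfDiv_eq, areaDensity, unitNormal, cross_smul_left, cross_smul_right, inner_smul_right,
    inner_smul_right]
  field_simp

lemma contDiffAt_tangent {X : P2 → E3} {u : P2} (hX : ContDiffAt ℝ 2 X u) (α : Fin 2) :
    ContDiffAt ℝ 1 (tangent X α) u := by
  have := hX.fderiv_right (m := 1) (by norm_num)
  exact this.clm_apply contDiffAt_const

lemma contDiffAt_normalVec {X : P2 → E3} {u : P2} (hX : ContDiffAt ℝ 2 X u) :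
    ContDiffAt ℝ 1 (normalVec X) u :=
  contDiffAt_cross (contDiffAt_tangent hX 0) (contDiffAt_tangent hX 1)

lemma contDiffAt_unitNormal {X : P2 → E3} {u : P2} (hX : ContDiffAt ℝ 2 X u)
    (h : normalVec X u ≠ 0) : ContDiffAt ℝ 1 (unitNormal X) u :=
  (((contDiffAt_normalVec hX).norm ℝ h).inv (norm_ne_zero_iff.2 h)).smul (contDiffAt_normalVec hX)

/-- The symmetry of the second derivatives of the parametrization. -/
lemma pd_tangent_comm {X : P2 → E3} {u : P2} (hX : ContDiffAt ℝ 2 X u) (α β : Fin 2) :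
    pd α (tangent X β) u = pd β (tangent X α) u := by
  have hs := hX.isSymmSndFDerivAt (by simp)
  have hd : DifferentiableAt ℝ (fderiv ℝ X) u :=
    (hX.fderiv_right (m := 1) (by norm_num)).differentiableAt (by norm_num)
  have key : ∀ α β : Fin 2, pd α (tangent X β) u
      = fderiv ℝ (fderiv ℝ X) u (EuclideanSpace.single α 1) (EuclideanSpace.single β 1) := by
    intro α β
    rw [pd, show tangent X β = fun y => fderiv ℝ X y (EuclideanSpace.single β 1) from rfl,
      fderiv_clm_apply hd (differentiableAt_const _)]
    simp
  rw [key, key, hs.eq]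

lemma inner_unitNormal_pd {X : P2 → E3} {u : P2} (hX : ContDiffAt ℝ 2 X u)
    (h : normalVec X u ≠ 0) (α : Fin 2) :
    inner ℝ (unitNormal X u) (pd α (unitNormal X) u) = 0 := by
  have hd := (contDiffAt_unitNormal hX h).differentiableAt (by norm_num)
  have hev : (fun u => inner ℝ (unitNormal X u) (unitNormal X u)) =ᶠ[𝓝 u] fun _ => (1 : ℝ) := by
    filter_upwards [(contDiffAt_normalVec hX).continuousAt.eventually_ne h] with y hy
    rw [real_inner_self_eq_norm_sq, norm_unitNormal hy]; norm_num
  have h1 := pd_inner α hd hd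
  rw [pd, hev.fderiv_eq] at h1
  simp only [fderiv_fun_const, Pi.zero_apply, zero_apply] at h1
  linarith [real_inner_comm (unitNormal X u) (pd α (unitNormal X) u)]

/-- The Weingarten relation `∂τ_α/∂u_β · ν = - τ_α · ∂ν/∂u_β`. -/
lemma inner_pd_tangent_unitNormal {X : P2 → E3} {u : P2} (hX : ContDiffAt ℝ 2 X u)
    (h : normalVec X u ≠ 0) (α β : Fin 2) :
    inner ℝ (pd β (tangent X α) u) (unitNormal X u)
      = - inner ℝ (tangent X α u) (pd β (unitNormal X) u) := by
  have h1 := pd_inner β ((contDiffAt_tangent hX α).differentiableAt (by norm_num))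
    ((contDiffAt_unitNormal hX h).differentiableAt (by norm_num))
  have h0 : (fun u => inner ℝ (tangent X α u) (unitNormal X u)) = fun _ => (0 : ℝ) :=
    funext fun y => inner_tangent_unitNormal X α y
  rw [h0, pd] at h1
  simp only [fderiv_fun_const, Pi.zero_apply, zero_apply] at h1
  linarith

/-- The mean curvature is minus half of the surface divergence of the unit normal. -/
lemma two_mul_meanCurvature {X : P2 → E3} {u : P2} (hX : ContDiffAt ℝ 2 X u)
    (h : normalVec X u ≠ 0) :
    2 * meanCurvature X u = - surfDiv X (unitNormal X) u := by
  have e : ∀ α β, inner ℝ (pd β (tangent X α) u) (unitNormal X u)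
      = - inner ℝ (pd α (unitNormal X) u) (tangent X β u) := fun α β => by
    rw [pd_tangent_comm hX β α, inner_pd_tangent_unitNormal hX h, real_inner_comm]
  simp only [meanCurvature, surfDiv, Fin.sum_univ_two, e]
  ring

lemma surfDiv_smul {X : P2 → E3} {u : P2} {c : P2 → ℝ} {f : P2 → E3}
    (hc : DifferentiableAt ℝ c u) (hf : DifferentiableAt ℝ f u) :
    surfDiv X (fun u => c u • f u) u = c u * surfDiv X f u +
      (‖normalVec X u‖ ^ 2)⁻¹ * inner ℝ (f u)
        (pd 0 c u • cross (tangent X 1 u) (normalVec X u)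
          + pd 1 c u • cross (normalVec X u) (tangent X 0 u)) := by
  simp only [surfDiv_eq, pd_smul _ hc hf, inner_add_left, inner_add_right, inner_smul_left,
    inner_smul_right]
  simp
  ring

lemma surfDiv_sub {X : P2 → E3} {u : P2} {f g : P2 → E3}
    (hf : DifferentiableAt ℝ f u) (hg : DifferentiableAt ℝ g u) :
    surfDiv X (fun u => f u - g u) u = surfDiv X f u - surfDiv X g u := by
  simp only [surfDiv_eq, pd_sub _ hf hg, inner_sub_left]
  ring

lemma surfDiv_smul_unitNormal {X : P2 → E3} {u : P2} {c : P2 → ℝ} (hX : ContDiffAt ℝ 2 X u)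
    (h : normalVec X u ≠ 0) (hc : DifferentiableAt ℝ c u) :
    surfDiv X (fun u => c u • unitNormal X u) u = c u * surfDiv X (unitNormal X) u := by
  rw [surfDiv_smul hc ((contDiffAt_unitNormal hX h).differentiableAt (by norm_num))]
  rw [normalVec_eq_smul]
  simp [inner_add_right, inner_smul_right, cross_smul_left, cross_smul_right,
    inner_cross_right_self, inner_cross_left_self]

lemma differentiableAt_inner_unitNormal {X : P2 → E3} {u : P2} {a : P2 → E3}
    (hX : ContDiffAt ℝ 2 X u) (h : normalVec X u ≠ 0) (ha : DifferentiableAt ℝ a u) :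
    DifferentiableAt ℝ (fun u => inner ℝ (a u) (unitNormal X u)) u :=
  ha.inner ℝ ((contDiffAt_unitNormal hX h).differentiableAt (by norm_num))

lemma surfDiv_tangentialPart {X : P2 → E3} {u : P2} {a : P2 → E3} (hX : ContDiffAt ℝ 2 X u)
    (h : normalVec X u ≠ 0) (ha : DifferentiableAt ℝ a u) :
    surfDiv X (tangentialPart X a) u = surfDiv X a u
      - inner ℝ (a u) (unitNormal X u) * surfDiv X (unitNormal X) u := by
  have hn := (contDiffAt_unitNormal hX h).differentiableAt (by norm_num)
  have hi := differentiableAt_inner_unitNormal hX h ha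
  rw [show tangentialPart X a = fun u => a u - inner ℝ (a u) (unitNormal X u) • unitNormal X u
    from rfl]
  rw [← surfDiv_smul_unitNormal hX h hi]
  exact surfDiv_sub ha (hi.smul hn)

/-- The component `a · (τ_β × ν)` of the one-form whose line integral along a curve in the
surface is the flux of `a` through the curve. -/
def fluxForm (X : P2 → E3) (a : P2 → E3) (β : Fin 2) (u : P2) : ℝ :=
  inner ℝ (a u) (cross (tangent X β u) (unitNormal X u))

lemma contDiffAt_fluxForm {X : P2 → E3} {u : P2} {a : P2 → E3} (hX : ContDiffAt ℝ 2 X u)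
    (h : normalVec X u ≠ 0) (ha : ContDiffAt ℝ 1 a u) (β : Fin 2) :
    ContDiffAt ℝ 1 (fluxForm X a β) u :=
  ha.inner ℝ (contDiffAt_cross (contDiffAt_tangent hX β) (contDiffAt_unitNormal hX h))

/-- The divergence theorem on the surface in infinitesimal form: the exterior derivative of the
flux form is the surface divergence of the tangential part. -/
lemma pd_fluxForm_sub {X : P2 → E3} {u : P2} {a : P2 → E3} (hX : ContDiffAt ℝ 2 X u)
    (h : normalVec X u ≠ 0) (ha : ContDiffAt ℝ 1 a u) :
    pd 0 (fluxForm X a 1) u - pd 1 (fluxForm X a 0) u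
      = areaDensity X u * surfDiv X (tangentialPart X a) u := by
  have hν := contDiffAt_unitNormal hX h
  have dν := hν.differentiableAt (by norm_num)
  have dτ := fun α => (contDiffAt_tangent hX α).differentiableAt (by norm_num)
  have da := ha.differentiableAt (by norm_num)
  have dc := fun α => (contDiffAt_cross (contDiffAt_tangent hX α) hν).differentiableAt (by norm_num)
  have e : ∀ α β, pd α (fluxForm X a β) u = inner ℝ (pd α a u)
      (cross (tangent X β u) (unitNormal X u)) + inner ℝ (a u)
        (cross (pd α (tangent X β) u) (unitNormal X u)
          + cross (tangent X β u) (pd α (unitNormal X) u)) := by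
    intro α β
    rw [show fluxForm X a β = fun u => inner ℝ (a u) (cross (tangent X β u) (unitNormal X u))
      from rfl, pd_inner α da (dc β), pd_cross α (dτ β) dν]
  have ho : ∀ α, inner ℝ (unitNormal X u) (tangent X α u) = 0 := fun α => by
    rw [real_inner_comm, inner_tangent_unitNormal]
  -- `τ_β × ∂_α ν` is normal to the surface
  have hc : ∀ α β, inner ℝ (a u) (cross (tangent X β u) (pd α (unitNormal X) u))
      = inner ℝ (a u) (unitNormal X u)
        * inner ℝ (unitNormal X u) (cross (tangent X β u) (pd α (unitNormal X) u)) := by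
    intro α β
    rw [cross_eq_smul_of_orthogonal (norm_unitNormal h) (ho β) (inner_unitNormal_pd hX h α),
      inner_smul_right, inner_smul_right, real_inner_self_eq_norm_sq, norm_unitNormal h]
    ring
  rw [surfDiv_tangentialPart hX h da, mul_sub, mul_left_comm, areaDensity_mul_surfDiv _ h,
    areaDensity_mul_surfDiv _ h, e, e, pd_tangent_comm hX 1 0, inner_add_right, inner_add_right,
    hc, hc, inner_cross_swap (pd 1 a u) (unitNormal X u),
    inner_cross_rotate (unitNormal X u) (tangent X 1 u),
    inner_cross_rotate (unitNormal X u) (tangent X 0 u),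
    inner_cross_rotate (tangent X 1 u), inner_cross_rotate (tangent X 0 u),
    inner_cross_swap (pd 0 (unitNormal X) u) (unitNormal X u)]
  ring

/-! ### The moving surface -/

section Moving

variable {Φ : ℝ → P2 → E3} {t : ℝ} {u : P2}

lemma hasFDerivAt_slice {E F G : Type*} [NormedAddCommGroup E] [NormedSpace ℝ E]
    [NormedAddCommGroup F] [NormedSpace ℝ F] [NormedAddCommGroup G] [NormedSpace ℝ G]
    {f : E × F → G} {f' : E × F →L[ℝ] G} {p : E × F} (h : HasFDerivAt f f' p) :
    HasFDerivAt (fun y => f (p.1, y)) (f'.comp (ContinuousLinearMap.inr ℝ E F)) p.2 :=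
  HasFDerivAt.comp (f := fun y => (p.1, y)) p.2 h (hasFDerivAt_prodMk_right p.1 p.2)

lemma hasDerivAt_slice {F G : Type*} [NormedAddCommGroup F] [NormedSpace ℝ F]
    [NormedAddCommGroup G] [NormedSpace ℝ G]
    {f : ℝ × F → G} {f' : ℝ × F →L[ℝ] G} {p : ℝ × F} (h : HasFDerivAt f f' p) :
    HasDerivAt (fun s => f (s, p.2)) (f' (1, 0)) p.1 := by
  have := HasFDerivAt.comp (f := fun s => (s, p.2)) p.1 h (hasFDerivAt_prodMk_left p.1 p.2)
  simpa [Function.comp_def] using this.hasDerivAt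

lemma eventually_differentiableAt_uncurry (h : ContDiffAt ℝ 2 (fun p : ℝ × P2 => Φ p.1 p.2) (t, u)) :
    ∀ᶠ p in 𝓝 (t, u), DifferentiableAt ℝ (fun p : ℝ × P2 => Φ p.1 p.2) p := by
  filter_upwards [h.eventually (by simp)] with p hp
  exact hp.differentiableAt (by norm_num)

lemma eventually_tangent_eq (h : ContDiffAt ℝ 2 (fun p : ℝ × P2 => Φ p.1 p.2) (t, u)) (α : Fin 2) :
    ∀ᶠ p in 𝓝 (t, u), tangent (Φ p.1) α p.2
      = fderiv ℝ (fun p : ℝ × P2 => Φ p.1 p.2) p (0, EuclideanSpace.single α 1) := by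
  filter_upwards [eventually_differentiableAt_uncurry h] with p hp
  rw [tangent, pd, (hasFDerivAt_slice hp.hasFDerivAt).fderiv]
  simp

lemma eventually_surfVelocity_eq (h : ContDiffAt ℝ 2 (fun p : ℝ × P2 => Φ p.1 p.2) (t, u)) :
    ∀ᶠ p in 𝓝 (t, u), surfVelocity Φ p.1 p.2
      = fderiv ℝ (fun p : ℝ × P2 => Φ p.1 p.2) p (1, 0) := by
  filter_upwards [eventually_differentiableAt_uncurry h] with p hp
  rw [surfVelocity, (hasDerivAt_slice hp.hasFDerivAt).deriv]

lemma contDiffAt_fderiv_apply (h : ContDiffAt ℝ 2 (fun p : ℝ × P2 => Φ p.1 p.2) (t, u))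
    (e : ℝ × P2) :
    ContDiffAt ℝ 1 (fun p => fderiv ℝ (fun p : ℝ × P2 => Φ p.1 p.2) p e) (t, u) :=
  (h.fderiv_right (m := 1) (by norm_num)).clm_apply contDiffAt_const

lemma contDiffAt_tangent_uncurry (h : ContDiffAt ℝ 2 (fun p : ℝ × P2 => Φ p.1 p.2) (t, u))
    (α : Fin 2) : ContDiffAt ℝ 1 (fun p : ℝ × P2 => tangent (Φ p.1) α p.2) (t, u) :=
  (contDiffAt_fderiv_apply h _).congr_of_eventuallyEq (eventually_tangent_eq h α)

lemma contDiffAt_normalVec_uncurry (h : ContDiffAt ℝ 2 (fun p : ℝ × P2 => Φ p.1 p.2) (t, u)) :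
    ContDiffAt ℝ 1 (fun p : ℝ × P2 => normalVec (Φ p.1) p.2) (t, u) :=
  contDiffAt_cross (contDiffAt_tangent_uncurry h 0) (contDiffAt_tangent_uncurry h 1)

lemma contDiffAt_slice_right {f : ℝ × P2 → E3} {k : WithTop ℕ∞} (h : ContDiffAt ℝ k f (t, u)) :
    ContDiffAt ℝ k (fun u' => f (t, u')) u :=
  ContDiffAt.comp (f := fun u' => (t, u')) u h (contDiffAt_const.prodMk contDiffAt_id)

lemma contDiffAt_surfVelocity (h : ContDiffAt ℝ 2 (fun p : ℝ × P2 => Φ p.1 p.2) (t, u)) :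
    ContDiffAt ℝ 1 (surfVelocity Φ t) u :=
  contDiffAt_slice_right (f := fun p => surfVelocity Φ p.1 p.2)
    ((contDiffAt_fderiv_apply h _).congr_of_eventuallyEq (eventually_surfVelocity_eq h))

lemma hasDerivAt_tangent (h : ContDiffAt ℝ 2 (fun p : ℝ × P2 => Φ p.1 p.2) (t, u)) (α : Fin 2) :
    HasDerivAt (fun s => tangent (Φ s) α u) (pd α (surfVelocity Φ t) u) t := by
  set F := fun p : ℝ × P2 => Φ p.1 p.2 with hF
  have hs := h.isSymmSndFDerivAt (by simp)
  have hd : HasFDerivAt (fderiv ℝ F) (fderiv ℝ (fderiv ℝ F) (t, u)) (t, u) :=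
    ((h.fderiv_right (m := 1) (by norm_num)).differentiableAt (by norm_num)).hasFDerivAt
  have h1 := hasDerivAt_slice (hd.clm_apply
    (hasFDerivAt_const ((0, EuclideanSpace.single α 1) : ℝ × P2) (t, u)))
  have h2 := hasFDerivAt_slice (hd.clm_apply (hasFDerivAt_const ((1, 0) : ℝ × P2) (t, u)))
  have c1 : Tendsto (fun s : ℝ => (s, u)) (𝓝 t) (𝓝 (t, u)) := by
    apply Continuous.tendsto' (by fun_prop) _ _ rfl
  have c2 : Tendsto (fun y : P2 => (t, y)) (𝓝 u) (𝓝 (t, u)) := by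
    apply Continuous.tendsto' (by fun_prop) _ _ rfl
  have h3 := h1.congr_of_eventuallyEq (c1.eventually (eventually_tangent_eq h α))
  have h4 := h2.congr_of_eventuallyEq (c2.eventually (eventually_surfVelocity_eq h))
  rw [pd, h4.fderiv]
  refine h3.congr_deriv ?_
  simpa using (hs (1, 0) (0, EuclideanSpace.single α 1))

/-- The rate of change of the area density of the moving surface is `√g ∇_Σ · w`. -/
lemma hasDerivAt_areaDensity (h : ContDiffAt ℝ 2 (fun p : ℝ × P2 => Φ p.1 p.2) (t, u))
    (hN : normalVec (Φ t) u ≠ 0) :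
    HasDerivAt (fun s => areaDensity (Φ s) u)
      (areaDensity (Φ t) u * surfDiv (Φ t) (surfVelocity Φ t) u) t := by
  have h2 := crossL.hasDerivAt_of_bilinear (fun _ => hasDerivAt_tangent h 0)
    (fun _ => hasDerivAt_tangent h 1)
  have h3 := (h2.norm_sq).sqrt (by
    change ‖normalVec (Φ t) u‖ ^ 2 ≠ 0
    positivity)
  have e : (fun s => areaDensity (Φ s) u)
      = fun s => Real.sqrt (‖cross (tangent (Φ s) 0 u) (tangent (Φ s) 1 u)‖ ^ 2) := by
    funext s; rw [Real.sqrt_sq (norm_nonneg _)]; rfl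
  rw [e]
  refine h3.congr_deriv (Eq.symm ?_)
  rw [Real.sqrt_sq (norm_nonneg _)]
  change _ = 2 * inner ℝ (normalVec (Φ t) u) _ / (2 * ‖normalVec (Φ t) u‖)
  rw [areaDensity_mul_surfDiv _ hN, unitNormal]
  have hne : ‖normalVec (Φ t) u‖ ≠ 0 := norm_ne_zero_iff.2 hN
  simp only [cross_smul_left, cross_smul_right, inner_smul_right, crossL_apply, inner_add_right]
  rw [inner_cross_rotate (normalVec (Φ t) u) (pd 0 _ u),
    inner_cross_rotate (normalVec (Φ t) u) (tangent (Φ t) 0 u), inner_cross_rotate (tangent (Φ t) 0 u)]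
  field_simp
  ring

lemma contDiffAt_areaDensity_uncurry (h : ContDiffAt ℝ 2 (fun p : ℝ × P2 => Φ p.1 p.2) (t, u))
    (hN : normalVec (Φ t) u ≠ 0) :
    ContDiffAt ℝ 1 (fun p : ℝ × P2 => areaDensity (Φ p.1) p.2) (t, u) :=
  (contDiffAt_normalVec_uncurry h).norm ℝ hN

end Moving

/-- The two forms of the left hand side of the surface balance agree: in terms of the partial time
derivative the convective term `w · ∇ψ` and the area change `ψ ∇_Σ · w` split into a tangential and
a normal part. -/
lemma lagrangian_eq_eulerian {Φ : ℝ → P2 → E3} {t : ℝ} {u : P2} {ψS : ℝ → E3 → ℝ}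
    (h : ContDiffAt ℝ 2 (fun p : ℝ × P2 => Φ p.1 p.2) (t, u)) (hN : normalVec (Φ t) u ≠ 0)
    (hψ : DifferentiableAt ℝ (fun p : ℝ × E3 => ψS p.1 p.2) (t, Φ t u)) :
    deriv (fun s => ψS s (Φ s u)) t + ψS t (Φ t u) * surfDiv (Φ t) (surfVelocity Φ t) u
      = deriv (fun s => ψS s (Φ t u)) t
          + surfDiv (Φ t) (fun u' => ψS t (Φ t u') • tangentialPart (Φ t) (surfVelocity Φ t) u') u
          + (inner ℝ (gradient (ψS t) (Φ t u)) (unitNormal (Φ t) u)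
              - 2 * meanCurvature (Φ t) u * ψS t (Φ t u)) * normalVelocity Φ t u := by
  have hX : ContDiffAt ℝ 2 (Φ t) u := contDiffAt_slice_right (f := fun p => Φ p.1 p.2) h
  have hw := (contDiffAt_surfVelocity h).differentiableAt (by norm_num)
  have hn := (contDiffAt_unitNormal hX hN).differentiableAt (by norm_num)
  have hwn := differentiableAt_inner_unitNormal hX hN hw
  set F' := fderiv ℝ (fun p : ℝ × E3 => ψS p.1 p.2) (t, Φ t u) with hF'
  have hF : HasFDerivAt (fun p : ℝ × E3 => ψS p.1 p.2) F' (t, Φ t u) := hψ.hasFDerivAt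
  have hx : HasFDerivAt (ψS t) (F'.comp (ContinuousLinearMap.inr ℝ ℝ E3)) (Φ t u) :=
    hasFDerivAt_slice (f := fun p : ℝ × E3 => ψS p.1 p.2) hF
  have ht : deriv (fun s => ψS s (Φ t u)) t = F' (1, 0) :=
    (hasDerivAt_slice (f := fun p : ℝ × E3 => ψS p.1 p.2) hF).deriv
  have hΦt : HasDerivAt (fun s => Φ s u) (surfVelocity Φ t u) t := by
    have := hasDerivAt_slice (f := fun p : ℝ × P2 => Φ p.1 p.2)
      (h.differentiableAt (by norm_num)).hasFDerivAt
    exact this.differentiableAt.hasDerivAt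
  set gr := gradient (ψS t) (Φ t u) with hgr
  have hgrad : ∀ z, F' (0, z) = inner ℝ gr z := by
    intro z
    rw [hgr, gradient, InnerProductSpace.toDual_symm_apply, hx.fderiv]
    simp
  have hl : deriv (fun s => ψS s (Φ s u)) t = F' (1, 0) + inner ℝ gr (surfVelocity Φ t u) := by
    have h1 := HasFDerivAt.comp_hasDerivAt (f := fun s => (s, Φ s u)) t hF
      ((hasDerivAt_id t).prodMk hΦt)
    have h2 : deriv (fun s => ψS s (Φ s u)) t = F' (1, surfVelocity Φ t u) := h1.deriv
    rw [h2, ← hgrad, ← map_add]; simp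
  have hc : DifferentiableAt ℝ (fun u' => ψS t (Φ t u')) u :=
    hx.differentiableAt.comp u (hX.differentiableAt (by norm_num))
  have hpd : ∀ α, pd α (fun u' => ψS t (Φ t u')) u = inner ℝ gr (tangent (Φ t) α u) := by
    intro α
    have h1 := HasFDerivAt.comp u hx (hX.differentiableAt (by norm_num)).hasFDerivAt
    have h2 : fderiv ℝ (fun u' => ψS t (Φ t u')) u = _ := h1.fderiv
    rw [pd, h2, ← hgrad]; rfl
  have hT : DifferentiableAt ℝ (tangentialPart (Φ t) (surfVelocity Φ t)) u := hw.sub (hwn.smul hn)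
  rw [surfDiv_smul hc hT, surfDiv_tangentialPart hX hN hw, two_mul_meanCurvature hX hN, hl, ht,
    normalVelocity, hpd, hpd]
  set w := surfVelocity Φ t u
  set ν := unitNormal (Φ t) u with hν
  set a := ‖normalVec (Φ t) u‖ with ha
  have ha0 : a ≠ 0 := norm_ne_zero_iff.2 hN
  -- a tangential vector is recovered from its products with the tangent vectors
  have key : (a ^ 2)⁻¹ * inner ℝ (tangentialPart (Φ t) (surfVelocity Φ t) u)
      (inner ℝ gr (tangent (Φ t) 0 u) • cross (tangent (Φ t) 1 u) (normalVec (Φ t) u)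
        + inner ℝ gr (tangent (Φ t) 1 u) • cross (normalVec (Φ t) u) (tangent (Φ t) 0 u))
      = inner ℝ gr w - inner ℝ gr ν * inner ℝ w ν := by
    have e1 : inner ℝ gr (tangent (Φ t) 0 u) • cross (tangent (Φ t) 1 u) (normalVec (Φ t) u)
        + inner ℝ gr (tangent (Φ t) 1 u) • cross (normalVec (Φ t) u) (tangent (Φ t) 0 u)
        = cross (normalVec (Φ t) u) (cross gr (normalVec (Φ t) u)) := by
      have hg : cross gr (normalVec (Φ t) u) = inner ℝ gr (tangent (Φ t) 1 u) • tangent (Φ t) 0 u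
          - inner ℝ gr (tangent (Φ t) 0 u) • tangent (Φ t) 1 u := cross_cross gr _ _
      rw [hg, cross_swap (tangent (Φ t) 1 u)]
      simp only [← crossL_apply, map_sub, map_smul]
      module
    have e2 : normalVec (Φ t) u = a • ν := normalVec_eq_smul
    rw [e1, cross_cross, e2, tangentialPart]
    have hνν : inner ℝ ν ν = (1 : ℝ) := by
      rw [real_inner_self_eq_norm_sq, norm_unitNormal hN]; norm_num
    simp only [inner_sub_left, inner_sub_right, inner_smul_left, inner_smul_right, ← hν, hνν,
      conj_trivial]
    rw [real_inner_comm gr ν, real_inner_comm gr w]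
    field_simp
    ring
  rw [key]
  ring

/-! ### Straightening the moving surface -/

/-- The projection of space onto the plane of the first two coordinates. -/
def proj : E3 →L[ℝ] P2 :=
  LinearMap.toContinuousLinearMap
    { toFun := fun q => !₂[q 0, q 1]
      map_add' := fun a b => by ext i; fin_cases i <;> simp
      map_smul' := fun a b => by ext i; fin_cases i <;> simp }

@[simp] lemma proj_apply_zero (q : E3) : proj q 0 = q 0 := rfl
@[simp] lemma proj_apply_one (q : E3) : proj q 1 = q 1 := rfl

lemma ext_two {a b : P2} (h0 : a 0 = b 0) (h1 : a 1 = b 1) : a = b := by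
  ext i; fin_cases i <;> assumption

/-- The standard basis of space. -/
abbrev e3 (i : Fin 3) : E3 := EuclideanSpace.single i 1

/-- The space-time chart `(s, q) ↦ Φ(s, u₀ + (q₀, q₁)) + q₂ n` with a fixed transversal
direction `n`; it straightens the moving surface to `q₂ = 0`. Since `n` does not depend on the
parameter, the chart is of class `C²` like `Φ`. -/
def chart (Φ : ℝ → P2 → E3) (u₀ : P2) (n : E3) (p : ℝ × E3) : E3 :=
  Φ p.1 (u₀ + proj p.2) + p.2 2 • n

lemma norm_le_of_coord {q : E3} {c : ℝ} (h : ∀ i, |q i| ≤ c) : ‖q‖ ≤ 2 * c := by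
  have hc : 0 ≤ c := (abs_nonneg _).trans (h 0)
  rw [EuclideanSpace.norm_eq, Real.sqrt_le_left (by positivity), Fin.sum_univ_three]
  have h' : ∀ i, ‖q i‖ ^ 2 ≤ c ^ 2 := fun i =>
    pow_le_pow_left₀ (norm_nonneg _) (by simpa using h i) 2
  nlinarith [h' 0, h' 1, h' 2]

lemma abs_coord_le (q : E3) (i : Fin 3) : |q i| ≤ ‖q‖ := by
  simpa using PiLp.norm_apply_le q i

/-- The determinant of an endomorphism of `ℝ³` as a triple product. -/
lemma det_eq_inner_cross (A : E3 →L[ℝ] E3) :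
    A.det = inner ℝ (cross (A (e3 0)) (A (e3 1))) (A (e3 2)) := by
  rw [ContinuousLinearMap.det,
    ← LinearMap.det_toMatrix (EuclideanSpace.basisFun (Fin 3) ℝ).toBasis, Matrix.det_fin_three]
  simp [LinearMap.toMatrix_apply, inner_eq_sum]
  ring

section Chart

variable {Φ : ℝ → P2 → E3} {t s : ℝ} {u₀ : P2} {n q : E3}

lemma contDiffAt_chart {k : WithTop ℕ∞} (h : ContDiffAt ℝ k (fun p : ℝ × P2 => Φ p.1 p.2)
    (s, u₀ + proj q)) : ContDiffAt ℝ k (chart Φ u₀ n) (s, q) := by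
  have h1 : ContDiffAt ℝ k (fun p : ℝ × E3 => (p.1, u₀ + proj p.2)) (s, q) := by fun_prop
  have h2 : ContDiffAt ℝ k (fun p : ℝ × E3 => p.2 2 • n) (s, q) := by fun_prop
  exact (ContDiffAt.comp (s, q) h h1).add h2

lemma hasFDerivAt_chart_slice (h : DifferentiableAt ℝ (Φ s) (u₀ + proj q)) :
    HasFDerivAt (fun q => chart Φ u₀ n (s, q))
      ((fderiv ℝ (Φ s) (u₀ + proj q)).comp proj
        + (EuclideanSpace.proj (2 : Fin 3) : E3 →L[ℝ] ℝ).smulRight n) q := by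
  have h1 : HasFDerivAt (fun q : E3 => u₀ + proj q) proj q := proj.hasFDerivAt.const_add u₀
  have h2 := ((EuclideanSpace.proj (2 : Fin 3) : E3 →L[ℝ] ℝ).hasFDerivAt (x := q)).smul_const n
  exact (HasFDerivAt.comp q h.hasFDerivAt h1).add h2

lemma proj_e3_zero : proj (e3 0) = EuclideanSpace.single 0 1 :=
  ext_two (by simp) (by simp)

lemma proj_e3_one : proj (e3 1) = EuclideanSpace.single 1 1 :=
  ext_two (by simp) (by simp)

lemma proj_e3_two : proj (e3 2) = 0 :=
  ext_two (by simp) (by simp)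

lemma fderiv_chart_slice_apply (h : DifferentiableAt ℝ (Φ s) (u₀ + proj q)) :
    fderiv ℝ (fun q => chart Φ u₀ n (s, q)) q (e3 0) = tangent (Φ s) 0 (u₀ + proj q)
    ∧ fderiv ℝ (fun q => chart Φ u₀ n (s, q)) q (e3 1) = tangent (Φ s) 1 (u₀ + proj q)
    ∧ fderiv ℝ (fun q => chart Φ u₀ n (s, q)) q (e3 2) = n := by
  rw [(hasFDerivAt_chart_slice h).fderiv]
  refine ⟨?_, ?_, ?_⟩ <;>
    simp [proj_e3_zero, proj_e3_one, proj_e3_two, tangent, pd]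

/-- The Jacobian determinant of the chart. -/
lemma det_chart (h : DifferentiableAt ℝ (Φ s) (u₀ + proj q)) :
    (fderiv ℝ (fun q => chart Φ u₀ n (s, q)) q).det
      = inner ℝ (normalVec (Φ s) (u₀ + proj q)) n := by
  obtain ⟨h0, h1, h2⟩ := fderiv_chart_slice_apply (n := n) h
  rw [det_eq_inner_cross, h0, h1, h2]; rfl

end Chart

/-- `π` is a local inverse of the space-time chart at `(t, u₀)`, on the part `|s - t| < r`,
`‖q‖ < r` of which the two sides of the surface are `q₂ > 0` and `q₂ < 0`. -/
structure IsChart (T : ℝ) (U : Set P2) (Φ : ℝ → P2 → E3) (V₁ V₂ : ℝ → Set E3) (t : ℝ) (u₀ : P2)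
    (π : ℝ × E3 → E3) (r : ℝ) : Prop where
  pos : 0 < r
  mem_time : ∀ s, |s - t| < r → s ∈ Ioo 0 T
  mem_param : ∀ q, ‖q‖ < r → u₀ + proj q ∈ U
  left_inv : ∀ s q, |s - t| < r → ‖q‖ < r → π (s, chart Φ u₀ (unitNormal (Φ t) u₀) (s, q)) = q
  right_inv : ∀ᶠ p in 𝓝 (t, Φ t u₀), chart Φ u₀ (unitNormal (Φ t) u₀) (p.1, π p) = p.2
  side₁ : ∀ s q, |s - t| < r → ‖q‖ < r → q 2 < 0 →
    chart Φ u₀ (unitNormal (Φ t) u₀) (s, q) ∈ V₁ s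
  side₂ : ∀ s q, |s - t| < r → ‖q‖ < r → 0 < q 2 →
    chart Φ u₀ (unitNormal (Φ t) u₀) (s, q) ∈ V₂ s
  det_pos : ∀ s q, |s - t| < r → ‖q‖ < r →
    0 < inner ℝ (normalVec (Φ s) (u₀ + proj q)) (unitNormal (Φ t) u₀)
  strict : ∃ π' : ℝ × E3 →L[ℝ] E3, HasStrictFDerivAt π π' (t, Φ t u₀) ∧
    ∀ σ ξ, π' (σ, ξ) 2 = inner ℝ (unitNormal (Φ t) u₀) ξ - σ * normalVelocity Φ t u₀

section Exists

variable {T : ℝ} {U : Set P2} {Φ : ℝ → P2 → E3} {V₁ V₂ : ℝ → Set E3}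

lemma IsSingularSurface.contDiffAt (h : IsSingularSurface T U Φ V₁ V₂) {s : ℝ} {u : P2}
    (hs : s ∈ Ioo 0 T) (hu : u ∈ U) : ContDiffAt ℝ 2 (fun p : ℝ × P2 => Φ p.1 p.2) (s, u) :=
  h.smooth.contDiffAt ((isOpen_Ioo.prod h.isOpen_param).mem_nhds ⟨hs, hu⟩)

lemma IsSingularSurface.contDiffAt_slice (h : IsSingularSurface T U Φ V₁ V₂) {s : ℝ} {u : P2}
    (hs : s ∈ Ioo 0 T) (hu : u ∈ U) : ContDiffAt ℝ 2 (Φ s) u :=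
  contDiffAt_slice_right (f := fun p => Φ p.1 p.2) (h.contDiffAt hs hu)

lemma IsSingularSurface.normalVec_ne_zero (h : IsSingularSurface T U Φ V₁ V₂) {s : ℝ} {u : P2}
    (hs : s ∈ Ioo 0 T) (hu : u ∈ U) : normalVec (Φ s) u ≠ 0 :=
  SurfaceBalance.normalVec_ne_zero (h.immersion s hs u hu)

/-- Surface points near a given surface point have parameters near the given parameter. -/
lemma IsSingularSurface.eventually_param_mem (h : IsSingularSurface T U Φ V₁ V₂) {t : ℝ} {u₀ : P2}
    (ht : t ∈ Ioo 0 T) (hu : u₀ ∈ U) {N : Set P2} (hN : N ∈ 𝓝 u₀) :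
    ∀ᶠ p in 𝓝 (t, Φ t u₀), p.1 ∈ Ioo 0 T → ∀ u ∈ U, Φ p.1 u = p.2 → u ∈ N := by
  have hi := h.embedding.isInducing.nhds_eq_comap ⟨(t, u₀), ht, hu⟩
  have hm : {p : ↥(Ioo 0 T ×ˢ U) | p.1.2 ∈ N} ∈ 𝓝 (⟨(t, u₀), ht, hu⟩ : ↥(Ioo 0 T ×ˢ U)) := by
    have hc : Continuous fun p : ↥(Ioo 0 T ×ˢ U) => p.1.2 := by fun_prop
    exact hc.continuousAt.preimage_mem_nhds hN
  rw [hi, mem_comap] at hm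
  obtain ⟨M, hM, hsub⟩ := hm
  filter_upwards [hM] with p hp h1 u hu' he
  have : (⟨(p.1, u), h1, hu'⟩ : ↥(Ioo 0 T ×ˢ U)) ∈ {p : ↥(Ioo 0 T ×ˢ U) | p.1.2 ∈ N} := by
    apply hsub
    change (p.1, Φ p.1 u) ∈ M
    rw [he]; exact hp
  exact this

lemma chart_zero (u₀ : P2) (n : E3) (s : ℝ) : chart Φ u₀ n (s, 0) = Φ s u₀ := by
  simp [chart]

lemma abs_lt_and_norm_lt_of_ball {s t r : ℝ} {q : E3} :
    (s, q) ∈ Metric.ball (t, (0 : E3)) r ↔ |s - t| < r ∧ ‖q‖ < r := by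
  simp [Prod.dist_eq, Real.dist_eq]

/-- The inverse function theorem for `(s, q) ↦ (s, chart Φ u₀ n (s, q))`. The derivative of the third
coordinate of the inverse shows that it measures the signed distance from the moving surface, to
first order. -/
lemma exists_localInverse_chart (h : IsSingularSurface T U Φ V₁ V₂) {t : ℝ} {u₀ : P2}
    (ht : t ∈ Ioo 0 T) (hu : u₀ ∈ U) :
    ∃ π : ℝ × E3 → E3,
      (∀ᶠ p in 𝓝 (t, (0 : E3)), π (p.1, chart Φ u₀ (unitNormal (Φ t) u₀) p) = p.2) ∧
      (∀ᶠ p in 𝓝 (t, Φ t u₀), chart Φ u₀ (unitNormal (Φ t) u₀) (p.1, π p) = p.2) ∧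
      ∃ π' : ℝ × E3 →L[ℝ] E3, HasStrictFDerivAt π π' (t, Φ t u₀) ∧
        ∀ σ ξ, π' (σ, ξ) 2 = inner ℝ (unitNormal (Φ t) u₀) ξ - σ * normalVelocity Φ t u₀ := by
  set n := unitNormal (Φ t) u₀ with hn
  have hN := h.normalVec_ne_zero ht hu
  have hn1 : ‖n‖ = 1 := norm_unitNormal hN
  have hC := h.contDiffAt ht hu
  have hch : ContDiffAt ℝ 2 (chart Φ u₀ n) (t, 0) := contDiffAt_chart (by simpa using hC)
  set H' := fderiv ℝ (chart Φ u₀ n) (t, 0) with hH'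
  have hH : HasFDerivAt (chart Φ u₀ n) H' (t, 0) :=
    (hch.differentiableAt (by norm_num)).hasFDerivAt
  have hsl : ∀ q, H' (0, q) = fderiv ℝ (Φ t) u₀ (proj q) + q 2 • n := by
    intro q
    have h1 := hasFDerivAt_slice hH
    have h2 := hasFDerivAt_chart_slice (n := n) (q := 0)
      (by simpa using (h.contDiffAt_slice ht hu).differentiableAt (by norm_num) :
        DifferentiableAt ℝ (Φ t) (u₀ + proj 0))
    have h3 := DFunLike.congr_fun (h1.unique h2) q
    simpa using h3
  have hw : H' (1, 0) = surfVelocity Φ t u₀ := by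
    have h1 := hasDerivAt_slice hH
    have : (fun s => chart Φ u₀ n (s, ((t, (0 : E3)) : ℝ × E3).2)) = fun s => Φ s u₀ := by
      funext s; exact chart_zero _ _ _
    rw [this] at h1
    exact h1.deriv.symm
  -- the third coordinate is recovered by the product with the normal
  have hτ : ∀ a : P2, inner ℝ n (fderiv ℝ (Φ t) u₀ a) = 0 := by
    intro a
    have ea : a = a 0 • EuclideanSpace.single 0 1 + a 1 • EuclideanSpace.single 1 1 :=
      ext_two (by simp) (by simp)
    rw [ea, map_add, map_smul, map_smul, inner_add_right, inner_smul_right, inner_smul_right]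
    have := fun α => inner_tangent_unitNormal (Φ t) α u₀
    simp only [tangent, pd] at this
    rw [real_inner_comm, this 0, real_inner_comm, this 1]; simp
  have hq2 : ∀ q, inner ℝ n (H' (0, q)) = q 2 := by
    intro q
    rw [hsl, inner_add_right, hτ, inner_smul_right, real_inner_self_eq_norm_sq, hn1]; simp
  have hinj : Function.Injective fun q : E3 => H' (0, q) := by
    have hlin : ∀ q, H' (0, q) = 0 → q = 0 := by
      intro q hq
      have h2 : q 2 = 0 := by rw [← hq2, hq, inner_zero_right]
      have h3 : fderiv ℝ (Φ t) u₀ (proj q) = 0 := by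
        have := hsl q; rw [hq, h2] at this; simpa using this.symm
      have ea : proj q = q 0 • EuclideanSpace.single 0 1 + q 1 • EuclideanSpace.single 1 1 :=
        ext_two (by simp) (by simp)
      have h4 := Fintype.linearIndependent_iff.1 (h.immersion t ht u₀ hu) ![q 0, q 1] (by
        rw [Fin.sum_univ_two]
        rw [ea, map_add, map_smul, map_smul] at h3
        simpa [tangent, pd] using h3)
      exact ext_three (by simpa using h4 0) (by simpa using h4 1) (by simpa using h2)
    intro a b hab
    have := hlin (a - b) (by
      have : ((0, a - b) : ℝ × E3) = (0, a) - (0, b) := by simp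
      rw [this, map_sub]; exact sub_eq_zero.2 hab)
    exact sub_eq_zero.1 this
  set G : ℝ × E3 → ℝ × E3 := fun p => (p.1, chart Φ u₀ n p) with hG
  have hGC : ContDiffAt ℝ 2 G (t, 0) := contDiffAt_fst.prodMk hch
  set G' : ℝ × E3 →L[ℝ] ℝ × E3 := (ContinuousLinearMap.fst ℝ ℝ E3).prod H' with hG'
  have hGd : HasFDerivAt G G' (t, 0) := hasFDerivAt_fst.prodMk hH
  have hG'inj : Function.Injective (G' : ℝ × E3 →ₗ[ℝ] ℝ × E3) := by
    rw [← LinearMap.ker_eq_bot, LinearMap.ker_eq_bot']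
    rintro ⟨σ, q⟩ hp
    have h1 : σ = 0 := congrArg Prod.fst hp
    have h2 : H' (σ, q) = 0 := congrArg Prod.snd hp
    subst h1
    have : q = 0 := hinj (h2.trans (map_zero H').symm)
    rw [this]; rfl
  let E : (ℝ × E3) ≃L[ℝ] (ℝ × E3) :=
    (LinearEquiv.ofInjectiveEndo (G' : ℝ × E3 →ₗ[ℝ] ℝ × E3) hG'inj).toContinuousLinearEquiv
  have hE : ∀ p, E p = G' p := fun p => rfl
  have hGE : HasFDerivAt G (E : ℝ × E3 →L[ℝ] ℝ × E3) (t, 0) := by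
    have : (E : ℝ × E3 →L[ℝ] ℝ × E3) = G' := ContinuousLinearMap.ext hE
    rw [this]; exact hGd
  let e := hGC.toOpenPartialHomeomorph G hGE (by norm_num)
  have he : ∀ p, e p = G p := fun p => rfl
  have hmem : (t, (0 : E3)) ∈ e.source := hGC.mem_toOpenPartialHomeomorph_source hGE (by norm_num)
  have hG0 : G (t, 0) = (t, Φ t u₀) := by simp [hG, chart]
  have hsymm0 : e.symm (t, Φ t u₀) = (t, 0) := by rw [← hG0, ← he]; exact e.left_inv hmem
  have htgt : (t, Φ t u₀) ∈ e.target := by rw [← hG0, ← he]; exact e.map_source hmem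
  refine ⟨fun p => (e.symm p).2, ?_, ?_, ?_⟩
  · filter_upwards [e.open_source.mem_nhds hmem] with p hp
    change (e.symm (e p)).2 = p.2
    rw [e.left_inv hp]
  · filter_upwards [e.open_target.mem_nhds htgt] with p hp
    have h1 : G (e.symm p) = p := e.right_inv hp
    have h2 : (e.symm p).1 = p.1 := (congrArg Prod.fst h1 :)
    have h3 : chart Φ u₀ n (e.symm p) = p.2 := (congrArg Prod.snd h1 :)
    rw [← h2]; exact h3
  · have hs : HasStrictFDerivAt G (E : ℝ × E3 →L[ℝ] ℝ × E3) (e.symm (t, Φ t u₀)) := by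
      rw [hsymm0]; exact hGC.hasStrictFDerivAt' hGE (by norm_num)
    have hi : HasStrictFDerivAt e.symm (E.symm : ℝ × E3 →L[ℝ] ℝ × E3) (t, Φ t u₀) :=
      e.hasStrictFDerivAt_symm htgt hs
    refine ⟨(ContinuousLinearMap.snd ℝ ℝ E3).comp (E.symm : ℝ × E3 →L[ℝ] ℝ × E3),
      hasStrictFDerivAt_snd.comp _ hi, ?_⟩
    intro σ ξ
    obtain ⟨⟨σ', q⟩, hq⟩ := E.surjective (σ, ξ)
    have h1 : σ' = σ := congrArg Prod.fst ((hE _).symm.trans hq)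
    have h2 : H' (σ', q) = ξ := congrArg Prod.snd ((hE _).symm.trans hq)
    have h3 : E.symm (σ, ξ) = (σ', q) := by rw [← hq, E.symm_apply_apply]
    change (E.symm (σ, ξ)).2 2 = _
    have h4 : H' (σ', q) = σ' • H' (1, 0) + H' (0, q) := by
      rw [← map_smul, ← map_add]; simp
    rw [h3, ← h2, h4, inner_add_right, hq2, hw, inner_smul_right, ← h1, normalVelocity,
      real_inner_comm n]
    ring

lemma e3_two_smul_apply (l : ℝ) : (l • e3 2 : E3) 2 = l := by simp

theorem exists_isChart (h : IsSingularSurface T U Φ V₁ V₂) {t : ℝ} {u₀ : P2}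
    (ht : t ∈ Ioo 0 T) (hu : u₀ ∈ U) : ∃ π r, IsChart T U Φ V₁ V₂ t u₀ π r := by
  obtain ⟨π, hl, hr, hs⟩ := exists_localInverse_chart h ht hu
  set n := unitNormal (Φ t) u₀ with hn
  have hN := h.normalVec_ne_zero ht hu
  have hC := h.contDiffAt ht hu
  have hch : ContDiffAt ℝ 2 (chart Φ u₀ n) (t, 0) := contDiffAt_chart (by simpa using hC)
  have hG : Tendsto (fun p : ℝ × E3 => (p.1, chart Φ u₀ n p)) (𝓝 (t, 0)) (𝓝 (t, Φ t u₀)) := by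
    have := (contDiffAt_fst (𝕜 := ℝ) (n := 2)).continuousAt.prodMk hch.continuousAt
    rw [ContinuousAt, chart_zero] at this
    exact this
  have e1 : ∀ᶠ p : ℝ × E3 in 𝓝 (t, 0), p.1 ∈ Ioo 0 T :=
    continuousAt_fst.eventually (isOpen_Ioo.mem_nhds ht)
  have hp : Tendsto (fun p : ℝ × E3 => (p.1, u₀ + proj p.2)) (𝓝 (t, 0)) (𝓝 (t, u₀)) := by
    apply Continuous.tendsto' (by fun_prop); simp
  have e2 : ∀ᶠ p : ℝ × E3 in 𝓝 (t, 0), u₀ + proj p.2 ∈ U :=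
    (continuousAt_snd.tendsto.comp hp).eventually (h.isOpen_param.mem_nhds hu)
  have e3' : ∀ᶠ p : ℝ × E3 in 𝓝 (t, 0), 0 < inner ℝ (normalVec (Φ p.1) (u₀ + proj p.2)) n := by
    have hc : ContinuousAt (fun p : ℝ × P2 => inner ℝ (normalVec (Φ p.1) p.2) n) (t, u₀) :=
      (contDiffAt_normalVec_uncurry hC).continuousAt.inner continuousAt_const
    have hpos : 0 < inner ℝ (normalVec (Φ t) u₀) n := by
      rw [normalVec_eq_smul, ← hn, inner_smul_left, real_inner_self_eq_norm_sq, hn,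
        norm_unitNormal hN]
      simpa [areaDensity] using hN
    exact (hc.tendsto.comp hp).eventually (lt_mem_nhds hpos)
  have e4 : ∀ᶠ p : ℝ × E3 in 𝓝 (t, 0), (p.1, chart Φ u₀ n p) ∈
      spaceTime T fun t => V₁ t ∪ Φ t '' U ∪ V₂ t :=
    hG.eventually (h.isOpen_region.mem_nhds ⟨ht, Or.inl (Or.inr ⟨u₀, hu, rfl⟩)⟩)
  -- points of the surface near `(t, Φ t u₀)` have small coordinates
  obtain ⟨r₁, hr₁, hb₁⟩ := Metric.eventually_nhds_iff_ball.1 (((hl.and e1).and e2).and (e3'.and e4))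
  have e5 := hG.eventually (h.eventually_param_mem ht hu
    (Metric.ball_mem_nhds u₀ (show 0 < r₁ / 2 by positivity)))
  obtain ⟨r₂, hr₂, hb₂⟩ := Metric.eventually_nhds_iff_ball.1 e5
  set r := min r₁ r₂ with hrdef
  have hr0 : 0 < r := lt_min hr₁ hr₂
  have key : ∀ s q, |s - t| < r → ‖q‖ < r → _ := fun s q h1 h2 =>
    hb₁ (s, q) (abs_lt_and_norm_lt_of_ball.2 ⟨h1.trans_le (min_le_left _ _),
      h2.trans_le (min_le_left _ _)⟩)
  have hoff : ∀ s q, |s - t| < r → ‖q‖ < r → q 2 ≠ 0 → chart Φ u₀ n (s, q) ∉ Φ s '' U := by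
    rintro s q h1 h2 h3 ⟨u, hu', he⟩
    have h4 := hb₂ (s, q) (abs_lt_and_norm_lt_of_ball.2 ⟨h1.trans_le (min_le_right _ _),
      h2.trans_le (min_le_right _ _)⟩) (key s q h1 h2).1.1.2 u hu' he
    rw [Metric.mem_ball, dist_eq_norm] at h4
    set q' : E3 := !₂[(u - u₀) 0, (u - u₀) 1, 0] with hq'
    have hq'p : u₀ + proj q' = u := ext_two (by simp [hq']) (by simp [hq'])
    have hcq' : chart Φ u₀ n (s, q') = Φ s u := by
      rw [chart]; simp only [hq'p]; simp [hq']
    have hq'n : ‖q'‖ < r₁ := by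
      have hb : ∀ i, |(u - u₀) i| ≤ ‖u - u₀‖ := fun i => by
        simpa using PiLp.norm_apply_le (u - u₀) i
      have : ‖q'‖ ≤ 2 * ‖u - u₀‖ := by
        apply norm_le_of_coord
        intro i; fin_cases i
        · exact hb 0
        · exact hb 1
        · simp [hq']
      linarith
    have l1 := (key s q h1 h2).1.1.1
    have l2 := (hb₁ (s, q') (abs_lt_and_norm_lt_of_ball.2
      ⟨h1.trans_le (min_le_left _ _), hq'n⟩)).1.1.1
    simp only at l1 l2
    rw [← he] at l1
    rw [hcq', l1] at l2
    exact h3 (by rw [l2]; simp [hq'])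
  have hcont : ∀ s q, |s - t| < r → ‖q‖ < r →
      ContinuousAt (fun p : ℝ × E3 => (p.1, chart Φ u₀ n p)) (s, q) := fun s q h1 h2 =>
    continuousAt_fst.prodMk
      (contDiffAt_chart (h.contDiffAt (key s q h1 h2).1.1.2 (key s q h1 h2).1.2)).continuousAt
  -- either half of the coordinate domain is connected, hence lies on one side
  have half : ∀ σ : ℝ, σ ≠ 0 →
      (∀ s q, |s - t| < r → ‖q‖ < r → 0 < σ * q 2 → chart Φ u₀ n (s, q) ∈ V₁ s) ∨
      (∀ s q, |s - t| < r → ‖q‖ < r → 0 < σ * q 2 → chart Φ u₀ n (s, q) ∈ V₂ s) := by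
    intro σ hσ
    set W : Set (ℝ × E3) := Metric.ball (t, (0 : E3)) r ∩ {p | 0 < σ * p.2 2} with hW
    have hconv : Convex ℝ W := by
      refine (convex_ball _ _).inter ?_
      have : IsLinearMap ℝ fun p : ℝ × E3 => σ * p.2 2 :=
        ⟨fun a b => by simp [mul_add], fun a b => by simp; ring⟩
      exact convex_halfSpace_gt this 0
    have him : IsPreconnected ((fun p : ℝ × E3 => (p.1, chart Φ u₀ n p)) '' W) := by
      refine hconv.isPreconnected.image _ fun p hp => ?_
      obtain ⟨h1, h2⟩ := abs_lt_and_norm_lt_of_ball.1 hp.1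
      exact (hcont p.1 p.2 h1 h2).continuousWithinAt
    have hdisj : Disjoint (spaceTime T V₁) (spaceTime T V₂) := by
      rw [Set.disjoint_left]
      rintro p ⟨h1, h2⟩ ⟨_, h3⟩
      exact Set.disjoint_left.1 (h.disjoint₁₂ p.1 h1) h2 h3
    have hsub : (fun p : ℝ × E3 => (p.1, chart Φ u₀ n p)) '' W
        ⊆ spaceTime T V₁ ∪ spaceTime T V₂ := by
      rintro _ ⟨p, hp, rfl⟩
      obtain ⟨h1, h2⟩ := abs_lt_and_norm_lt_of_ball.1 hp.1
      obtain ⟨h3, h4⟩ := (key p.1 p.2 h1 h2).2.2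
      have hne : p.2 2 ≠ 0 := by
        intro h0
        have h5 : 0 < σ * p.2 2 := hp.2
        rw [h0] at h5; simp at h5
      rcases h4 with (h4 | h4) | h4
      · exact Or.inl ⟨h3, h4⟩
      · exact absurd h4 (hoff p.1 p.2 h1 h2 hne)
      · exact Or.inr ⟨h3, h4⟩
    rcases him.subset_or_subset h.isOpen₁ h.isOpen₂ hdisj hsub with h1 | h1
    · left
      intro s q hs hq hσq
      exact (h1 ⟨(s, q), ⟨abs_lt_and_norm_lt_of_ball.2 ⟨hs, hq⟩, hσq⟩, rfl⟩).2
    · right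
      intro s q hs hq hσq
      exact (h1 ⟨(s, q), ⟨abs_lt_and_norm_lt_of_ball.2 ⟨hs, hq⟩, hσq⟩, rfl⟩).2
  have hline : ∀ l : ℝ, chart Φ u₀ n (t, l • e3 2) = Φ t u₀ + l • n := by
    intro l
    rw [chart]
    simp [proj_e3_two]
  have hnorm : ∀ l : ℝ, ‖(l • e3 2 : E3)‖ = |l| := by
    intro l; rw [norm_smul]; simp
  obtain ⟨l, ⟨hl1, hl2⟩, hl3, hl4⟩ := ((h.normal_direction t ht u₀ hu).and
    (Ioo_mem_nhdsGT hr0)).exists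
  have ht0 : |t - t| < r := by simpa using hr0
  refine ⟨π, r, hr0, fun s hs => ?_, fun q hq => ?_, fun s q hs hq => ?_, hr, fun s q hs hq h2 => ?_,
    fun s q hs hq h2 => ?_, fun s q hs hq => ?_, hs⟩
  · exact (key s 0 hs (by simpa using hr0)).1.1.2
  · exact (key t q ht0 hq).1.2
  · exact (key s q hs hq).1.1.1
  · rcases half (-1) (by norm_num) with h1 | h1
    · exact h1 s q hs hq (by linarith)
    · exfalso
      have h3 := h1 t ((-l) • e3 2) ht0 (by rw [hnorm, abs_neg, abs_of_pos hl3]; exact hl4)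
        (by rw [e3_two_smul_apply]; linarith)
      rw [hline, neg_smul, ← sub_eq_add_neg] at h3
      exact Set.disjoint_left.1 (h.disjoint₁₂ t ht) hl2 h3
  · rcases half 1 (by norm_num) with h1 | h1
    · exfalso
      have h3 := h1 t (l • e3 2) ht0 (by rw [hnorm, abs_of_pos hl3]; exact hl4)
        (by rw [e3_two_smul_apply]; linarith)
      rw [hline] at h3
      exact Set.disjoint_left.1 (h.disjoint₁₂ t ht) h3 hl1
    · exact h1 s q hs hq (by linarith)
  · exact (key s q hs hq).2.1

end Exists

/-! ### Boxes and their boundaries -/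

section Box

variable {ι : Type*}

/-- The open box `∏ ]lᵢ, uᵢ[`. -/
def gbox (l u : ι → ℝ) : Set (EuclideanSpace ℝ ι) := {q | ∀ i, l i < q i ∧ q i < u i}

/-- The open box around the origin with half side lengths `aᵢ`. -/
def box (a : ι → ℝ) : Set (EuclideanSpace ℝ ι) := {q | ∀ i, |q i| < a i}

/-- The closed box around the origin with half side lengths `aᵢ`. -/
def cbox (a : ι → ℝ) : Set (EuclideanSpace ℝ ι) := {q | ∀ i, |q i| ≤ a i}

lemma isClosed_cbox (a : ι → ℝ) : IsClosed (cbox a) := by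
  simp only [cbox, ofPred_forall]
  exact isClosed_iInter fun i => isClosed_le (by fun_prop) (by fun_prop)

lemma box_eq_gbox (a : ι → ℝ) : box a = gbox (-a) a := by
  ext q; simp [box, gbox, abs_lt]

lemma box_subset_cbox (a : ι → ℝ) : box a ⊆ cbox a := fun _ hq i => (hq i).le

lemma convex_gbox (l u : ι → ℝ) : Convex ℝ (gbox l u) := by
  simp only [gbox, ofPred_forall, ofPred_and]
  refine convex_iInter fun i => ?_
  have hl : IsLinearMap ℝ fun q : EuclideanSpace ℝ ι => q i := ⟨fun _ _ => rfl, fun _ _ => rfl⟩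
  exact (convex_halfSpace_gt hl _).inter (convex_halfSpace_lt hl _)

lemma convex_box (a : ι → ℝ) : Convex ℝ (box a) := box_eq_gbox a ▸ convex_gbox _ _

variable [Fintype ι]

lemma isOpen_gbox (l u : ι → ℝ) : IsOpen (gbox l u) := by
  simp only [gbox, ofPred_forall, ofPred_and]
  exact isOpen_iInter_of_finite fun i =>
    (isOpen_lt (by fun_prop) (by fun_prop)).inter (isOpen_lt (by fun_prop) (by fun_prop))

lemma isOpen_box (a : ι → ℝ) : IsOpen (box a) := by
  simp only [box, ofPred_forall]
  exact isOpen_iInter_of_finite fun i => isOpen_lt (by fun_prop) (by fun_prop)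

lemma isBounded_cbox (a : ι → ℝ) : Bornology.IsBounded (cbox a) := by
  refine (Metric.isBounded_closedBall (x := (0 : EuclideanSpace ℝ ι))
    (r := √(∑ i, a i ^ 2))).subset fun q hq => ?_
  rw [mem_closedBall_zero_iff, EuclideanSpace.norm_eq]
  refine Real.sqrt_le_sqrt (Finset.sum_le_sum fun i _ => ?_)
  exact pow_le_pow_left₀ (norm_nonneg _) (by simpa using hq i) 2

lemma isCompact_cbox (a : ι → ℝ) : IsCompact (cbox a) :=
  Metric.isCompact_of_isClosed_isBounded (isClosed_cbox a) (isBounded_cbox a)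

lemma closure_box {a : ι → ℝ} (ha : ∀ i, 0 < a i) : closure (box a) = cbox a := by
  refine (closure_minimal (box_subset_cbox a) (isClosed_cbox a)).antisymm fun q hq => ?_
  have ht : Tendsto (fun l : ℝ => l • q) (𝓝[<] 1) (𝓝 q) := by
    refine Tendsto.mono_left ?_ nhdsWithin_le_nhds
    exact Continuous.tendsto' (by fun_prop) _ _ (one_smul _ _)
  refine mem_closure_of_tendsto ht ?_
  filter_upwards [Ioo_mem_nhdsLT (show (0 : ℝ) < 1 by norm_num)] with l hl i
  rw [PiLp.smul_apply, smul_eq_mul, abs_mul, abs_of_pos hl.1]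
  rcases (abs_nonneg (q i)).eq_or_lt with h | h
  · rw [← h]; simpa using ha i
  · nlinarith [hq i, hl.2]

lemma volume_gbox (l u : ι → ℝ) : volume (gbox l u) = ∏ i, ENNReal.ofReal (u i - l i) := by
  have h : gbox l u = (MeasurableEquiv.toLp 2 (ι → ℝ)).symm ⁻¹'
      (Set.pi univ fun i => Ioo (l i) (u i)) := by
    ext q; simp [gbox]
  rw [h, (EuclideanSpace.volume_preserving_symm_measurableEquiv_toLp ι).measure_preimage
    (MeasurableSet.univ_pi fun i => measurableSet_Ioo).nullMeasurableSet, Real.volume_pi_Ioo]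

lemma volume_real_gbox {l u : ι → ℝ} (h : ∀ i, l i ≤ u i) :
    volume.real (gbox l u) = ∏ i, (u i - l i) := by
  rw [Measure.real, volume_gbox, ENNReal.toReal_prod]
  exact Finset.prod_congr rfl fun i _ => ENNReal.toReal_ofReal (sub_nonneg.2 (h i))

lemma volume_gbox_lt_top (l u : ι → ℝ) : volume (gbox l u) < ⊤ := by
  rw [volume_gbox]; exact ENNReal.prod_lt_top fun i _ => ENNReal.ofReal_lt_top

lemma volume_real_box {a : ι → ℝ} (h : ∀ i, 0 ≤ a i) :
    volume.real (box a) = ∏ i, 2 * a i := by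
  rw [box_eq_gbox, volume_real_gbox fun i => by simp [h i]]
  exact Finset.prod_congr rfl fun i _ => by simp; ring

lemma volume_box_lt_top (a : ι → ℝ) : volume (box a) < ⊤ := by
  rw [box_eq_gbox]; exact volume_gbox_lt_top _ _

end Box

/-! ### The square in the parameter plane -/

/-- The open square with centre `u₀` and half side length `ε`. -/
def square (u₀ : P2) (ε : ℝ) : Set P2 := {u | ∀ i, |(u - u₀) i| < ε}

lemma square_eq_preimage (u₀ : P2) (ε : ℝ) : square u₀ ε = (· - u₀) ⁻¹' box (fun _ => ε) := rfl

lemma isOpen_square (u₀ : P2) (ε : ℝ) : IsOpen (square u₀ ε) :=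
  (isOpen_box _).preimage (by fun_prop)

lemma closure_square (u₀ : P2) {ε : ℝ} (hε : 0 < ε) :
    closure (square u₀ ε) = {u | ∀ i, |(u - u₀) i| ≤ ε} := by
  rw [square_eq_preimage]
  have := (Homeomorph.subRight u₀).preimage_closure (box (fun _ : Fin 2 => ε))
  rw [closure_box fun _ => hε] at this
  exact this.symm

lemma isCompact_closure_square (u₀ : P2) {ε : ℝ} (hε : 0 < ε) :
    IsCompact (closure (square u₀ ε)) := by
  rw [closure_square u₀ hε]
  exact (Homeomorph.subRight u₀).isCompact_preimage.2 (isCompact_cbox (fun _ : Fin 2 => ε))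

lemma volume_square_lt_top (u₀ : P2) (ε : ℝ) : volume (square u₀ ε) < ⊤ := by
  simp only [square_eq_preimage, sub_eq_add_neg, measure_preimage_add_right]; exact volume_box_lt_top _

lemma volume_real_square (u₀ : P2) {ε : ℝ} (hε : 0 ≤ ε) :
    volume.real (square u₀ ε) = 4 * ε ^ 2 := by
  simp only [square_eq_preimage, sub_eq_add_neg, Measure.real, measure_preimage_add_right]
  rw [← Measure.real, volume_real_box fun _ => hε]
  simp; ring

/-- The outer normals of the four sides of a square. -/
def sideNormal : Fin 4 → P2 := ![!₂[1, 0], !₂[0, 1], !₂[-1, 0], !₂[0, -1]]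

/-- The side of the square with outer normal `sideNormal k`, as a curve on `[0, 1]` with the square
on the left. -/
def side (u₀ : P2) (ε : ℝ) (k : Fin 4) (s : ℝ) : P2 :=
  u₀ + ε • (sideNormal k + (2 * s - 1) • rotate (sideNormal k))

lemma hasDerivAt_side (u₀ : P2) (ε : ℝ) (k : Fin 4) (s : ℝ) :
    HasDerivAt (side u₀ ε k) ((2 * ε) • rotate (sideNormal k)) s := by
  have h1 : HasDerivAt (fun s : ℝ => 2 * s - 1) 2 s := by
    simpa using ((hasDerivAt_id s).const_mul 2).sub_const 1
  have h2 := (((h1.smul_const (rotate (sideNormal k))).const_add (sideNormal k)).const_smul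
    ε).const_add u₀
  refine h2.congr_deriv ?_
  module

lemma contDiff_side (u₀ : P2) (ε : ℝ) (k : Fin 4) : ContDiff ℝ 1 (side u₀ ε k) := by
  unfold side; fun_prop

lemma sideNormal_coord (k : Fin 4) (x y : ℝ) :
    (∀ c, (∀ i, |(x • sideNormal k + y • rotate (sideNormal k)) i| < c) ↔ |x| < c ∧ |y| < c) ∧
    (∀ c, (∀ i, |(x • sideNormal k + y • rotate (sideNormal k)) i| ≤ c) ↔ |x| ≤ c ∧ |y| ≤ c) := by
  fin_cases k <;> simp [sideNormal, rotate, Fin.forall_fin_two, and_comm]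

lemma add_smul_mem_square (u₀ : P2) {ε : ℝ} (hε : 0 < ε) (k : Fin 4) (x y : ℝ) :
    u₀ + ε • (x • sideNormal k + y • rotate (sideNormal k)) ∈ square u₀ ε ↔ |x| < 1 ∧ |y| < 1 := by
  rw [← (sideNormal_coord k x y).1 1]
  refine forall_congr' fun i => ?_
  rw [add_sub_cancel_left, PiLp.smul_apply, smul_eq_mul, abs_mul, abs_of_pos hε]
  exact mul_lt_iff_lt_one_right hε

lemma add_smul_mem_closure_square (u₀ : P2) {ε : ℝ} (hε : 0 < ε) (k : Fin 4) (x y : ℝ) :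
    u₀ + ε • (x • sideNormal k + y • rotate (sideNormal k)) ∈ closure (square u₀ ε)
      ↔ |x| ≤ 1 ∧ |y| ≤ 1 := by
  rw [← (sideNormal_coord k x y).2 1, closure_square u₀ hε]
  refine forall_congr' fun i => ?_
  rw [add_sub_cancel_left, PiLp.smul_apply, smul_eq_mul, abs_mul, abs_of_pos hε]
  exact mul_le_iff_le_one_right hε

lemma side_mem_closure_square (u₀ : P2) {ε : ℝ} (hε : 0 < ε) (k : Fin 4) {s : ℝ}
    (hs : s ∈ Icc (0 : ℝ) 1) : side u₀ ε k s ∈ closure (square u₀ ε) := by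
  have := (add_smul_mem_closure_square u₀ hε k 1 (2 * s - 1)).2
    ⟨by simp, abs_le.2 ⟨by linarith [hs.1], by linarith [hs.2]⟩⟩
  rwa [one_smul] at this

lemma side_notMem_square (u₀ : P2) {ε : ℝ} (hε : 0 < ε) (k : Fin 4) (s : ℝ) :
    side u₀ ε k s ∉ square u₀ ε := by
  have := (add_smul_mem_square u₀ hε k 1 (2 * s - 1)).not.2 (by simp)
  rwa [one_smul] at this

lemma side_ne {u₀ : P2} {ε : ℝ} (hε : 0 < ε) {k k' : Fin 4} (hk : k ≠ k') {s s' : ℝ}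
    (hs : s ∈ Ioo (0 : ℝ) 1) (hs' : s' ∈ Ioo (0 : ℝ) 1) : side u₀ ε k s ≠ side u₀ ε k' s' := by
  intro h
  have h1 := smul_right_injective P2 hε.ne' (add_left_cancel h)
  have h2 := congrArg (fun p : P2 => p 0) h1
  have h3 := congrArg (fun p : P2 => p 1) h1
  obtain ⟨a1, a2⟩ := hs
  obtain ⟨b1, b2⟩ := hs'
  fin_cases k <;> fin_cases k' <;>
    first
    | exact absurd rfl hk
    | (simp [sideNormal, rotate] at h2 h3; linarith)

lemma rotate_smul (c : ℝ) (a : P2) : rotate (c • a) = c • rotate a :=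
  ext_two (by simp [rotate]) (by simp [rotate])

lemma rotate_rotate (a : P2) : rotate (rotate a) = -a :=
  ext_two (by simp [rotate]) (by simp [rotate])

lemma rotate_sideNormal_ne_zero (k : Fin 4) : rotate (sideNormal k) ≠ 0 := by
  intro h
  have h2 := congrArg (fun p : P2 => p 0) h
  have h3 := congrArg (fun p : P2 => p 1) h
  fin_cases k <;> simp [sideNormal, rotate] at h2 h3

lemma side_shift_aux (u d r : P2) (ε y l : ℝ) :
    u + ε • (d + y • r) + l • (2 * ε) • -d = u + ε • ((1 - 2 * l) • d + y • r) := by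
  module

/-- The boundary of the square, run through counter-clockwise along its four sides. -/
def squareBoundary (u₀ : P2) {ε : ℝ} (hε : 0 < ε) :
    PiecewiseSmoothBoundaryCurve (square u₀ ε) where
  n := 4
  γ := side u₀ ε
  smooth k s _ := (contDiff_side u₀ ε k).contDiffAt
  injOn k s _ s' _ h := by
    have h1 := add_left_cancel (smul_right_injective P2 hε.ne' (add_left_cancel h))
    have h2 := smul_left_injective ℝ (rotate_sideNormal_ne_zero k) h1
    simpa using h2
  regular k s _ := by
    rw [(hasDerivAt_side u₀ ε k s).deriv]
    exact smul_ne_zero (by positivity) (rotate_sideNormal_ne_zero k)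
  disjoint k k' hk := by
    refine Set.disjoint_left.2 ?_
    rintro _ ⟨s, hs, rfl⟩ ⟨s', hs', h⟩
    exact side_ne hε hk hs hs' h.symm
  cover := by
    rw [(isOpen_square u₀ ε).frontier_eq]
    ext u
    simp only [Set.mem_sdiff, mem_iUnion, mem_image]
    constructor
    · rintro ⟨h1, h2⟩
      rw [closure_square u₀ hε] at h1
      have hcov : ∃ k : Fin 4, ∃ y : ℝ, |y| ≤ 1 ∧
          u - u₀ = ε • (sideNormal k + y • rotate (sideNormal k)) := by
        have h0 := h1 0
        have h1 := h1 1
        have hy : ∀ a : ℝ, |a| ≤ ε → |a / ε| ≤ 1 := fun a ha => by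
          rw [abs_div, abs_of_pos hε]; exact (div_le_one hε).2 ha
        have hne : |(u - u₀) 0| = ε ∨ |(u - u₀) 1| = ε := by
          by_contra! hc
          exact h2 fun i => by
            fin_cases i
            · exact lt_of_le_of_ne h0 hc.1
            · exact lt_of_le_of_ne h1 hc.2
        have hex : ∀ a : ℝ, ε * (a / ε) = a := fun a => by field_simp
        rcases hne with h | h <;> rcases (abs_eq hε.le).1 h with h | h
        · exact ⟨0, (u - u₀) 1 / ε, hy _ h1,
            ext_two (by rw [h]; simp [sideNormal, rotate]) (by
              simp [sideNormal, rotate, -PiLp.sub_apply, hex])⟩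
        · exact ⟨2, -((u - u₀) 1) / ε, hy _ (by rwa [abs_neg]),
            ext_two (by rw [h]; simp [sideNormal, rotate]) (by
              simp [sideNormal, rotate, -PiLp.sub_apply, hex])⟩
        · exact ⟨1, -((u - u₀) 0) / ε, hy _ (by rwa [abs_neg]),
            ext_two (by simp [sideNormal, rotate, -PiLp.sub_apply, hex]) (by
              rw [h]; simp [sideNormal, rotate])⟩
        · exact ⟨3, (u - u₀) 0 / ε, hy _ h0,
            ext_two (by simp [sideNormal, rotate, -PiLp.sub_apply, hex]) (by
              rw [h]; simp [sideNormal, rotate])⟩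
      obtain ⟨k, y, hy, he⟩ := hcov
      rw [abs_le] at hy
      refine ⟨k, (y + 1) / 2, ⟨by linarith, by linarith⟩, ?_⟩
      rw [side, show 2 * ((y + 1) / 2) - 1 = y by ring, ← he, add_sub_cancel]
    · rintro ⟨k, s, hs, rfl⟩
      exact ⟨side_mem_closure_square u₀ hε k hs, side_notMem_square u₀ hε k s⟩
  onLeft k s hs := by
    filter_upwards [Ioo_mem_nhdsGT (show (0 : ℝ) < 1 by norm_num)] with l hl
    obtain ⟨hl0, hl1⟩ := hl
    obtain ⟨hs0, hs1⟩ := hs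
    have hx : |1 - 2 * l| < 1 := abs_lt.2 ⟨by linarith, by linarith⟩
    have hy : |2 * s - 1| < 1 := abs_lt.2 ⟨by linarith, by linarith⟩
    have hz : ¬ |1 + 2 * l| < 1 := fun h => by linarith [(abs_lt.1 h).2]
    rw [(hasDerivAt_side u₀ ε k s).deriv, rotate_smul, rotate_rotate]
    have e1 : side u₀ ε k s + l • (2 * ε) • -sideNormal k
        = u₀ + ε • ((1 - 2 * l) • sideNormal k + (2 * s - 1) • rotate (sideNormal k)) := by
      rw [side]; exact side_shift_aux u₀ _ _ ε (2 * s - 1) l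
    have e2 : side u₀ ε k s - l • (2 * ε) • -sideNormal k
        = u₀ + ε • ((1 + 2 * l) • sideNormal k + (2 * s - 1) • rotate (sideNormal k)) := by
      rw [side, sub_eq_add_neg, ← neg_smul]
      simpa using side_shift_aux u₀ (sideNormal k) (rotate (sideNormal k)) ε (2 * s - 1) (-l)
    rw [e1, e2, add_smul_mem_square u₀ hε, add_smul_mem_square u₀ hε]
    exact ⟨⟨hx, hy⟩, fun h => hz h.1⟩

/-! ### The boundary of a curvilinear box -/

/-- `H` is an orientation preserving `C¹` diffeomorphism of the ball of radius `r` onto its image. -/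
structure IsPositiveDiffeo (H : E3 → E3) (r : ℝ) : Prop where
  smooth : ∀ q, ‖q‖ < r → ContDiffAt ℝ 1 H q
  injOn : InjOn H (Metric.ball 0 r)
  det_pos : ∀ q, ‖q‖ < r → 0 < (fderiv ℝ H q).det

lemma exists_index (i k : Fin 3) : k = i ∨ k = i + 1 ∨ k = i + 2 := by
  revert i k; decide

lemma det_eq_inner_cross_cyclic (A : E3 →L[ℝ] E3) (i : Fin 3) :
    A.det = inner ℝ (cross (A (e3 (i + 1))) (A (e3 (i + 2)))) (A (e3 i)) := by
  rw [det_eq_inner_cross]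
  fin_cases i
  · exact (inner_cross_cyclic _ _ _).trans (real_inner_comm _ _)
  · simp only [inner_eq_sum, cross_apply_zero, cross_apply_one, cross_apply_two]
    simp
    ring
  · rfl

/-- The parametrization of the face `qᵢ = σ aᵢ` of the box by the other two coordinates; the last of
them is reversed on the face `σ = -1`, so that the vector product of the tangents is an outward
normal. -/
def face (a : Fin 3 → ℝ) (i : Fin 3) (σ : ℝ) (p : P2) : E3 :=
  (σ * a i) • e3 i + p 0 • e3 (i + 1) + (σ * p 1) • e3 (i + 2)

section Face

variable (a : Fin 3 → ℝ) (i : Fin 3) (σ : ℝ) (p : P2)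

lemma face_apply : face a i σ p i = σ * a i := by
  fin_cases i <;> simp [face]

lemma face_apply_one : face a i σ p (i + 1) = p 0 := by
  fin_cases i <;> simp [face]

lemma face_apply_two : face a i σ p (i + 2) = σ * p 1 := by
  fin_cases i <;> simp [face]

lemma contDiff_face {k : WithTop ℕ∞} : ContDiff ℝ k (face a i σ) := by
  unfold face; fun_prop

lemma hasFDerivAt_face : HasFDerivAt (face a i σ)
    ((EuclideanSpace.proj (0 : Fin 2) : P2 →L[ℝ] ℝ).smulRight (e3 (i + 1))
      + (σ • (EuclideanSpace.proj (1 : Fin 2) : P2 →L[ℝ] ℝ)).smulRight (e3 (i + 2))) p := by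
  have h0 := ((EuclideanSpace.proj (0 : Fin 2) : P2 →L[ℝ] ℝ).hasFDerivAt (x := p)).smul_const
    (e3 (i + 1))
  have h1 := ((σ • (EuclideanSpace.proj (1 : Fin 2) : P2 →L[ℝ] ℝ)).hasFDerivAt (x := p)).smul_const
    (e3 (i + 2))
  exact (h0.const_add _).add h1

variable {a i σ p}

lemma tangent_comp_face {H : E3 → E3} (h : DifferentiableAt ℝ H (face a i σ p)) :
    tangent (H ∘ face a i σ) 0 p = fderiv ℝ H (face a i σ p) (e3 (i + 1)) ∧
    tangent (H ∘ face a i σ) 1 p = σ • fderiv ℝ H (face a i σ p) (e3 (i + 2)) := by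
  simp only [tangent, pd, (h.hasFDerivAt.comp p (hasFDerivAt_face a i σ p)).fderiv]
  constructor <;> simp

lemma normalVec_comp_face {H : E3 → E3} (h : DifferentiableAt ℝ H (face a i σ p)) :
    normalVec (H ∘ face a i σ) p = σ • cross (fderiv ℝ H (face a i σ p) (e3 (i + 1)))
      (fderiv ℝ H (face a i σ p) (e3 (i + 2))) := by
  rw [normalVec, (tangent_comp_face h).1, (tangent_comp_face h).2, cross_smul_right]

/-- The parameter domain of the pair of faces of index `i`. -/
def faceDomain (a : Fin 3 → ℝ) (i : Fin 3) : Set P2 := box ![a (i + 1), a (i + 2)]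

lemma mem_faceDomain : p ∈ faceDomain a i ↔ |p 0| < a (i + 1) ∧ |p 1| < a (i + 2) := by
  simp [faceDomain, box, Fin.forall_fin_two]

lemma closure_faceDomain (ha : ∀ i, 0 < a i) :
    p ∈ closure (faceDomain a i) ↔ |p 0| ≤ a (i + 1) ∧ |p 1| ≤ a (i + 2) := by
  rw [faceDomain, closure_box (by simp [Fin.forall_fin_two, ha])]
  simp [cbox, Fin.forall_fin_two]

lemma abs_face_lt (hσ : |σ| = 1) (hp : p ∈ faceDomain a i) {k : Fin 3} (hk : k ≠ i) :
    |face a i σ p k| < a k := by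
  rw [mem_faceDomain] at hp
  rcases exists_index i k with rfl | rfl | rfl
  · exact absurd rfl hk
  · rw [face_apply_one]; exact hp.1
  · rw [face_apply_two, abs_mul, hσ, one_mul]; exact hp.2

lemma abs_face_self (hσ : |σ| = 1) (ha : ∀ i, 0 < a i) : |face a i σ p i| = a i := by
  rw [face_apply, abs_mul, hσ, one_mul, abs_of_pos (ha i)]

lemma face_mem_cbox (hσ : |σ| = 1) (ha : ∀ i, 0 < a i) (hp : p ∈ closure (faceDomain a i)) :
    face a i σ p ∈ cbox a := by
  rw [closure_faceDomain ha] at hp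
  intro k
  rcases exists_index i k with rfl | rfl | rfl
  · exact (abs_face_self hσ ha).le
  · rw [face_apply_one]; exact hp.1
  · rw [face_apply_two, abs_mul, hσ, one_mul]; exact hp.2

lemma face_notMem_box (hσ : |σ| = 1) (ha : ∀ i, 0 < a i) : face a i σ p ∉ box a := fun h =>
  (h i).ne (abs_face_self hσ ha)

lemma exists_face (ha : ∀ i, 0 < a i) {q : E3} (h : q ∈ cbox a) (h' : q ∉ box a) :
    ∃ i, ∃ σ : ℝ, (σ = 1 ∨ σ = -1) ∧ ∃ p ∈ closure (faceDomain a i), face a i σ p = q := by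
  obtain ⟨i, hi⟩ : ∃ i, |q i| = a i := by
    by_contra! hc
    exact h' fun i => lt_of_le_of_ne (h i) (hc i)
  obtain ⟨σ, hσ, hq⟩ : ∃ σ : ℝ, (σ = 1 ∨ σ = -1) ∧ q i = σ * a i := by
    rcases (abs_eq (ha i).le).1 hi with h1 | h1
    · exact ⟨1, Or.inl rfl, by simpa using h1⟩
    · exact ⟨-1, Or.inr rfl, by simpa using h1⟩
  have hσσ : σ * σ = 1 := by rcases hσ with rfl | rfl <;> norm_num
  have hσ1 : |σ| = 1 := by rcases hσ with rfl | rfl <;> simp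
  refine ⟨i, σ, hσ, !₂[q (i + 1), σ * q (i + 2)], ?_, ?_⟩
  · rw [closure_faceDomain ha]
    refine ⟨by simpa using h (i + 1), ?_⟩
    have := h (i + 2)
    simpa [abs_mul, hσ1] using this
  · ext k
    rcases exists_index i k with rfl | rfl | rfl
    · rw [face_apply, hq]
    · rw [face_apply_one]; simp
    · rw [face_apply_two]; simp [← mul_assoc, hσσ]

end Face

lemma eventually_lt_of_hasDerivAt_pos {g : ℝ → ℝ} {c : ℝ} (h : HasDerivAt g c 0) (hc : 0 < c) :
    ∀ᶠ l in 𝓝[>] (0 : ℝ), g 0 < g l ∧ g (-l) < g 0 := by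
  have hs := (hasDerivAt_iff_tendsto_slope_zero.1 h).eventually (lt_mem_nhds hc)
  have hp : Tendsto (fun l : ℝ => l) (𝓝[>] 0) (𝓝[≠] 0) :=
    nhdsWithin_mono _ fun x (hx : 0 < x) => hx.ne'
  have hn : Tendsto (fun l : ℝ => -l) (𝓝[>] 0) (𝓝[≠] 0) := by
    refine tendsto_nhdsWithin_iff.2 ⟨?_, ?_⟩
    · refine Tendsto.mono_left ?_ nhdsWithin_le_nhds
      exact Continuous.tendsto' (by fun_prop) _ _ (by simp)
    · filter_upwards [self_mem_nhdsWithin] with l hl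
      have : (0 : ℝ) < l := hl
      simpa using this.ne'
  filter_upwards [hp.eventually hs, hn.eventually hs, self_mem_nhdsWithin] with l h1 h2 h3
  have h3' : (0 : ℝ) < l := h3
  simp only [zero_add, smul_eq_mul] at h1 h2
  constructor
  · have := (mul_pos_iff_of_pos_left (inv_pos.2 h3')).1 h1
    linarith
  · rw [inv_neg, neg_mul, ← mul_neg] at h2
    have := (mul_pos_iff_of_pos_left (inv_pos.2 h3')).1 h2
    linarith

section Diffeo

variable {H : E3 → E3} {r : ℝ} {a : Fin 3 → ℝ}

lemma cbox_subset_ball (hr : ∀ i, 2 * a i < r) : cbox a ⊆ Metric.ball 0 r := by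
  intro q hq
  set c := max (a 0) (max (a 1) (a 2)) with hc
  have h1 : ‖q‖ ≤ 2 * c := norm_le_of_coord fun i => (hq i).trans (by fin_cases i <;> simp [hc])
  rw [mem_ball_zero_iff]
  refine h1.trans_lt ?_
  rw [hc]
  rcases max_choice (a 0) (max (a 1) (a 2)) with h | h <;> rw [h]
  · exact hr 0
  · rcases max_choice (a 1) (a 2) with h | h <;> rw [h]
    exacts [hr 1, hr 2]

lemma IsPositiveDiffeo.isOpen_image (hH : IsPositiveDiffeo H r) {S : Set E3} (hS : IsOpen S)
    (hSr : S ⊆ Metric.ball 0 r) : IsOpen (H '' S) := by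
  rw [isOpen_iff_mem_nhds]
  rintro _ ⟨q, hq, rfl⟩
  have hqr := mem_ball_zero_iff.1 (hSr hq)
  have hs := (hH.smooth q hqr).hasStrictFDerivAt (by norm_num)
  have hsurj : (fderiv ℝ H q : E3 →ₗ[ℝ] E3).range = ⊤ :=
    LinearMap.range_eq_top.2
      (ContinuousLinearMap.toContinuousLinearEquivOfDetNeZero _ (hH.det_pos q hqr).ne').surjective
  rw [← hs.map_nhds_eq_of_surj hsurj]
  exact image_mem_map (hS.mem_nhds hq)

lemma IsPositiveDiffeo.continuousOn (hH : IsPositiveDiffeo H r) :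
    ContinuousOn H (Metric.ball 0 r) := fun q hq =>
  (hH.smooth q (mem_ball_zero_iff.1 hq)).continuousAt.continuousWithinAt

lemma IsPositiveDiffeo.closure_image_box (hH : IsPositiveDiffeo H r) (ha : ∀ i, 0 < a i)
    (hr : ∀ i, 2 * a i < r) : closure (H '' box a) = H '' cbox a := by
  have hc := hH.continuousOn.mono (cbox_subset_ball hr)
  refine (closure_minimal (image_mono (box_subset_cbox a))
    ((isCompact_cbox a).image_of_continuousOn hc).isClosed).antisymm ?_
  rw [← closure_box ha] at hc ⊢
  exact hc.image_closure

lemma IsPositiveDiffeo.frontier_image_box (hH : IsPositiveDiffeo H r) (ha : ∀ i, 0 < a i)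
    (hr : ∀ i, 2 * a i < r) : frontier (H '' box a) = H '' (cbox a \ box a) := by
  have hsub := cbox_subset_ball hr
  rw [(hH.isOpen_image (isOpen_box a) ((box_subset_cbox a).trans hsub)).frontier_eq,
    hH.closure_image_box ha hr,
    (hH.injOn.mono hsub).image_sdiff_subset (box_subset_cbox a)]

lemma normalVec_face_inner (A : E3 →L[ℝ] E3) (i : Fin 3) (c : E3) :
    inner ℝ (cross (A (e3 (i + 1))) (A (e3 (i + 2)))) (A c) = c i * A.det := by
  have hc : c = c i • e3 i + c (i + 1) • e3 (i + 1) + c (i + 2) • e3 (i + 2) := by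
    fin_cases i <;> exact ext_three (by simp) (by simp) (by simp)
  rw [det_eq_inner_cross_cyclic A i]
  conv_lhs => rw [hc]
  rw [map_add, map_add, map_smul, map_smul, map_smul, inner_add_right, inner_add_right,
    inner_smul_right, inner_smul_right, inner_smul_right,
    real_inner_comm (A (e3 (i + 1))), real_inner_comm (A (e3 (i + 2))), inner_cross_left_self,
    inner_cross_right_self]
  ring

lemma normalVec_comp_face_ne_zero (hH : IsPositiveDiffeo H r) {i : Fin 3} {σ : ℝ} (hσ : |σ| = 1)
    {p : P2} (hp : ‖face a i σ p‖ < r) : normalVec (H ∘ face a i σ) p ≠ 0 := by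
  rw [normalVec_comp_face ((hH.smooth _ hp).differentiableAt (by norm_num))]
  intro h0
  have hσ0 : σ ≠ 0 := by rintro rfl; simp at hσ
  rw [smul_eq_zero_iff_right hσ0] at h0
  have := det_eq_inner_cross_cyclic (fderiv ℝ H (face a i σ p)) i
  rw [h0, inner_zero_left] at this
  exact (hH.det_pos _ hp).ne' this

lemma linearIndependent_of_normalVec_ne_zero {X : P2 → E3} {u : P2} (h : normalVec X u ≠ 0) :
    LinearIndependent ℝ (fun α => tangent X α u) := by
  rw [Fintype.linearIndependent_iff]
  intro g hg
  rw [Fin.sum_univ_two] at hg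
  have h0 : g 0 • normalVec X u = 0 := by
    have := congrArg (fun z => cross z (tangent X 1 u)) hg
    simp only [← crossL_apply, map_add, map_smul, add_apply,
      smul_apply, map_zero, zero_apply] at this
    have hs : cross (tangent X 1 u) (tangent X 1 u) = 0 := by
      apply ext_three <;> simp <;> ring
    simpa [hs, normalVec] using this
  have h1 : g 1 • normalVec X u = 0 := by
    have := congrArg (fun z => cross (tangent X 0 u) z) hg
    simp only [← crossL_apply, map_add, map_smul, map_zero] at this
    have hs : cross (tangent X 0 u) (tangent X 0 u) = 0 := by
      apply ext_three <;> simp <;> ring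
    simpa [hs, normalVec] using this
  intro i
  fin_cases i
  · exact (smul_eq_zero.1 h0).resolve_right h
  · exact (smul_eq_zero.1 h1).resolve_right h

/-- Crossing a face of the curvilinear box in the direction of the normal leads outwards. -/
lemma IsPositiveDiffeo.outward_face (hH : IsPositiveDiffeo H r)
    (ha : ∀ i, 0 < a i) (hr : ∀ i, 2 * a i < r) {i : Fin 3} {σ : ℝ} (hσ : |σ| = 1) {p : P2}
    (hp : p ∈ faceDomain a i) :
    ∀ᶠ l in 𝓝[>] (0 : ℝ),
      H (face a i σ p) + l • unitNormal (H ∘ face a i σ) p ∉ H '' box a ∧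
      H (face a i σ p) - l • unitNormal (H ∘ face a i σ) p ∈ H '' box a := by
  set q := face a i σ p with hq
  have hsub := cbox_subset_ball hr
  have hqr : ‖q‖ < r :=
    mem_ball_zero_iff.1 (hsub (face_mem_cbox hσ ha (subset_closure hp)))
  set ν := unitNormal (H ∘ face a i σ) p with hν
  set A := fderiv ℝ H q with hA
  have hdet : 0 < A.det := hH.det_pos q hqr
  let E := ContinuousLinearMap.toContinuousLinearEquivOfDetNeZero A hdet.ne'
  have hE : (E : E3 →L[ℝ] E3) = A := rfl
  have hs : HasStrictFDerivAt H (E : E3 →L[ℝ] E3) q :=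
    (hH.smooth q hqr).hasStrictFDerivAt (by norm_num)
  set φ := hs.localInverse with hφ
  have hφq : φ (H q) = q := hs.localInverse_apply_image
  have hN : normalVec (H ∘ face a i σ) p ≠ 0 := normalVec_comp_face_ne_zero hH hσ hqr
  -- the `i`-th coordinate increases or decreases along the normal according to the sign `σ`
  have hc : 0 < σ * (E.symm ν) i := by
    have h1 : inner ℝ (normalVec (H ∘ face a i σ) p) ν = ‖normalVec (H ∘ face a i σ) p‖ := by
      rw [normalVec_eq_smul, inner_smul_left, ← hν, real_inner_self_eq_norm_sq, hν,
        norm_unitNormal hN, norm_smul, norm_unitNormal hN]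
      simp [areaDensity]
    have h2 : ν = A (E.symm ν) := (E.apply_symm_apply ν).symm
    rw [normalVec_comp_face ((hH.smooth _ hqr).differentiableAt (by norm_num)), inner_smul_left,
      h2, normalVec_face_inner, ← normalVec_comp_face
        ((hH.smooth _ hqr).differentiableAt (by norm_num)), ← hA, ← mul_assoc] at h1
    have h3 : 0 < ‖normalVec (H ∘ face a i σ) p‖ := norm_pos_iff.2 hN
    rw [← h1] at h3
    exact (mul_pos_iff_of_pos_right hdet).1 h3
  have hline : HasDerivAt (fun l : ℝ => H q + l • ν) ν 0 := by
    simpa using ((hasDerivAt_id (0 : ℝ)).smul_const ν).const_add (H q)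
  have hφd : HasDerivAt (fun l : ℝ => φ (H q + l • ν)) (E.symm ν) 0 := by
    have h1 : HasFDerivAt φ (E.symm : E3 →L[ℝ] E3) (H q + (0 : ℝ) • ν) := by
      simpa using hs.to_localInverse.hasFDerivAt
    exact h1.comp_hasDerivAt (0 : ℝ) hline
  have hcoord : HasDerivAt (fun l : ℝ => σ * (φ (H q + l • ν)) i) (σ * (E.symm ν) i) 0 :=
    (((EuclideanSpace.proj i : E3 →L[ℝ] ℝ).hasFDerivAt.comp_hasDerivAt (0 : ℝ) hφd)).const_mul σ
  have hsign := eventually_lt_of_hasDerivAt_pos hcoord hc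
  simp only [zero_smul, add_zero, hφq] at hsign
  have hqi : σ * q i = a i := by
    rw [hq, face_apply, ← mul_assoc, ← abs_mul_abs_self σ, hσ]; simp
  have hσs : ∀ x : ℝ, |x| = |σ * x| := fun x => by rw [abs_mul, hσ, one_mul]
  -- `φ` is an inverse of `H` along the normal line, with values in the ball
  have hnear : ∀ᶠ l in 𝓝 (0 : ℝ), H (φ (H q + l • ν)) = H q + l • ν ∧
      φ (H q + l • ν) ∈ Metric.ball (0 : E3) r ∧ (∀ k, k ≠ i → |φ (H q + l • ν) k| < a k) ∧
      -a i < σ * φ (H q + l • ν) i := by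
    have t1 : Tendsto (fun l : ℝ => H q + l • ν) (𝓝 0) (𝓝 (H q)) := by
      apply Continuous.tendsto' (by fun_prop); simp
    have t2 : Tendsto (fun l : ℝ => φ (H q + l • ν)) (𝓝 0) (𝓝 q) := by
      have := hφd.continuousAt.tendsto
      simpa [hφq] using this
    have t3 : ∀ k : Fin 3, Tendsto (fun l : ℝ => φ (H q + l • ν) k) (𝓝 0) (𝓝 (q k)) := fun k =>
      ((EuclideanSpace.proj k : E3 →L[ℝ] ℝ).continuous.tendsto q).comp t2
    refine (t1.eventually hs.eventually_right_inverse).and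
      ((t2.eventually (Metric.isOpen_ball.mem_nhds (mem_ball_zero_iff.2 hqr))).and
      (Filter.Eventually.and ?_ ?_))
    · rw [eventually_all]
      intro k
      by_cases hk : k = i
      · simp [hk]
      · have := (t3 k).abs.eventually (gt_mem_nhds (abs_face_lt hσ hp hk))
        filter_upwards [this] with l hl _ using hl
    · refine ((t3 i).const_mul σ).eventually (lt_mem_nhds ?_)
      rw [hqi]; linarith [ha i]
  have hneg : Tendsto (fun l : ℝ => -l) (𝓝[>] 0) (𝓝 0) :=
    Tendsto.mono_left (Continuous.tendsto' (by fun_prop) _ _ (by simp)) nhdsWithin_le_nhds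
  filter_upwards [hsign, nhdsWithin_le_nhds hnear, hneg.eventually hnear] with l h1 h2 h3
  constructor
  · rintro ⟨q', hq', he⟩
    rw [← h2.1] at he
    have h4 := hH.injOn (hsub (box_subset_cbox a hq')) h2.2.1 he
    have h5 := hq' i
    rw [h4, hσs] at h5
    have h6 := h1.1
    rw [hqi] at h6
    linarith [(abs_lt.1 h5).2]
  · refine ⟨φ (H q + (-l) • ν), fun k => ?_, ?_⟩
    · by_cases hk : k = i
      · subst hk
        rw [hσs, abs_lt]
        exact ⟨h3.2.2.2, by linarith [h1.2]⟩
      · exact h3.2.2.1 k hk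
    · rw [h3.1, neg_smul, sub_eq_add_neg]

/-- The sign of a face: the first of each pair of faces is `qᵢ = aᵢ`, the second `qᵢ = -aᵢ`. -/
def faceSign : Fin 2 → ℝ := ![1, -1]

lemma abs_faceSign (k : Fin 2) : |faceSign k| = 1 := by
  fin_cases k <;> simp [faceSign]

lemma faceSign_injective : Function.Injective faceSign := by
  intro k k' h
  fin_cases k <;> fin_cases k' <;> simp [faceSign] at h ⊢ <;> norm_num at h

/-- The boundary of a curvilinear box consists of its six faces. -/
def boxBoundary (hH : IsPositiveDiffeo H r) (ha : ∀ i, 0 < a i) (hr : ∀ i, 2 * a i < r) :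
    PiecewiseSmoothBoundary (H '' box a) where
  m := 3 * 2
  O k := faceDomain a (finProdFinEquiv.symm k).1
  b k := H ∘ face a (finProdFinEquiv.symm k).1 (faceSign (finProdFinEquiv.symm k).2)
  isOpen k := isOpen_box _
  isBounded k := (isBounded_cbox _).subset (box_subset_cbox _)
  null_frontier k := (convex_box _).addHaar_frontier _
  smooth k p hp := (hH.smooth _ (mem_ball_zero_iff.1 (cbox_subset_ball hr
    (face_mem_cbox (abs_faceSign _) ha hp)))).comp p (contDiff_face _ _ _).contDiffAt
  injOn k := by
    have hmem : ∀ p ∈ faceDomain a (finProdFinEquiv.symm k).1, face a (finProdFinEquiv.symm k).1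
        (faceSign (finProdFinEquiv.symm k).2) p ∈ Metric.ball (0 : E3) r := fun p hp =>
      cbox_subset_ball hr (face_mem_cbox (abs_faceSign _) ha (subset_closure hp))
    intro p hp p' hp' h
    have h1 := hH.injOn (hmem p hp) (hmem p' hp') h
    have h2 := congrArg (fun q : E3 => q ((finProdFinEquiv.symm k).1 + 1)) h1
    have h3 := congrArg (fun q : E3 => q ((finProdFinEquiv.symm k).1 + 2)) h1
    simp only [face_apply_one, face_apply_two] at h2 h3
    have h0 : faceSign (finProdFinEquiv.symm k).2 ≠ 0 := by
      intro h0; have := abs_faceSign (finProdFinEquiv.symm k).2; rw [h0] at this; simp at this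
    exact ext_two h2 (mul_left_cancel₀ h0 h3)
  immersion k p hp := linearIndependent_of_normalVec_ne_zero
    (normalVec_comp_face_ne_zero hH (abs_faceSign _) (mem_ball_zero_iff.1 (cbox_subset_ball hr
      (face_mem_cbox (abs_faceSign _) ha (subset_closure hp)))))
  disjoint k k' hk := by
    refine Set.disjoint_left.2 ?_
    rintro _ ⟨p, hp, rfl⟩ ⟨p', hp', h⟩
    have h1 := hH.injOn
      (cbox_subset_ball hr (face_mem_cbox (abs_faceSign _) ha (subset_closure hp')))
      (cbox_subset_ball hr (face_mem_cbox (abs_faceSign _) ha (subset_closure hp))) h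
    apply hk
    apply finProdFinEquiv.symm.injective
    have h2 : (finProdFinEquiv.symm k).1 = (finProdFinEquiv.symm k').1 := by
      by_contra hne
      have h3 := abs_face_lt (abs_faceSign (finProdFinEquiv.symm k').2) hp' hne
      rw [h1, abs_face_self (abs_faceSign _) ha] at h3
      exact lt_irrefl _ h3
    refine Prod.ext h2 (faceSign_injective ?_)
    have h3 := congrArg (fun q : E3 => q (finProdFinEquiv.symm k).1) h1
    simp only [face_apply] at h3
    rw [h2, face_apply] at h3
    exact (mul_right_cancel₀ (ha _).ne' h3).symm
  cover := by
    rw [hH.frontier_image_box ha hr]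
    ext x
    simp only [mem_iUnion, mem_image]
    constructor
    · rintro ⟨q, ⟨h1, h2⟩, rfl⟩
      obtain ⟨i, σ, hσ, p, hp, rfl⟩ := exists_face ha h1 h2
      obtain ⟨k, rfl⟩ : ∃ k, faceSign k = σ := by
        rcases hσ with rfl | rfl
        · exact ⟨0, rfl⟩
        · exact ⟨1, rfl⟩
      refine ⟨finProdFinEquiv (i, k), p, ?_, ?_⟩
      · simpa only [Equiv.symm_apply_apply] using hp
      · simp only [Equiv.symm_apply_apply]; rfl
    · rintro ⟨k, p, hp, rfl⟩
      exact ⟨_, ⟨face_mem_cbox (abs_faceSign _) ha hp, face_notMem_box (abs_faceSign _) ha⟩, rfl⟩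
  outward k p hp := hH.outward_face ha hr (abs_faceSign _) hp

lemma flux_boxBoundary (hH : IsPositiveDiffeo H r) (ha : ∀ i, 0 < a i) (hr : ∀ i, 2 * a i < r)
    (F : E3 → E3) :
    (boxBoundary hH ha hr).flux F = ∑ i : Fin 3, ∑ k : Fin 2, ∫ p in faceDomain a i,
      inner ℝ (F (H (face a i (faceSign k) p))) (normalVec (H ∘ face a i (faceSign k)) p) := by
  rw [PiecewiseSmoothBoundary.flux, ← Finset.sum_product', Finset.univ_product_univ]
  refine Fintype.sum_equiv finProdFinEquiv.symm _ _ fun k => ?_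
  refine setIntegral_congr_fun (isOpen_box _).measurableSet fun p _ => ?_
  rw [normalVec_eq_smul, inner_smul_right, mul_comm]
  rfl

end Diffeo

/-! ### The motion of the particles near the surface -/

/-- A continuous path which at each time agrees with one of two Lipschitz paths is Lipschitz: when
it changes from one to the other, both agree with it at some intermediate time. -/
lemma norm_sub_le_of_eq_or_eq {E : Type*} [NormedAddCommGroup E] {f g₁ g₂ : ℝ → E} {K a b : ℝ}
    (hf : ContinuousOn f (uIcc a b)) (hc₁ : ContinuousOn g₁ (uIcc a b))
    (hc₂ : ContinuousOn g₂ (uIcc a b))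
    (h₁ : ∀ x ∈ uIcc a b, ∀ y ∈ uIcc a b, ‖g₁ x - g₁ y‖ ≤ K * |x - y|)
    (h₂ : ∀ x ∈ uIcc a b, ∀ y ∈ uIcc a b, ‖g₂ x - g₂ y‖ ≤ K * |x - y|)
    (h : ∀ x ∈ uIcc a b, f x = g₁ x ∨ f x = g₂ x) : ‖f a - f b‖ ≤ K * |a - b| := by
  have ha : a ∈ uIcc a b := left_mem_uIcc
  have hb : b ∈ uIcc a b := right_mem_uIcc
  have hcl : ∀ g : ℝ → E, ContinuousOn g (uIcc a b) →
      IsClosed (uIcc a b ∩ {x | f x = g x}) := by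
    intro g hg
    have := (hf.prodMk hg).preimage_isClosed_of_isClosed isClosed_Icc isClosed_diagonal
    have he : {x | f x = g x} = (fun x => (f x, g x)) ⁻¹' diagonal E := by ext; simp
    rwa [he]
  have hpre := isPreconnected_closed_iff.1 (isPreconnected_uIcc (a := a) (b := b)) _ _
    (hcl g₁ hc₁) (hcl g₂ hc₂)
    (fun x hx => (h x hx).imp (fun e => ⟨hx, e⟩) fun e => ⟨hx, e⟩)
  have hsum : ∀ c ∈ uIcc a b, |a - c| + |c - b| = |a - b| := by
    intro c hc
    rcases le_total a b with hab | hab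
    · rw [uIcc_of_le hab] at hc
      rw [abs_of_nonpos (by linarith [hc.1]), abs_of_nonpos (by linarith [hc.2]),
        abs_of_nonpos (by linarith)]
      ring
    · rw [uIcc_of_ge hab] at hc
      rw [abs_of_nonneg (by linarith [hc.2]), abs_of_nonneg (by linarith [hc.1]),
        abs_of_nonneg (by linarith)]
      ring
  rcases h a ha with e1 | e1 <;> rcases h b hb with e2 | e2
  · rw [e1, e2]; exact h₁ a ha b hb
  · obtain ⟨c, hc, ⟨-, c1⟩, -, c2⟩ := hpre ⟨a, ha, ha, e1⟩ ⟨b, hb, hb, e2⟩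
    have h3 := h₁ a ha c hc
    have h4 := h₂ c hc b hb
    rw [← e1, ← show f c = g₁ c from c1] at h3
    rw [← e2, ← show f c = g₂ c from c2] at h4
    rw [← hsum c hc, mul_add]
    exact (norm_sub_le_norm_sub_add_norm_sub _ (f c) _).trans (add_le_add h3 h4)
  · obtain ⟨c, hc, ⟨-, c1⟩, -, c2⟩ := hpre ⟨b, hb, hb, e2⟩ ⟨a, ha, ha, e1⟩
    have h3 := h₂ a ha c hc
    have h4 := h₁ c hc b hb
    rw [← e1, ← show f c = g₂ c from c2] at h3
    rw [← e2, ← show f c = g₁ c from c1] at h4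
    rw [← hsum c hc, mul_add]
    exact (norm_sub_le_norm_sub_add_norm_sub _ (f c) _).trans (add_le_add h3 h4)
  · rw [e1, e2]; exact h₂ a ha b hb

section Motion

variable {T : ℝ} {U : Set P2} {Φ : ℝ → P2 → E3} {V₁ V₂ : ℝ → Set E3} {χ : ℝ → E3 ≃ₜ E3}
  {v : ℝ → E3 → E3} {t : ℝ} {u₀ : P2} {π : ℝ × E3 → E3} {r : ℝ}

lemma IsMotion.continuousAt (hχ : IsMotion T U Φ V₁ V₂ χ v) {s : ℝ} (hs : s ∈ Ioo 0 T) (y : E3) :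
    ContinuousAt (fun p : ℝ × E3 => χ p.1 p.2) (s, y) :=
  hχ.continuous.continuousAt (prod_mem_nhds (Icc_mem_nhds hs.1 hs.2) univ_mem)

lemma IsMotion.continuousAt_symm (hχ : IsMotion T U Φ V₁ V₂ χ v) {s : ℝ} (hs : s ∈ Ioo 0 T)
    (x : E3) : ContinuousAt (fun p : ℝ × E3 => (χ p.1).symm p.2) (s, x) :=
  hχ.continuous_symm.continuousAt (prod_mem_nhds (Icc_mem_nhds hs.1 hs.2) univ_mem)

lemma IsMotion.tendsto_graph (hχ : IsMotion T U Φ V₁ V₂ χ v) (ht : t ∈ Ioo 0 T) (x₀ : E3) :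
    Tendsto (fun p : ℝ × E3 => (p.1, χ p.1 p.2)) (𝓝 (t, (χ t).symm x₀)) (𝓝 (t, x₀)) := by
  have := (continuousAt_fst (p := (t, (χ t).symm x₀))).prodMk (hχ.continuousAt ht ((χ t).symm x₀))
  rw [ContinuousAt, Homeomorph.apply_symm_apply] at this
  exact this

/-- Near an initial position whose particle is on the surface at time `t`, the motion is Lipschitz
continuous in time, also for particles which meet the surface. -/
lemma IsMotion.exists_lipschitz (hS : IsSingularSurface T U Φ V₁ V₂)
    (hχ : IsMotion T U Φ V₁ V₂ χ v) (ht : t ∈ Ioo 0 T) (hu : u₀ ∈ U) :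
    ∃ C > 0, ∃ ρ > 0, ∀ y, ‖y - (χ t).symm (Φ t u₀)‖ < ρ → ∀ s s', |s - t| < ρ → |s' - t| < ρ →
      ‖χ s y - χ s' y‖ ≤ C * |s - s'| := by
  set x₀ := Φ t u₀ with hx₀
  set y₀ := (χ t).symm x₀ with hy₀
  have hmem : (t, y₀) ∈ spaceTime T fun t => χ t ⁻¹' (Φ t '' U) := by
    refine ⟨ht, ?_⟩
    change χ t y₀ ∈ Φ t '' U
    rw [hy₀, Homeomorph.apply_symm_apply]
    exact ⟨u₀, hu, rfl⟩
  obtain ⟨g₁, hg₁, he₁⟩ := hχ.smooth₁ (t, y₀) (Or.inr hmem)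
  obtain ⟨g₂, hg₂, he₂⟩ := hχ.smooth₂ (t, y₀) (Or.inr hmem)
  obtain ⟨K₁, N₁, hN₁, hL₁⟩ := hg₁.exists_lipschitzOnWith
  obtain ⟨K₂, N₂, hN₂, hL₂⟩ := hg₂.exists_lipschitzOnWith
  have he₁' := eventually_nhdsWithin_iff.1 he₁
  have he₂' := eventually_nhdsWithin_iff.1 he₂
  have htime : ∀ᶠ p : ℝ × E3 in 𝓝 (t, y₀), p.1 ∈ Ioo 0 T :=
    continuousAt_fst.eventually (isOpen_Ioo.mem_nhds ht)
  have hreg : ∀ᶠ p : ℝ × E3 in 𝓝 (t, y₀), (p.1, χ p.1 p.2) ∈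
      spaceTime T fun t => V₁ t ∪ Φ t '' U ∪ V₂ t :=
    (hχ.tendsto_graph ht x₀).eventually
      (hS.isOpen_region.mem_nhds ⟨ht, Or.inl (Or.inr ⟨u₀, hu, rfl⟩)⟩)
  have hc₁ : ∀ᶠ p in 𝓝 (t, y₀), ContinuousAt g₁ p :=
    (hg₁.eventually (by simp)).mono fun p hp => hp.continuousAt
  have hc₂ : ∀ᶠ p in 𝓝 (t, y₀), ContinuousAt g₂ p :=
    (hg₂.eventually (by simp)).mono fun p hp => hp.continuousAt
  -- on the surface `χ` agrees with the extension from the first side, by continuity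
  have hsurf : ∀ᶠ p : ℝ × E3 in 𝓝 (t, y₀), χ p.1 p.2 ∈ Φ p.1 '' U → χ p.1 p.2 = g₁ p := by
    filter_upwards [eventually_eventually_nhds.2 he₁', hc₁, htime] with p hp hcp hs
    rintro ⟨u, hu', hux⟩
    obtain ⟨s, y⟩ := p
    simp only at hux hs ⊢
    set ν := unitNormal (Φ s) u
    have hy : (χ s).symm (Φ s u) = y := by rw [hux, Homeomorph.symm_apply_apply]
    have t1 : Tendsto (fun l : ℝ => Φ s u - l • ν) (𝓝[>] 0) (𝓝 (Φ s u)) := by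
      refine Tendsto.mono_left ?_ nhdsWithin_le_nhds
      apply Continuous.tendsto' (by fun_prop); simp
    have t2 : Tendsto (fun l : ℝ => (s, (χ s).symm (Φ s u - l • ν))) (𝓝[>] 0) (𝓝 (s, y)) := by
      refine tendsto_const_nhds.prodMk_nhds ?_
      rw [← hy]
      exact ((χ s).symm.continuous.tendsto _).comp t1
    have t3 := hcp.tendsto.comp t2
    refine tendsto_nhds_unique (f := fun l : ℝ => Φ s u - l • ν) (l := 𝓝[>] 0) ?_ ?_
    · rw [← hux]; exact t1
    · refine t3.congr' ?_
      filter_upwards [t2.eventually hp, hS.normal_direction s hs u hu'] with l h1 h2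
      have h3 := h1 ⟨hs, by simpa using h2.2⟩
      simp only [Homeomorph.apply_symm_apply] at h3
      exact h3.symm
  have hall : ∀ᶠ p : ℝ × E3 in 𝓝 (t, y₀), (χ p.1 p.2 = g₁ p ∨ χ p.1 p.2 = g₂ p) ∧ p ∈ N₁ ∧ p ∈ N₂ ∧
      p.1 ∈ Ioo 0 T ∧ ContinuousAt g₁ p ∧ ContinuousAt g₂ p := by
    filter_upwards [hsurf, he₁', he₂', hreg, htime, hN₁, hN₂, hc₁, hc₂] with p h1 h2 h3 h4 h5 h6 h7
      h8 h9
    refine ⟨?_, h6, h7, h5, h8, h9⟩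
    rcases h4.2 with (h | h) | h
    · exact Or.inl (h2 ⟨h5, h⟩)
    · exact Or.inl (h1 h)
    · exact Or.inr (h3 ⟨h5, h⟩)
  obtain ⟨ρ, hρ, hb⟩ := Metric.eventually_nhds_iff_ball.1 hall
  refine ⟨(K₁ + K₂ + 1 : ℝ), by positivity, ρ, hρ, fun y hy s s' hs hs' => ?_⟩
  have hin : ∀ z ∈ uIcc s s', (z, y) ∈ Metric.ball (t, y₀) ρ := by
    intro z hz
    rw [Metric.mem_ball, Prod.dist_eq, max_lt_iff, dist_eq_norm, dist_eq_norm]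
    refine ⟨?_, hy⟩
    have h1 : uIcc s s' ⊆ Metric.ball t ρ :=
      (convex_ball t ρ).ordConnected.uIcc_subset (by simpa [Real.dist_eq] using hs)
        (by simpa [Real.dist_eq] using hs')
    simpa [Real.dist_eq] using h1 hz
  have hline : Continuous fun z : ℝ => (z, y) := by fun_prop
  have hdist : ∀ z z' : ℝ, dist (z, y) (z', y) = |z - z'| := fun z z' => by
    simp [Prod.dist_eq, Real.dist_eq]
  refine norm_sub_le_of_eq_or_eq (f := fun z => χ z y) (g₁ := fun z => g₁ (z, y))
    (g₂ := fun z => g₂ (z, y)) ?_ ?_ ?_ ?_ ?_ fun z hz => (hb _ (hin z hz)).1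
  · intro z hz
    exact (ContinuousAt.comp (f := fun z : ℝ => (z, y)) (x := z)
      (hχ.continuousAt (hb _ (hin z hz)).2.2.2.1 y) hline.continuousAt).continuousWithinAt
  · intro z hz
    exact (ContinuousAt.comp (f := fun z : ℝ => (z, y)) (x := z)
      (hb _ (hin z hz)).2.2.2.2.1 hline.continuousAt).continuousWithinAt
  · intro z hz
    exact (ContinuousAt.comp (f := fun z : ℝ => (z, y)) (x := z)
      (hb _ (hin z hz)).2.2.2.2.2 hline.continuousAt).continuousWithinAt
  · intro z hz z' hz'
    have := hL₁.dist_le_mul _ (hb _ (hin z hz)).2.1 _ (hb _ (hin z' hz')).2.1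
    rw [hdist, dist_eq_norm] at this
    exact this.trans (mul_le_mul_of_nonneg_right
      (by linarith [K₂.coe_nonneg]) (abs_nonneg _))
  · intro z hz z' hz'
    have := hL₂.dist_le_mul _ (hb _ (hin z hz)).2.2.1 _ (hb _ (hin z' hz')).2.2.1
    rw [hdist, dist_eq_norm] at this
    exact this.trans (mul_le_mul_of_nonneg_right
      (by linarith [K₁.coe_nonneg]) (abs_nonneg _))

lemma IsChart.apply_center (hπ : IsChart T U Φ V₁ V₂ t u₀ π r) : π (t, Φ t u₀) = 0 := by
  have := hπ.left_inv t 0 (by simpa using hπ.pos) (by simpa using hπ.pos)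
  rwa [chart_zero] at this

lemma IsChart.continuousAt (hπ : IsChart T U Φ V₁ V₂ t u₀ π r) : ContinuousAt π (t, Φ t u₀) := by
  obtain ⟨π', h, -⟩ := hπ.strict
  exact h.hasFDerivAt.continuousAt

/-- The coordinates of a particle are Lipschitz continuous in time. -/
lemma IsMotion.exists_lipschitz_chart (hS : IsSingularSurface T U Φ V₁ V₂)
    (hχ : IsMotion T U Φ V₁ V₂ χ v) (ht : t ∈ Ioo 0 T) (hu : u₀ ∈ U)
    (hπ : IsChart T U Φ V₁ V₂ t u₀ π r) :
    ∃ C > 0, ∃ ρ > 0, ∀ y, ‖y - (χ t).symm (Φ t u₀)‖ < ρ → ∀ s s', |s - t| < ρ → |s' - t| < ρ →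
      ‖χ s y - χ s' y‖ ≤ C * |s - s'| ∧
      ‖π (s, χ s y) - π (s', χ s' y)‖ ≤ C * |s - s'| := by
  obtain ⟨C, hC, ρ, hρ, hL⟩ := hχ.exists_lipschitz hS ht hu
  obtain ⟨π', hπ', -⟩ := hπ.strict
  obtain ⟨K, N, hN, hK⟩ := hπ'.exists_lipschitzOnWith
  obtain ⟨ρ', hρ', hb⟩ := Metric.eventually_nhds_iff_ball.1
    ((hχ.tendsto_graph ht (Φ t u₀)).eventually hN)
  refine ⟨max C (K * max 1 C), lt_max_of_lt_left hC, min ρ ρ', lt_min hρ hρ',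
    fun y hy s s' hs hs' => ?_⟩
  have h1 := hL y (hy.trans_le (min_le_left _ _)) s s' (hs.trans_le (min_le_left _ _))
    (hs'.trans_le (min_le_left _ _))
  refine ⟨h1.trans (mul_le_mul_of_nonneg_right (le_max_left _ _) (abs_nonneg _)), ?_⟩
  have hm : ∀ s, |s - t| < min ρ ρ' → (s, χ s y) ∈ N := fun s hs => hb (s, y) (by
    rw [Metric.mem_ball, Prod.dist_eq, max_lt_iff, dist_eq_norm, dist_eq_norm]
    exact ⟨hs.trans_le (min_le_right _ _), hy.trans_le (min_le_right _ _)⟩)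
  have h2 := hK.dist_le_mul _ (hm s hs) _ (hm s' hs')
  rw [dist_eq_norm, Prod.dist_eq, Real.dist_eq, dist_eq_norm] at h2
  refine h2.trans ?_
  have h3 : max |s - s'| ‖χ s y - χ s' y‖ ≤ max 1 C * |s - s'| := by
    refine max_le ?_ (h1.trans ?_)
    · nlinarith [le_max_left 1 C, abs_nonneg (s - s')]
    · exact mul_le_mul_of_nonneg_right (le_max_right _ _) (abs_nonneg _)
  calc (K : ℝ) * max |s - s'| ‖χ s y - χ s' y‖ ≤ K * (max 1 C * |s - s'|) :=
        mul_le_mul_of_nonneg_left h3 K.2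
    _ = K * max 1 C * |s - s'| := by ring
    _ ≤ _ := mul_le_mul_of_nonneg_right (le_max_right _ _) (abs_nonneg _)

/-- `V` is the side of the surface on which the third coordinate of the chart has the sign `σ`. -/
structure IsSide (T : ℝ) (U : Set P2) (Φ : ℝ → P2 → E3) (V : ℝ → Set E3) (t : ℝ) (u₀ : P2) (r : ℝ)
    (σ : ℝ) : Prop where
  sign : σ = 1 ∨ σ = -1
  mem_iff : ∀ s q, |s - t| < r → ‖q‖ < r →
    (chart Φ u₀ (unitNormal (Φ t) u₀) (s, q) ∈ V s ↔ 0 < σ * q 2)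

lemma chart_mem_surface {n q : E3} {s : ℝ} (hq : u₀ + proj q ∈ U) (h0 : q 2 = 0) :
    chart Φ u₀ n (s, q) ∈ Φ s '' U := ⟨u₀ + proj q, hq, by simp [chart, h0]⟩

lemma IsChart.isSide₂ (hS : IsSingularSurface T U Φ V₁ V₂)
    (hπ : IsChart T U Φ V₁ V₂ t u₀ π r) : IsSide T U Φ V₂ t u₀ r 1 where
  sign := Or.inl rfl
  mem_iff s q hs hq := by
    rw [one_mul]
    refine ⟨fun h => ?_, hπ.side₂ s q hs hq⟩
    have hT := hπ.mem_time s hs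
    rcases lt_trichotomy (q 2) 0 with h0 | h0 | h0
    · exact absurd h (Set.disjoint_left.1 (hS.disjoint₁₂ s hT) (hπ.side₁ s q hs hq h0))
    · exact absurd (chart_mem_surface (hπ.mem_param q hq) h0)
        (Set.disjoint_left.1 (hS.disjoint₂ s hT) h)
    · exact h0

lemma IsChart.isSide₁ (hS : IsSingularSurface T U Φ V₁ V₂)
    (hπ : IsChart T U Φ V₁ V₂ t u₀ π r) : IsSide T U Φ V₁ t u₀ r (-1) where
  sign := Or.inr rfl
  mem_iff s q hs hq := by
    rw [neg_one_mul, Left.neg_pos_iff]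
    refine ⟨fun h => ?_, hπ.side₁ s q hs hq⟩
    have hT := hπ.mem_time s hs
    rcases lt_trichotomy (q 2) 0 with h0 | h0 | h0
    · exact h0
    · exact absurd (chart_mem_surface (hπ.mem_param q hq) h0)
        (Set.disjoint_left.1 (hS.disjoint₁ s hT) h)
    · exact absurd (hπ.side₂ s q hs hq h0) (Set.disjoint_left.1 (hS.disjoint₁₂ s hT) h)

/-- The motion of a particle which stays on one side of the surface, to first order: its third
coordinate changes with the velocity `v · n - w_ν` relative to the surface. -/
lemma IsMotion.normal_displacement (hχ : IsMotion T U Φ V₁ V₂ χ v) (ht : t ∈ Ioo 0 T)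
    (hπ : IsChart T U Φ V₁ V₂ t u₀ π r) (hn : ‖unitNormal (Φ t) u₀‖ = 1) {V : ℝ → Set E3}
    (hV : ∀ s, V s ⊆ V₁ s ∪ V₂ s) {σ : ℝ} (hside : IsSide T U Φ V t u₀ r σ) {g : ℝ × E3 → E3}
    (hg : ContinuousAt g (t, Φ t u₀))
    (hvg : ∀ᶠ p in 𝓝 (t, Φ t u₀), p ∈ spaceTime T V → v p.1 p.2 = g p) {C ρ : ℝ} (hC : 0 < C)
    (hρ : 0 < ρ)
    (hL : ∀ y, ‖y - (χ t).symm (Φ t u₀)‖ < ρ → ∀ s s', |s - t| < ρ → |s' - t| < ρ →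
      ‖χ s y - χ s' y‖ ≤ C * |s - s'| ∧
      ‖π (s, χ s y) - π (s', χ s' y)‖ ≤ C * |s - s'|) {δ : ℝ} (hδ : 0 < δ) :
    ∀ᶠ p in 𝓝 (t, (χ t).symm (Φ t u₀)), C * |p.1 - t| < σ * π (p.1, χ p.1 p.2) 2 →
      |π (t, χ t p.2) 2 - π (p.1, χ p.1 p.2) 2
        - (t - p.1) * (inner ℝ (unitNormal (Φ t) u₀) (g (t, Φ t u₀)) - normalVelocity Φ t u₀)|
      ≤ δ * |p.1 - t| := by
  set n := unitNormal (Φ t) u₀ with hndef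
  set x₀ := Φ t u₀ with hx₀
  set y₀ := (χ t).symm x₀ with hy₀
  set w := g (t, x₀) with hw
  obtain ⟨π', hπ', hπ'2⟩ := hπ.strict
  have hσ1 : |σ| = 1 := by rcases hside.sign with h | h <;> simp [h]
  have hgr := hχ.tendsto_graph ht x₀
  have e1 := hgr.eventually hπ.right_inv
  have e2 := hgr.eventually (hπ.continuousAt.eventually (Metric.ball_mem_nhds _ hπ.pos))
  have e3 := hgr.eventually (hg.eventually (Metric.ball_mem_nhds _ (half_pos hδ)))
  have e4 := hgr.eventually hvg
  set c := δ / 2 / (1 + C) with hc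
  have hc0 : 0 < c := by positivity
  have hst : Tendsto (fun p : ℝ × E3 => ((t, χ t p.2), (p.1, χ p.1 p.2))) (𝓝 (t, y₀))
      (𝓝 ((t, x₀), (t, x₀))) := by
    refine Tendsto.prodMk_nhds ?_ hgr
    refine Tendsto.prodMk_nhds tendsto_const_nhds ?_
    have : Continuous fun p : ℝ × E3 => χ t p.2 := by fun_prop
    refine this.tendsto' _ _ ?_
    simp [hy₀]
  have e5 := hst.eventually (hπ'.isLittleO.def hc0)
  obtain ⟨ρ', hρ', hb⟩ := Metric.eventually_nhds_iff_ball.1 (((e1.and e2).and (e3.and e4)).and e5)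
  have hmin : 0 < min (min ρ ρ') r := lt_min (lt_min hρ hρ') hπ.pos
  filter_upwards [Metric.ball_mem_nhds (t, y₀) hmin] with p hp hpos
  obtain ⟨s, y⟩ := p
  simp only at hpos ⊢
  rw [Metric.mem_ball, Prod.dist_eq, max_lt_iff, Real.dist_eq, dist_eq_norm, lt_min_iff, lt_min_iff,
    lt_min_iff, lt_min_iff] at hp
  obtain ⟨⟨⟨hs1, hs2⟩, hs3⟩, ⟨hy1, hy2⟩, -⟩ := hp
  simp only at hs1 hs2 hs3 hy1 hy2
  have hin : ∀ z, |z - t| ≤ |s - t| → (z, y) ∈ Metric.ball (t, y₀) ρ' := fun z hz => by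
    rw [Metric.mem_ball, Prod.dist_eq, max_lt_iff, Real.dist_eq, dist_eq_norm]
    exact ⟨hz.trans_lt hs2, hy2⟩
  have huIcc : ∀ z ∈ uIcc s t, |z - t| ≤ |s - t| ∧ |s - z| ≤ |s - t| := fun z hz =>
    ⟨by rw [abs_sub_comm, abs_sub_comm s t]; exact abs_sub_right_of_mem_uIcc hz,
      by rw [abs_sub_comm, abs_sub_comm s t]; exact abs_sub_left_of_mem_uIcc hz⟩
  -- the whole trajectory between the times `s` and `t` stays on the side `V`
  have hmemV : ∀ z ∈ uIcc s t, χ z y ∈ V z ∧ ‖v z (χ z y) - w‖ ≤ δ / 2 ∧ z ∈ Ioo 0 T := by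
    intro z hz
    obtain ⟨hz1, hz2⟩ := huIcc z hz
    obtain ⟨⟨⟨b1, b2⟩, b3, b4⟩, -⟩ := hb (z, y) (hin z hz1)
    have hzT := hπ.mem_time z (hz1.trans_lt hs3)
    have hL1 := (hL y hy1 s z hs1 (hz1.trans_lt hs1)).2
    have h2 : |σ * (π (s, χ s y) 2 - π (z, χ z y) 2)| ≤ C * |s - t| := by
      rw [abs_mul, hσ1, one_mul]
      refine (abs_coord_le (π (s, χ s y) - π (z, χ z y)) 2).trans (hL1.trans ?_)
      exact mul_le_mul_of_nonneg_left hz2 hC.le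
    have h3 : 0 < σ * π (z, χ z y) 2 := by
      have := (abs_le.1 h2).2
      rw [mul_sub] at this
      linarith
    have hmem : χ z y ∈ V z := by
      have b2' : ‖π (z, χ z y)‖ < r := by simpa [hπ.apply_center] using b2
      have := (hside.mem_iff z _ (hz1.trans_lt hs3) b2').2 h3
      simp only at b1
      rwa [b1] at this
    refine ⟨hmem, ?_, hzT⟩
    have b4' := b4 ⟨hzT, hmem⟩
    simp only at b4'
    rw [b4', ← dist_eq_norm]
    exact (Metric.mem_ball.1 b3).le
  have hdisp : ‖χ t y - χ s y - (t - s) • w‖ ≤ δ / 2 * |s - t| := by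
    have := Convex.norm_image_sub_le_of_norm_hasDerivWithin_le (f := fun z => χ z y - z • w)
      (f' := fun z => v z (χ z y) - w) (C := δ / 2) (s := uIcc s t) (x := s) (y := t)
      (fun z hz => ((hχ.velocity z (hmemV z hz).2.2 y (hV z (hmemV z hz).1)).sub (by
        simpa using (hasDerivAt_id z).smul_const w)).hasDerivWithinAt)
      (fun z hz => (hmemV z hz).2.1) (convex_uIcc s t) left_mem_uIcc right_mem_uIcc
    rw [Real.norm_eq_abs, abs_sub_comm] at this
    refine le_trans (le_of_eq ?_) this
    congr 1
    module
  have hstr := (hb (s, y) (hin s le_rfl)).2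
  simp only at hstr
  have hnorm : ‖((t, χ t y) : ℝ × E3) - (s, χ s y)‖ ≤ (1 + C) * |s - t| := by
    rw [Prod.norm_def]
    have h1 := (hL y hy1 t s (by simpa using hρ) hs1).1
    rw [abs_sub_comm] at h1
    have h2 := abs_nonneg (s - t)
    refine max_le ?_ ?_
    · simp only [Prod.mk_sub_mk, Real.norm_eq_abs]
      rw [abs_sub_comm]; nlinarith
    · simp only [Prod.mk_sub_mk]; nlinarith
  have hstr2 : ‖π (t, χ t y) - π (s, χ s y) - π' ((t, χ t y) - (s, χ s y))‖ ≤ δ / 2 * |s - t| := by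
    refine hstr.trans ((mul_le_mul_of_nonneg_left hnorm hc0.le).trans (le_of_eq ?_))
    rw [hc]; field_simp
  have hstr3 := (abs_coord_le _ 2).trans hstr2
  have hinner : |inner ℝ n (χ t y - χ s y - (t - s) • w)| ≤ δ / 2 * |s - t| := by
    refine (abs_real_inner_le_norm _ _).trans ?_
    rw [hn, one_mul]; exact hdisp
  rw [Prod.mk_sub_mk] at hstr3
  simp only [PiLp.sub_apply, hπ'2] at hstr3
  rw [inner_sub_right, inner_smul_right] at hinner
  have := abs_add_le _ _ |>.trans (add_le_add hstr3 hinner)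
  refine le_trans (le_of_eq ?_) (this.trans (le_of_eq (by ring)))
  congr 1
  ring

end Motion

/-! ### The volume integral over the material volume -/

/-- The open slab `|q₀|, |q₁| < e`, `lo < σ q₂ < hi`. -/
def slab (σ e lo hi : ℝ) : Set E3 := {q | |q 0| < e ∧ |q 1| < e ∧ lo < σ * q 2 ∧ σ * q 2 < hi}

lemma slab_eq_gbox {σ : ℝ} (hσ : σ = 1 ∨ σ = -1) (e lo hi : ℝ) :
    ∃ l u : ℝ, u - l = hi - lo ∧ slab σ e lo hi = gbox ![-e, -e, l] ![e, e, u] := by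
  rcases hσ with rfl | rfl
  · refine ⟨lo, hi, rfl, ?_⟩
    ext q
    simp [slab, gbox, Fin.forall_fin_succ, abs_lt, and_assoc]
  · refine ⟨-hi, -lo, by ring, ?_⟩
    ext q
    simp only [slab, gbox, mem_ofPred_eq, Fin.forall_fin_succ, abs_lt]
    simp
    intro _ _ _ _
    constructor <;> rintro ⟨h3, h4⟩ <;> exact ⟨by linarith, by linarith⟩

lemma measurableSet_slab {σ : ℝ} (hσ : σ = 1 ∨ σ = -1) (e lo hi : ℝ) :
    MeasurableSet (slab σ e lo hi) := by
  obtain ⟨l, u, -, h⟩ := slab_eq_gbox hσ e lo hi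
  rw [h]; exact (isOpen_gbox _ _).measurableSet

lemma volume_slab_lt_top {σ : ℝ} (hσ : σ = 1 ∨ σ = -1) (e lo hi : ℝ) :
    volume (slab σ e lo hi) < ⊤ := by
  obtain ⟨l, u, -, h⟩ := slab_eq_gbox hσ e lo hi
  rw [h]; exact volume_gbox_lt_top _ _

lemma volume_real_slab {σ : ℝ} (hσ : σ = 1 ∨ σ = -1) {e lo hi : ℝ} (he : 0 ≤ e) (h : lo ≤ hi) :
    volume.real (slab σ e lo hi) = 4 * e ^ 2 * (hi - lo) := by
  obtain ⟨l, u, hlu, hs⟩ := slab_eq_gbox hσ e lo hi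
  rw [hs, volume_real_gbox (by
    intro i; fin_cases i
    · change -e ≤ e; linarith
    · change -e ≤ e; linarith
    · change l ≤ u; linarith), ← hlu, Fin.prod_univ_three]
  change (e - -e) * (e - -e) * (u - l) = _
  ring

lemma slab_subset {σ e e' lo hi hi' : ℝ} (he : e ≤ e') (hh : hi ≤ hi') :
    slab σ e lo hi ⊆ slab σ e' lo hi' := fun _ h =>
  ⟨h.1.trans_le he, h.2.1.trans_le he, h.2.2.1, h.2.2.2.trans_le hh⟩

/-- Two integrals whose domains differ little, of integrands which differ little from each other and
from a constant, differ by the constant times the difference of the volumes. The domains are compared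
by a common inner approximation `I` and a common outer approximation `O`. -/
lemma abs_setIntegral_sub_le {A B I O : Set E3} {f g : E3 → ℝ} {c δ L : ℝ}
    (hA : MeasurableSet A) (hB : MeasurableSet B) (hI : MeasurableSet I) (hIA : I ⊆ A)
    (hAO : A ⊆ O) (hIB : I ⊆ B) (hBO : B ⊆ O) (hO : volume O < ⊤) (hL : 0 ≤ L) (hδ : 0 ≤ δ)
    (hf : IntegrableOn f A) (hg : IntegrableOn g B) (h1 : ∀ q ∈ A, |f q - c| ≤ δ)
    (h2 : ∀ q ∈ B, |g q - c| ≤ δ) (h3 : ∀ q ∈ A, q ∈ B → |f q - g q| ≤ L) :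
    |(∫ q in A, f q) - (∫ q in B, g q) - c * (volume.real A - volume.real B)|
      ≤ L * volume.real B + 2 * δ * (volume.real O - volume.real I) := by
  have fA : volume A < ⊤ := (measure_mono hAO).trans_lt hO
  have fB : volume B < ⊤ := (measure_mono hBO).trans_lt hO
  have hcA : IntegrableOn (fun _ => c) A := integrableOn_const fA.ne
  have hcB : IntegrableOn (fun _ => c) B := integrableOn_const fB.ne
  have e1 : (∫ q in A, (f q - c)) = (∫ q in A, f q) - c * volume.real A := by
    rw [integral_sub hf hcA, setIntegral_const, smul_eq_mul, mul_comm]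
  have e2 : (∫ q in B, (g q - c)) = (∫ q in B, g q) - c * volume.real B := by
    rw [integral_sub hg hcB, setIntegral_const, smul_eq_mul, mul_comm]
  have hF : IntegrableOn (fun q => f q - c) A := hf.sub hcA
  have hG : IntegrableOn (fun q => g q - c) B := hg.sub hcB
  have s1 := integral_inter_add_sdiff hB hF
  have s2 := integral_inter_add_sdiff hA hG
  rw [inter_comm] at s2
  have e3 : (∫ q in A ∩ B, (f q - g q))
      = (∫ q in A ∩ B, (f q - c)) - ∫ q in A ∩ B, (g q - c) := by
    rw [← integral_sub (hF.mono_set inter_subset_left) (hG.mono_set inter_subset_right)]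
    exact integral_congr_ae (ae_of_all _ fun q => by ring)
  have b1 : |∫ q in A ∩ B, (f q - g q)| ≤ L * volume.real B := by
    refine (norm_setIntegral_le_of_norm_le_const ((measure_mono inter_subset_right).trans_lt fB)
      fun q hq => (Real.norm_eq_abs _).trans_le (h3 q hq.1 hq.2)).trans ?_
    exact mul_le_mul_of_nonneg_left (measureReal_mono inter_subset_right fB.ne) hL
  have hOI : volume.real (O \ I) = volume.real O - volume.real I :=
    measureReal_sdiff (hIA.trans hAO) hI hO.ne
  have fOI : volume (O \ I) ≠ ⊤ := ((measure_mono sdiff_subset).trans_lt hO).ne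
  have b2 : |∫ q in A \ B, (f q - c)| ≤ δ * (volume.real O - volume.real I) := by
    refine (norm_setIntegral_le_of_norm_le_const
      ((measure_mono sdiff_subset).trans_lt fA) fun q hq =>
        (Real.norm_eq_abs _).trans_le (h1 q hq.1)).trans ?_
    rw [← hOI]
    exact mul_le_mul_of_nonneg_left (measureReal_mono (sdiff_subset_sdiff hAO hIB) fOI) hδ
  have b3 : |∫ q in B \ A, (g q - c)| ≤ δ * (volume.real O - volume.real I) := by
    refine (norm_setIntegral_le_of_norm_le_const
      ((measure_mono sdiff_subset).trans_lt fB) fun q hq =>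
        (Real.norm_eq_abs _).trans_le (h2 q hq.1)).trans ?_
    rw [← hOI]
    exact mul_le_mul_of_nonneg_left (measureReal_mono (sdiff_subset_sdiff hBO hIA) fOI) hδ
  have key : (∫ q in A, f q) - (∫ q in B, g q) - c * (volume.real A - volume.real B)
      = (∫ q in A ∩ B, (f q - g q)) + (∫ q in A \ B, (f q - c)) - ∫ q in B \ A, (g q - c) := by
    linarith
  rw [key]
  rw [abs_le] at *
  constructor <;> linarith [b1.1, b1.2, b2.1, b2.2, b3.1, b3.2]

section Volume

variable {T : ℝ} {U : Set P2} {Φ : ℝ → P2 → E3} {V₁ V₂ : ℝ → Set E3} {χ : ℝ → E3 ≃ₜ E3}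
  {v : ℝ → E3 → E3} {t : ℝ} {u₀ : P2} {π : ℝ × E3 → E3} {r : ℝ}

lemma IsChart.contDiffAt (hS : IsSingularSurface T U Φ V₁ V₂)
    (hπ : IsChart T U Φ V₁ V₂ t u₀ π r) {s : ℝ} {q n : E3} (hs : |s - t| < r) (hq : ‖q‖ < r) :
    ContDiffAt ℝ 2 (chart Φ u₀ n) (s, q) :=
  contDiffAt_chart (hS.contDiffAt (hπ.mem_time s hs) (hπ.mem_param q hq))

lemma IsChart.differentiableAt (hS : IsSingularSurface T U Φ V₁ V₂)
    (hπ : IsChart T U Φ V₁ V₂ t u₀ π r) {s : ℝ} {q : E3} (hs : |s - t| < r) (hq : ‖q‖ < r) :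
    DifferentiableAt ℝ (Φ s) (u₀ + proj q) :=
  (hS.contDiffAt_slice (hπ.mem_time s hs) (hπ.mem_param q hq)).differentiableAt (by norm_num)

lemma IsChart.isPositiveDiffeo (hS : IsSingularSurface T U Φ V₁ V₂)
    (hπ : IsChart T U Φ V₁ V₂ t u₀ π r) {s : ℝ} (hs : |s - t| < r) :
    IsPositiveDiffeo (fun q => chart Φ u₀ (unitNormal (Φ t) u₀) (s, q)) r where
  smooth q hq := ContDiffAt.comp (f := fun q : E3 => (s, q)) q
    ((hπ.contDiffAt hS hs hq).of_le (by norm_num)) (contDiffAt_const.prodMk contDiffAt_id)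
  injOn q hq q' hq' h := by
    rw [mem_ball_zero_iff] at hq hq'
    rw [← hπ.left_inv s q hs hq, ← hπ.left_inv s q' hs hq', show chart Φ u₀ _ (s, q) = _ from h]
  det_pos q hq := by
    rw [det_chart (hπ.differentiableAt hS hs hq)]
    exact hπ.det_pos s q hs hq

/-- The half side lengths of the flat boxes used as control volumes. -/
def flatSides (δ ε : ℝ) : Fin 3 → ℝ := ![ε, ε, δ * ε]

/-- The flat curvilinear box around the surface point of parameter `u₀`. -/
def pillbox (Φ : ℝ → P2 → E3) (t : ℝ) (u₀ : P2) (δ ε : ℝ) : Set E3 :=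
  (fun q => chart Φ u₀ (unitNormal (Φ t) u₀) (t, q)) '' box (flatSides δ ε)

lemma mem_flatBox {δ ε : ℝ} {q : E3} :
    q ∈ box (flatSides δ ε) ↔ |q 0| < ε ∧ |q 1| < ε ∧ |q 2| < δ * ε := by
  simp [box, flatSides, Fin.forall_fin_succ]

lemma flatSides_pos {δ ε : ℝ} (hδ : 0 < δ) (hε : 0 < ε) (i : Fin 3) : 0 < flatSides δ ε i := by
  fin_cases i <;> simp [flatSides] <;> positivity

lemma flatSides_le {δ ε : ℝ} (hδ : δ < 1) (hε : 0 < ε) (i : Fin 3) : flatSides δ ε i ≤ ε := by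
  fin_cases i <;> simp [flatSides]
  nlinarith

lemma isOpen_pillbox (hS : IsSingularSurface T U Φ V₁ V₂)
    (hπ : IsChart T U Φ V₁ V₂ t u₀ π r) {δ ε : ℝ} (hδ : δ < 1) (hε : 0 < ε) (hεr : 2 * ε < r) :
    IsOpen (pillbox Φ t u₀ δ ε) :=
  (hπ.isPositiveDiffeo hS (by simpa using hπ.pos)).isOpen_image (isOpen_box _)
    ((box_subset_cbox _).trans (cbox_subset_ball fun i => by linarith [flatSides_le hδ hε i]))

/-- The part on the side `σ` of the material volume at time `s`, in the coordinates of the chart. -/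
def materialPart (Φ : ℝ → P2 → E3) (χ : ℝ → E3 ≃ₜ E3) (t : ℝ) (u₀ : P2) (σ r δ ε s : ℝ) : Set E3 :=
  {q | ‖q‖ < r ∧ 0 < σ * q 2 ∧
    χ t ((χ s).symm (chart Φ u₀ (unitNormal (Φ t) u₀) (s, q))) ∈ pillbox Φ t u₀ δ ε}

lemma isOpen_materialPart (hS : IsSingularSurface T U Φ V₁ V₂)
    (hπ : IsChart T U Φ V₁ V₂ t u₀ π r) {δ ε : ℝ} (hδ : δ < 1) (hε : 0 < ε) (hεr : 2 * ε < r)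
    {σ r' s : ℝ} (hr' : r' ≤ r) (hs : |s - t| < r) :
    IsOpen (materialPart Φ χ t u₀ σ r' δ ε s) := by
  have hc : ContinuousOn (fun q => χ t ((χ s).symm (chart Φ u₀ (unitNormal (Φ t) u₀) (s, q))))
      (Metric.ball (0 : E3) r') :=
    ((χ t).continuous.comp (χ s).symm.continuous).comp_continuousOn
      ((hπ.isPositiveDiffeo hS hs).continuousOn.mono (Metric.ball_subset_ball hr'))
  have h1 := hc.isOpen_inter_preimage Metric.isOpen_ball (isOpen_pillbox hS hπ hδ hε hεr)
  have h2 : IsOpen {q : E3 | 0 < σ * q 2} := isOpen_lt (by fun_prop) (by fun_prop)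
  convert h1.inter h2 using 1
  ext q
  simp only [materialPart, mem_ofPred_eq, mem_inter_iff, mem_ball_zero_iff, mem_preimage]
  tauto

/-- The part on one side of the material volume of a flat box is, in the coordinates of the chart,
a flat box whose thickness changes with the velocity of the particles relative to the surface, up
to an error at the lateral faces. -/
lemma materialPart_sandwich (hS : IsSingularSurface T U Φ V₁ V₂) (hχ : IsMotion T U Φ V₁ V₂ χ v)
    (ht : t ∈ Ioo 0 T) (hπ : IsChart T U Φ V₁ V₂ t u₀ π r)
    (hn : ‖unitNormal (Φ t) u₀‖ = 1) {V : ℝ → Set E3} (hV : ∀ s, V s ⊆ V₁ s ∪ V₂ s) {σ : ℝ}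
    (hside : IsSide T U Φ V t u₀ r σ) {g : ℝ × E3 → E3} (hg : ContinuousAt g (t, Φ t u₀))
    (hvg : ∀ᶠ p in 𝓝 (t, Φ t u₀), p ∈ spaceTime T V → v p.1 p.2 = g p) {C ρ : ℝ} (hC : 0 < C)
    (hρ : 0 < ρ)
    (hL : ∀ y, ‖y - (χ t).symm (Φ t u₀)‖ < ρ → ∀ s s', |s - t| < ρ → |s' - t| < ρ →
      ‖χ s y - χ s' y‖ ≤ C * |s - s'| ∧
      ‖π (s, χ s y) - π (s', χ s' y)‖ ≤ C * |s - s'|) {δ : ℝ} (hδ : δ ∈ Ioo (0 : ℝ) 1) {c C₁ : ℝ}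
    (hc : c = inner ℝ (unitNormal (Φ t) u₀) (g (t, Φ t u₀)) - normalVelocity Φ t u₀)
    (hC₁ : C₁ = C + |c| + 1) {r' : ℝ} (hr'0 : 0 < r') (hr' : r' ≤ r) :
    ∀ᶠ ε in 𝓝[>] (0 : ℝ), ∀ᶠ s in 𝓝 t,
      χ s '' (χ t ⁻¹' pillbox Φ t u₀ δ ε) ∩ V s
          = (fun q => chart Φ u₀ (unitNormal (Φ t) u₀) (s, q)) ''
            materialPart Φ χ t u₀ σ r' δ ε s ∧
      slab σ (ε - C₁ * |s - t|) 0 (δ * ε + σ * ((s - t) * c) - δ * |s - t|)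
        ⊆ materialPart Φ χ t u₀ σ r' δ ε s ∧
      materialPart Φ χ t u₀ σ r' δ ε s
        ⊆ slab σ (ε + C₁ * |s - t|) 0 (δ * ε + σ * ((s - t) * c) + δ * |s - t|) := by
  obtain ⟨hδ0, hδ1⟩ := hδ
  set n := unitNormal (Φ t) u₀ with hndef
  set x₀ := Φ t u₀ with hx₀
  set y₀ := (χ t).symm x₀ with hy₀
  have hσ1 : |σ| = 1 := by rcases hside.sign with h | h <;> simp [h]
  have hgr := hχ.tendsto_graph ht x₀
  have e1 := hgr.eventually hπ.right_inv
  have e2 := hgr.eventually (hπ.continuousAt.eventually (Metric.ball_mem_nhds _ hr'0))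
  have e3 := hχ.normal_displacement ht hπ hn hV hside hg hvg hC hρ hL hδ0
  rw [← hc] at e3
  obtain ⟨ρ₁', hρ₁', hb⟩ := Metric.eventually_nhds_iff_ball.1 ((e1.and e2).and e3)
  set ρ₁ := min ρ₁' (min ρ r) with hρ₁def
  have hρ₁ : 0 < ρ₁ := lt_min hρ₁' (lt_min hρ hπ.pos)
  have hball : ∀ s y, |s - t| < ρ₁ → ‖y - y₀‖ < ρ₁ → (s, y) ∈ Metric.ball (t, y₀) ρ₁' := by
    intro s y hs hy
    rw [Metric.mem_ball, Prod.dist_eq, max_lt_iff, Real.dist_eq, dist_eq_norm]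
    exact ⟨hs.trans_le (min_le_left _ _), hy.trans_le (min_le_left _ _)⟩
  have e4 : ∀ᶠ p : ℝ × E3 in 𝓝 (t, 0), ‖(χ p.1).symm (chart Φ u₀ n p) - y₀‖ < ρ₁ := by
    have h1 : ContinuousAt (chart Φ u₀ n) (t, 0) :=
      (hπ.contDiffAt hS (by simpa using hπ.pos) (by simpa using hπ.pos)).continuousAt
    have h2 : ContinuousAt (fun p : ℝ × E3 => (p.1, chart Φ u₀ n p)) (t, 0) :=
      continuousAt_fst.prodMk h1
    have h3 : ContinuousAt (fun p : ℝ × E3 => (χ p.1).symm (chart Φ u₀ n p)) (t, 0) := by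
      exact ContinuousAt.comp (g := fun p : ℝ × E3 => (χ p.1).symm p.2)
        (f := fun p : ℝ × E3 => (p.1, chart Φ u₀ n p)) (hχ.continuousAt_symm ht _) h2
    have h4 := h3.eventually (Metric.ball_mem_nhds _ hρ₁)
    simp only [chart_zero] at h4
    filter_upwards [h4] with p hp
    simpa [dist_eq_norm] using hp
  obtain ⟨ρ₂', hρ₂', hb₂⟩ := Metric.eventually_nhds_iff_ball.1 e4
  set ρ₂ := min ρ₂' (min ρ₁ r') with hρ₂def
  have hρ₂ : 0 < ρ₂ := lt_min hρ₂' (lt_min hρ₁ hr'0)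
  have hnear : ∀ s q, |s - t| < ρ₂ → ‖q‖ < ρ₂ → ‖(χ s).symm (chart Φ u₀ n (s, q)) - y₀‖ < ρ₁ :=
    fun s q hs hq => hb₂ (s, q) (abs_lt_and_norm_lt_of_ball.2
      ⟨hs.trans_le (min_le_left _ _), hq.trans_le (min_le_left _ _)⟩)
  have hρ₂₁ : ρ₂ ≤ ρ₁ := (min_le_right _ _).trans (min_le_left _ _)
  have hρ₂r' : ρ₂ ≤ r' := (min_le_right _ _).trans (min_le_right _ _)
  have hρ₁ρ : ρ₁ ≤ ρ := (min_le_right _ _).trans (min_le_left _ _)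
  have hρ₁r : ρ₁ ≤ r := (min_le_right _ _).trans (min_le_right _ _)
  have htt : |t - t| < ρ₂ := by simpa using hρ₂
  filter_upwards [Ioo_mem_nhdsGT (show 0 < ρ₂ / 4 by positivity)] with ε hε
  obtain ⟨hε0, hε1⟩ := hε
  have hh0 : 0 < δ * ε := mul_pos hδ0 hε0
  have hhε : δ * ε < ε := by nlinarith
  have hC₁0 : 0 < C₁ := by rw [hC₁]; positivity
  have hsmall : ∀ᶠ s in 𝓝 t, |s - t| < min ρ₂ (δ * ε / (2 * C₁)) := by
    have : 0 < min ρ₂ (δ * ε / (2 * C₁)) := lt_min hρ₂ (by positivity)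
    filter_upwards [Metric.ball_mem_nhds t this] with s hs
    simpa [Real.dist_eq] using hs
  filter_upwards [hsmall] with s hs
  set k := |s - t| with hk
  have hk0 : 0 ≤ k := abs_nonneg _
  have hkρ : k < ρ₂ := hs.trans_le (min_le_left _ _)
  have hkm : 2 * (C₁ * k) < δ * ε := by
    have h1 := hs.trans_le (min_le_right _ _)
    rw [lt_div_iff₀ (by positivity)] at h1
    linarith
  have hCk : C * k + |c| * k + k = C₁ * k := by rw [hC₁]; ring
  have hκ : |σ * ((s - t) * c)| ≤ |c| * k := by
    rw [abs_mul, hσ1, one_mul, abs_mul, mul_comm]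
  have hCk0 : 0 ≤ C * k := by positivity
  have hck0 : 0 ≤ |c| * k := by positivity
  obtain ⟨hκ1, hκ2⟩ := abs_le.1 hκ
  have hδk : δ * k ≤ k := by nlinarith
  have hδk0 : 0 ≤ δ * k := by positivity
  have hsr : |s - t| < r := hkρ.trans_le (hρ₂₁.trans hρ₁r)
  -- points of the box at time `t`
  have hbox : ∀ b ∈ box (flatSides δ ε), ‖b‖ < ρ₂ := by
    intro b hbb
    rw [mem_flatBox] at hbb
    refine (norm_le_of_coord (c := ε) fun i => ?_).trans_lt (by linarith)
    fin_cases i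
    exacts [hbb.1.le, hbb.2.1.le, (hbb.2.2.trans hhε).le]
  have hpar : ∀ y, ‖y - y₀‖ < ρ₁ →
      ‖π (s, χ s y) - π (t, χ t y)‖ ≤ C * k ∧
      chart Φ u₀ n (s, π (s, χ s y)) = χ s y ∧ chart Φ u₀ n (t, π (t, χ t y)) = χ t y ∧
      ‖π (s, χ s y)‖ < r' ∧
      (C * k < σ * π (s, χ s y) 2 →
        |π (t, χ t y) 2 - π (s, χ s y) 2 - (t - s) * c| ≤ δ * k) := by
    intro y hy
    have b1 := hb (s, y) (hball s y (hkρ.trans_le hρ₂₁) hy)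
    have b2 := hb (t, y) (hball t y (htt.trans_le hρ₂₁) hy)
    refine ⟨(hL y (hy.trans_le hρ₁ρ) s t (hkρ.trans_le (hρ₂₁.trans hρ₁ρ))
      (htt.trans_le (hρ₂₁.trans hρ₁ρ))).2, b1.1.1, b2.1.1, ?_, b1.2⟩
    simpa [hπ.apply_center] using b1.1.2
  have hσσ : ∀ x : ℝ, σ * x ≤ |x| := fun x => by
    rw [← one_mul |x|, ← hσ1, ← abs_mul]; exact le_abs_self _
  have hσσ' : ∀ x : ℝ, -|x| ≤ σ * x := fun x => by
    rw [← one_mul |x|, ← hσ1, ← abs_mul]; exact neg_abs_le _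
  refine ⟨?_, ?_, ?_⟩
  · ext x
    constructor
    · rintro ⟨⟨y, hy, rfl⟩, hxV⟩
      obtain ⟨b, hbb, hbe⟩ := hy
      have hyb : (χ t).symm (chart Φ u₀ n (t, b)) = y := by
        rw [show chart Φ u₀ n (t, b) = χ t y from hbe, Homeomorph.symm_apply_apply]
      have hy1 : ‖y - y₀‖ < ρ₁ := by rw [← hyb]; exact hnear t b htt (hbox b hbb)
      obtain ⟨-, p2, -, p4, -⟩ := hpar y hy1
      refine ⟨π (s, χ s y), ⟨p4, ?_, ?_⟩, p2⟩
      · rw [← hside.mem_iff s _ hsr (p4.trans_le hr'), p2]; exact hxV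
      · rw [p2, Homeomorph.symm_apply_apply]; exact ⟨b, hbb, hbe⟩
    · rintro ⟨q, ⟨h1, h2, h3⟩, rfl⟩
      refine ⟨⟨(χ s).symm (chart Φ u₀ n (s, q)), h3, Homeomorph.apply_symm_apply _ _⟩, ?_⟩
      exact (hside.mem_iff s _ hsr (h1.trans_le hr')).2 h2
  · rintro q ⟨h0, h1, h2, h3⟩
    have hqn : ‖q‖ < ρ₂ := by
      refine (norm_le_of_coord (c := 2 * ε) fun i => ?_).trans_lt (by linarith)
      have hq2 : |q 2| ≤ 2 * ε := by
        rw [← one_mul |q 2|, ← hσ1, ← abs_mul, abs_of_pos h2]; linarith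
      fin_cases i
      · exact h0.le.trans (by linarith)
      · exact h1.le.trans (by linarith)
      · exact hq2
    have hy := hnear s q hkρ hqn
    set y := (χ s).symm (chart Φ u₀ n (s, q)) with hydef
    have hχy : χ s y = chart Φ u₀ n (s, q) := Homeomorph.apply_symm_apply _ _
    obtain ⟨p1, -, p3, -, p5⟩ := hpar y hy
    have hπq : π (s, χ s y) = q := by
      rw [hχy]; exact hπ.left_inv s q hsr (hqn.trans_le (hρ₂r'.trans hr'))
    rw [hπq] at p1 p5
    set b := π (t, χ t y) with hbdef
    have hcoord : ∀ i, |q i - b i| ≤ C * k := fun i => (abs_coord_le (q - b) i).trans p1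
    refine ⟨hqn.trans_le hρ₂r', h2, b, ?_, p3⟩
    have habs : ∀ i, |b i| ≤ |q i| + C * k := fun i => by
      have := abs_sub_abs_le_abs_sub (b i) (q i)
      rw [abs_sub_comm] at this
      linarith [hcoord i]
    rw [mem_flatBox]
    refine ⟨by linarith [habs 0], by linarith [habs 1], ?_⟩
    rw [← one_mul |b 2|, ← hσ1, ← abs_mul, abs_lt]
    have h4 := hσσ (q 2 - b 2)
    have h5 := hσσ' (q 2 - b 2)
    have h6 := hcoord 2
    rw [mul_sub] at h4 h5
    refine ⟨by linarith, ?_⟩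
    -- a particle close to the surface at time `s` may cross it; then Lipschitz continuity suffices
    rcases lt_or_ge (C * k) (σ * q 2) with hcase | hcase
    · have h7 := p5 hcase
      have h8 := hσσ (b 2 - q 2 - (t - s) * c)
      have h9 : σ * (b 2 - q 2 - (t - s) * c) = σ * b 2 - σ * q 2 + σ * ((s - t) * c) := by ring
      linarith
    · linarith
  · rintro q ⟨h1, h2, b, hbb, hbe⟩
    set y := (χ s).symm (chart Φ u₀ n (s, q)) with hydef
    have hχy : χ s y = chart Φ u₀ n (s, q) := Homeomorph.apply_symm_apply _ _
    have hyb : (χ t).symm (chart Φ u₀ n (t, b)) = y := by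
      rw [show chart Φ u₀ n (t, b) = χ t y from hbe, Homeomorph.symm_apply_apply]
    have hy : ‖y - y₀‖ < ρ₁ := by rw [← hyb]; exact hnear t b htt (hbox b hbb)
    obtain ⟨p1, -, -, -, p5⟩ := hpar y hy
    have hπq : π (s, χ s y) = q := by
      rw [hχy]; exact hπ.left_inv s q hsr (h1.trans_le hr')
    have hπb : π (t, χ t y) = b := by
      rw [← hbe]
      exact hπ.left_inv t b (by simpa using hπ.pos)
        ((hbox b hbb).trans_le (hρ₂r'.trans hr'))
    rw [hπq, hπb] at p1 p5
    have hcoord : ∀ i, |q i - b i| ≤ C * k := fun i => (abs_coord_le (q - b) i).trans p1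
    have habs : ∀ i, |q i| ≤ |b i| + C * k := fun i => by
      have := abs_sub_abs_le_abs_sub (q i) (b i)
      linarith [hcoord i]
    rw [mem_flatBox] at hbb
    obtain ⟨g0, g1, g2⟩ := hbb
    refine ⟨by linarith [habs 0], by linarith [habs 1], h2, ?_⟩
    rcases lt_or_ge (C * k) (σ * q 2) with hcase | hcase
    · have h7 := p5 hcase
      have h8 := hσσ' (b 2 - q 2 - (t - s) * c)
      have h9 : σ * (b 2 - q 2 - (t - s) * c) = σ * b 2 - σ * q 2 + σ * ((s - t) * c) := by ring
      have h10 := hσσ (b 2)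
      linarith
    · linarith

end Volume

section VolumeTerm

variable {T : ℝ} {U : Set P2} {Φ : ℝ → P2 → E3} {V₁ V₂ : ℝ → Set E3} {χ : ℝ → E3 ≃ₜ E3}
  {v : ℝ → E3 → E3} {t : ℝ} {u₀ : P2} {π : ℝ × E3 → E3} {r : ℝ}

/-- The density of a volume field `g` in the coordinates of the chart. -/
def density (Φ : ℝ → P2 → E3) (u₀ : P2) (n : E3) (g : ℝ × E3 → ℝ) (p : ℝ × E3) : ℝ :=
  inner ℝ (normalVec (Φ p.1) (u₀ + proj p.2)) n * g (p.1, chart Φ u₀ n p)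

lemma inner_normalVec_unitNormal {X : P2 → E3} {u : P2} (h : normalVec X u ≠ 0) :
    inner ℝ (normalVec X u) (unitNormal X u) = areaDensity X u := by
  rw [normalVec_eq_smul, inner_smul_left, real_inner_self_eq_norm_sq, norm_unitNormal h]
  simp

lemma density_center {g : ℝ × E3 → ℝ} (h : normalVec (Φ t) u₀ ≠ 0) :
    density Φ u₀ (unitNormal (Φ t) u₀) g (t, 0) = areaDensity (Φ t) u₀ * g (t, Φ t u₀) := by
  simp [density, chart_zero, inner_normalVec_unitNormal h]

lemma tendsto_chartGraph (hS : IsSingularSurface T U Φ V₁ V₂) (ht : t ∈ Ioo 0 T)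
    (hu : u₀ ∈ U) {n : E3} :
    Tendsto (fun p : ℝ × E3 => (p.1, chart Φ u₀ n p)) (𝓝 (t, 0)) (𝓝 (t, Φ t u₀)) := by
  have hch : ContinuousAt (chart Φ u₀ n) (t, 0) :=
    (contDiffAt_chart (by simpa using hS.contDiffAt ht hu)).continuousAt
  have := continuousAt_fst.prodMk hch
  rw [ContinuousAt, chart_zero] at this
  exact this

lemma contDiffAt_density (hS : IsSingularSurface T U Φ V₁ V₂) (ht : t ∈ Ioo 0 T) (hu : u₀ ∈ U)
    {n : E3} {g : ℝ × E3 → ℝ} (hg : ContDiffAt ℝ 1 g (t, Φ t u₀)) :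
    ContDiffAt ℝ 1 (density Φ u₀ n g) (t, 0) := by
  have hC := hS.contDiffAt ht hu
  have hch : ContDiffAt ℝ 2 (chart Φ u₀ n) (t, 0) := contDiffAt_chart (by simpa using hC)
  have h1 : ContDiffAt ℝ 1 (fun p : ℝ × E3 => (p.1, u₀ + proj p.2)) (t, 0) := by fun_prop
  have h2 : ContDiffAt ℝ 1 (fun p : ℝ × E3 => normalVec (Φ p.1) (u₀ + proj p.2)) (t, 0) :=
    ContDiffAt.comp (g := fun p : ℝ × P2 => normalVec (Φ p.1) p.2) (t, (0 : E3))
      (by simpa using contDiffAt_normalVec_uncurry hC) h1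
  have h3 : ContDiffAt ℝ 1 (fun p : ℝ × E3 => g (p.1, chart Φ u₀ n p)) (t, 0) :=
    ContDiffAt.comp (t, (0 : E3)) (by simpa [chart_zero] using hg)
      (contDiffAt_fst.prodMk (hch.of_le (by norm_num)))
  exact (h2.inner ℝ contDiffAt_const).mul h3

/-- The change of variables to the chart in the integral of a volume field over the part of the
material volume on one side. -/
lemma integral_materialPart (hS : IsSingularSurface T U Φ V₁ V₂)
    (hπ : IsChart T U Φ V₁ V₂ t u₀ π r) {V : ℝ → Set E3} {σ : ℝ}
    (hside : IsSide T U Φ V t u₀ r σ) {ψ : ℝ → E3 → ℝ} {g : ℝ × E3 → ℝ} {r' : ℝ} (hr' : r' ≤ r)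
    {δ ε s : ℝ} (hδ : δ < 1) (hε : 0 < ε) (hεr : 2 * ε < r) (hs : |s - t| < r')
    (hψ : ∀ q, ‖q‖ < r' → (s, chart Φ u₀ (unitNormal (Φ t) u₀) (s, q)) ∈ spaceTime T V →
      ψ s (chart Φ u₀ (unitNormal (Φ t) u₀) (s, q))
        = g (s, chart Φ u₀ (unitNormal (Φ t) u₀) (s, q)))
    (hcont : ∀ q, ‖q‖ < r' → ContinuousAt (density Φ u₀ (unitNormal (Φ t) u₀) g) (s, q))
    {c d : ℝ} (hb : ∀ q, ‖q‖ < r' → |density Φ u₀ (unitNormal (Φ t) u₀) g (s, q) - c| ≤ d)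
    (hA : χ s '' (χ t ⁻¹' pillbox Φ t u₀ δ ε) ∩ V s
      = (fun q => chart Φ u₀ (unitNormal (Φ t) u₀) (s, q)) '' materialPart Φ χ t u₀ σ r' δ ε s) :
    IntegrableOn (fun q => density Φ u₀ (unitNormal (Φ t) u₀) g (s, q))
      (materialPart Φ χ t u₀ σ r' δ ε s) ∧
    IntegrableOn (ψ s) (χ s '' (χ t ⁻¹' pillbox Φ t u₀ δ ε) ∩ V s) ∧
    ∫ x in χ s '' (χ t ⁻¹' pillbox Φ t u₀ δ ε) ∩ V s, ψ s x
      = ∫ q in materialPart Φ χ t u₀ σ r' δ ε s,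
        density Φ u₀ (unitNormal (Φ t) u₀) g (s, q) := by
  set n := unitNormal (Φ t) u₀
  set A := materialPart Φ χ t u₀ σ r' δ ε s with hAdef
  have hsr : |s - t| < r := hs.trans_le hr'
  have hop : IsOpen A := isOpen_materialPart hS hπ hδ hε hεr hr' hsr
  have hAr : ∀ q ∈ A, ‖q‖ < r' := fun q hq => hq.1
  have hfin : volume A < ⊤ :=
    (measure_mono fun q hq => mem_ball_zero_iff.2 (hAr q hq)).trans_lt
      (measure_ball_lt_top (x := (0 : E3)) (r := r'))
  have hd : IsPositiveDiffeo (fun q => chart Φ u₀ n (s, q)) r := hπ.isPositiveDiffeo hS hsr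
  have hderiv : ∀ q ∈ A, HasFDerivWithinAt (fun q => chart Φ u₀ n (s, q))
      (fderiv ℝ (fun q => chart Φ u₀ n (s, q)) q) A q := fun q hq =>
    ((hd.smooth q ((hAr q hq).trans_le hr')).differentiableAt
      (by norm_num)).hasFDerivAt.hasFDerivWithinAt
  have hinj : InjOn (fun q => chart Φ u₀ n (s, q)) A :=
    hd.injOn.mono fun q hq => mem_ball_zero_iff.2 ((hAr q hq).trans_le hr')
  have hcongr : EqOn (fun q => |(fderiv ℝ (fun q => chart Φ u₀ n (s, q)) q).det| •
      ψ s (chart Φ u₀ n (s, q))) (fun q => density Φ u₀ n g (s, q)) A := by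
    intro q hq
    have h1 := hAr q hq
    have h2 : (s, chart Φ u₀ n (s, q)) ∈ spaceTime T V :=
      ⟨hπ.mem_time s hsr, (hside.mem_iff s q hsr (h1.trans_le hr')).2 hq.2.1⟩
    simp only
    rw [hψ q h1 h2, det_chart (hπ.differentiableAt hS hsr (h1.trans_le hr')),
      abs_of_pos (hπ.det_pos s q hsr (h1.trans_le hr')), smul_eq_mul, density]
  have hint : IntegrableOn (fun q => density Φ u₀ n g (s, q)) A := by
    have : IsFiniteMeasure (volume.restrict A) := ⟨by simpa using hfin⟩
    refine Integrable.of_bound (C := |c| + d) ?_ ?_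
    · have hco : ContinuousOn (fun q => density Φ u₀ n g (s, q)) A := fun q hq =>
        (ContinuousAt.comp (g := density Φ u₀ n g) (f := fun q : E3 => (s, q))
        (hcont q (hAr q hq)) (by fun_prop)).continuousWithinAt
      exact hco.aestronglyMeasurable hop.measurableSet
    · refine (ae_restrict_iff' hop.measurableSet).2 (ae_of_all _ fun q hq => ?_)
      have h1 := hb q (hAr q hq)
      have h2 := abs_sub_abs_le_abs_sub (density Φ u₀ n g (s, q)) c
      rw [Real.norm_eq_abs]; linarith
  refine ⟨hint, ?_, ?_⟩
  · rw [hA, integrableOn_image_iff_integrableOn_abs_det_fderiv_smul volume hop.measurableSet hderiv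
      hinj]
    exact hint.congr_fun hcongr.symm hop.measurableSet
  · rw [hA, integral_image_eq_integral_abs_det_fderiv_smul volume hop.measurableSet hderiv hinj]
    exact setIntegral_congr_fun hop.measurableSet hcongr

/-- The elementary estimate of the volumes in `volume_term`: `m` bounds the displacement of the
faces, `κ` is the increase of the thickness and `d` the error of the latter. -/
lemma slab_volume_estimate {e h m κ d a : ℝ} (hm : 0 ≤ m) (hme : m ≤ e) (hmh : m ≤ h)
    (hκ : |κ| + d ≤ m) (hd : 0 ≤ d)
    (h1 : 4 * (e - m) ^ 2 * (h + κ - d) ≤ a) (h2 : a ≤ 4 * (e + m) ^ 2 * (h + κ + d)) :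
    |a - 4 * e ^ 2 * h - 4 * e ^ 2 * κ| ≤ 4 * e ^ 2 * d + 24 * (e * m * h) := by
  obtain ⟨k1, k2⟩ := abs_le.1 (show |κ| ≤ m - d by linarith)
  have he : 0 ≤ e := hm.trans hme
  have hh : 0 ≤ h := hm.trans hmh
  have hem : 0 ≤ e * m := mul_nonneg he hm
  have hmm : m * m ≤ e * m := mul_le_mul_of_nonneg_right hme hm
  rw [abs_le]
  constructor
  · have b1 : (2 * (e * m) - m * m) * (h + κ - d) ≤ (2 * (e * m)) * (2 * h) :=
      mul_le_mul (by nlinarith [mul_self_nonneg m]) (by linarith) (by linarith) (by linarith)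
    nlinarith
  · have b1 : (2 * (e * m) + m * m) * (h + κ + d) ≤ (3 * (e * m)) * (2 * h) :=
      mul_le_mul (by linarith) (by linarith) (by linarith) (by linarith)
    nlinarith

lemma slab_volume_diff {e h m : ℝ} (hm : 0 ≤ m) (hme : m ≤ e) (hhe : h ≤ e) :
    4 * (e + m) ^ 2 * (h + m) - 4 * (e - m) ^ 2 * (h - m) ≤ 32 * (e ^ 2 * m) := by
  have he : 0 ≤ e := hm.trans hme
  have h1 : m * m * m ≤ e * e * m := mul_le_mul_of_nonneg_right (mul_le_mul hme hme hm he) hm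
  have h2 : e * m * h ≤ e * m * e := mul_le_mul_of_nonneg_left hhe (mul_nonneg he hm)
  nlinarith

lemma volume_term_arith {x y c₀ c a e δ k K C₁ σ τ P : ℝ} (hδ : 0 ≤ δ) (he1 : e ≤ 1)
    (hK : 0 ≤ K) (hk : 0 ≤ k)
    (hmain : |x - y - c₀ * (a - 4 * e ^ 2 * (δ * e))| ≤ K * k * (4 * e ^ 2 * (δ * e)) + 2 * δ * P)
    (hA : |a - 4 * e ^ 2 * (δ * e) - 4 * e ^ 2 * (σ * (τ * c))|
      ≤ 4 * e ^ 2 * (δ * k) + 24 * (e * (C₁ * k) * (δ * e)))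
    (hP : P ≤ 32 * (e ^ 2 * (C₁ * k))) :
    |x - y - τ * (σ * (c₀ * c) * (4 * e ^ 2))|
      ≤ (4 * K + 64 * C₁ + |c₀| * (4 + 24 * C₁)) * δ * e ^ 2 * k := by
  have hsplit : x - y - τ * (σ * (c₀ * c) * (4 * e ^ 2))
      = (x - y - c₀ * (a - 4 * e ^ 2 * (δ * e)))
        + c₀ * (a - 4 * e ^ 2 * (δ * e) - 4 * e ^ 2 * (σ * (τ * c))) := by ring
  have b1 := mul_le_mul_of_nonneg_left hA (abs_nonneg c₀)
  have b2 := mul_le_mul_of_nonneg_left hP (by linarith : (0 : ℝ) ≤ 2 * δ)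
  have b3 : K * k * (4 * e ^ 2 * (δ * e)) ≤ K * k * (4 * e ^ 2 * δ) := by
    refine mul_le_mul_of_nonneg_left ?_ (by positivity)
    exact mul_le_mul_of_nonneg_left (mul_le_of_le_one_right hδ he1) (by positivity)
  rw [hsplit]
  refine (abs_add_le _ _).trans ?_
  rw [abs_mul]
  calc _ ≤ (K * k * (4 * e ^ 2 * δ) + 2 * δ * (32 * (e ^ 2 * (C₁ * k))))
        + |c₀| * (4 * e ^ 2 * (δ * k) + 24 * (e * (C₁ * k) * (δ * e))) := by linarith
    _ = _ := by ring

/-- The rate of change of the integral of `ψ` over the part of the material volume on one side of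
the surface. For a flat box the lateral faces and the rate of change of `ψ` do not matter; there
remains the transport of `ψ` through the top face relative to the moving surface. -/
theorem volume_term (hS : IsSingularSurface T U Φ V₁ V₂) (hχ : IsMotion T U Φ V₁ V₂ χ v)
    (ht : t ∈ Ioo 0 T) (hu : u₀ ∈ U) (hπ : IsChart T U Φ V₁ V₂ t u₀ π r)
    {V : ℝ → Set E3} (hV : ∀ s, V s ⊆ V₁ s ∪ V₂ s) {σ : ℝ} (hside : IsSide T U Φ V t u₀ r σ)
    {gv : ℝ × E3 → E3} (hgv : ContinuousAt gv (t, Φ t u₀))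
    (hv : ∀ᶠ p in 𝓝 (t, Φ t u₀), p ∈ spaceTime T V → v p.1 p.2 = gv p)
    {ψ : ℝ → E3 → ℝ} {g : ℝ × E3 → ℝ} (hg : ContDiffAt ℝ 1 g (t, Φ t u₀))
    (hψ : ∀ᶠ p in 𝓝 (t, Φ t u₀), p ∈ spaceTime T V → ψ p.1 p.2 = g p) :
    ∃ C, ∀ δ ∈ Ioo (0 : ℝ) 1, ∀ᶠ ε in 𝓝[>] (0 : ℝ), ∀ᶠ s in 𝓝 t,
      IntegrableOn (ψ s) (χ s '' (χ t ⁻¹' pillbox Φ t u₀ δ ε) ∩ V s) ∧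
      |(∫ x in χ s '' (χ t ⁻¹' pillbox Φ t u₀ δ ε) ∩ V s, ψ s x)
        - (∫ x in χ t '' (χ t ⁻¹' pillbox Φ t u₀ δ ε) ∩ V t, ψ t x)
        - (s - t) * (σ * (areaDensity (Φ t) u₀ * g (t, Φ t u₀)
          * (inner ℝ (unitNormal (Φ t) u₀) (gv (t, Φ t u₀)) - normalVelocity Φ t u₀))
          * (4 * ε ^ 2))| ≤ C * δ * ε ^ 2 * |s - t| := by
  have hN := hS.normalVec_ne_zero ht hu
  have hn1 : ‖unitNormal (Φ t) u₀‖ = 1 := norm_unitNormal hN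
  set n := unitNormal (Φ t) u₀ with hn
  set c := inner ℝ n (gv (t, Φ t u₀)) - normalVelocity Φ t u₀ with hc
  set c₀ := areaDensity (Φ t) u₀ * g (t, Φ t u₀) with hc₀
  obtain ⟨C, hC, ρ, hρ, hL⟩ := hχ.exists_lipschitz_chart hS ht hu hπ
  set C₁ := C + |c| + 1 with hC₁
  have hC₁0 : 0 < C₁ := by positivity
  have hk := contDiffAt_density hS ht hu (n := n) hg
  have hk0 : density Φ u₀ n g (t, 0) = c₀ := density_center hN
  obtain ⟨K, N, hN', hK⟩ := hk.exists_lipschitzOnWith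
  refine ⟨4 * K + 64 * C₁ + |c₀| * (4 + 24 * C₁), fun δ hδ => ?_⟩
  have e1 : ∀ᶠ p in 𝓝 (t, (0 : E3)), |density Φ u₀ n g p - c₀| ≤ δ := by
    have := hk.continuousAt.eventually (Metric.closedBall_mem_nhds _ hδ.1)
    rw [hk0] at this
    simpa [Real.dist_eq] using this
  have e2 : ∀ᶠ p in 𝓝 (t, (0 : E3)), ContinuousAt (density Φ u₀ n g) p :=
    (hk.eventually (by simp)).mono fun p hp => hp.continuousAt
  have e3 := (tendsto_chartGraph hS ht hu (n := n)).eventually hψ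
  obtain ⟨r₁, hr₁, hb⟩ := Metric.eventually_nhds_iff_ball.1 ((e1.and e2).and (e3.and hN'))
  set r' := min r₁ r with hr'def
  have hr'0 : 0 < r' := lt_min hr₁ hπ.pos
  have hr' : r' ≤ r := min_le_right _ _
  have key : ∀ s q, |s - t| < r' → ‖q‖ < r' → _ := fun s q h1 h2 =>
    hb (s, q) (abs_lt_and_norm_lt_of_ball.2 ⟨h1.trans_le (min_le_left _ _),
      h2.trans_le (min_le_left _ _)⟩)
  have htt : |t - t| < r' := by simpa using hr'0
  filter_upwards [materialPart_sandwich hS hχ ht hπ hn1 hV hside hgv hv hC hρ hL hδ hc hC₁ hr'0 hr',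
    Ioo_mem_nhdsGT (show 0 < min (r' / 4) 1 by positivity)] with ε hsand hε
  obtain ⟨hε0, hε1⟩ := hε
  obtain ⟨hδ0, hδ1⟩ := hδ
  have hε2 : ε < 1 := hε1.trans_le (min_le_right _ _)
  have hεr : 2 * ε < r := by
    have := hε1.trans_le (min_le_left _ _)
    linarith
  have hh0 : 0 < δ * ε := mul_pos hδ0 hε0
  have hhε : δ * ε < ε := by nlinarith
  have hsmall : ∀ᶠ s in 𝓝 t, |s - t| < min r' (δ * ε / C₁) := by
    have : 0 < min r' (δ * ε / C₁) := lt_min hr'0 (by positivity)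
    filter_upwards [Metric.ball_mem_nhds t this] with s hs
    simpa [Real.dist_eq] using hs
  have hcv : ∀ s, |s - t| < r' → χ s '' (χ t ⁻¹' pillbox Φ t u₀ δ ε) ∩ V s
      = (fun q => chart Φ u₀ n (s, q)) '' materialPart Φ χ t u₀ σ r' δ ε s → _ := fun s hs hA =>
    integral_materialPart hS hπ hside hr' hδ1 hε0 hεr hs
      (fun q hq hm => (key s q hs hq).2.1 hm) (fun q hq => (key s q hs hq).1.2)
      (fun q hq => (key s q hs hq).1.1) hA
  obtain ⟨hAt, hBsub, hsubB⟩ := hsand.self_of_nhds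
  simp only [sub_self, abs_zero, mul_zero, zero_mul, add_zero, sub_zero] at hBsub hsubB
  have hB : materialPart Φ χ t u₀ σ r' δ ε t = slab σ ε 0 (δ * ε) := hsubB.antisymm hBsub
  obtain ⟨iB, -, eB⟩ := hcv t htt hAt
  filter_upwards [hsand, hsmall] with s hs hsk
  obtain ⟨hAs, hIA, hAO⟩ := hs
  have hsr' : |s - t| < r' := hsk.trans_le (min_le_left _ _)
  obtain ⟨iA, iA', eA⟩ := hcv s hsr' hAs
  refine ⟨iA', ?_⟩
  rw [eA, eB]
  set k := |s - t| with hkdef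
  have hk0' : 0 ≤ k := abs_nonneg _
  set m := C₁ * k with hm
  have hm0 : 0 ≤ m := by positivity
  have hmh : m ≤ δ * ε := by
    have := hsk.trans_le (min_le_right _ _)
    rw [lt_div_iff₀ hC₁0] at this
    linarith
  have hmε : m ≤ ε := hmh.trans hhε.le
  set κ := σ * ((s - t) * c) with hκdef
  have hσ1 : |σ| = 1 := by rcases hside.sign with h | h <;> simp [h]
  have hκ : |κ| = |c| * k := by rw [hκdef, abs_mul, hσ1, one_mul, abs_mul, mul_comm]
  have hκd : |κ| + δ * k ≤ m := by
    rw [hκ, hm, hC₁]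
    nlinarith [mul_nonneg hC.le hk0']
  obtain ⟨κ1, κ2⟩ := abs_le.1 (le_refl |κ|)
  have hδk : 0 ≤ δ * k := by positivity
  have hσ := hside.sign
  -- both domains lie between the slabs in which every face is moved by `m` inwards and outwards
  have hmain := abs_setIntegral_sub_le (A := materialPart Φ χ t u₀ σ r' δ ε s)
    (B := materialPart Φ χ t u₀ σ r' δ ε t) (I := slab σ (ε - m) 0 (δ * ε - m))
    (O := slab σ (ε + m) 0 (δ * ε + m)) (f := fun q => density Φ u₀ n g (s, q))
    (g := fun q => density Φ u₀ n g (t, q)) (c := c₀) (δ := δ) (L := K * k)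
    (isOpen_materialPart hS hπ hδ1 hε0 hεr hr' (hsr'.trans_le hr')).measurableSet
    (isOpen_materialPart hS hπ hδ1 hε0 hεr hr' (htt.trans_le hr')).measurableSet
    (measurableSet_slab hσ _ _ _)
    ((slab_subset le_rfl (by linarith)).trans hIA)
    (hAO.trans (slab_subset le_rfl (by linarith)))
    (by rw [hB]; exact slab_subset (by linarith) (by linarith))
    (by rw [hB]; exact slab_subset (by linarith) (by linarith))
    (volume_slab_lt_top hσ _ _ _) (by positivity) hδ0.le iA iB
    (fun q hq => (key s q hsr' hq.1).1.1) (fun q hq => (key t q htt hq.1).1.1)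
    (fun q hq _ => by
      have h1 := hK.dist_le_mul _ (key s q hsr' hq.1).2.2 _ (key t q htt hq.1).2.2
      simpa [Real.dist_eq, Prod.dist_eq] using h1)
  have volB : volume.real (materialPart Φ χ t u₀ σ r' δ ε t) = 4 * ε ^ 2 * (δ * ε) := by
    rw [hB, volume_real_slab hσ hε0.le hh0.le, sub_zero]
  have fO := volume_slab_lt_top hσ (ε + m) 0 (δ * ε + κ + δ * k)
  have volA := slab_volume_estimate hm0 hmε hmh hκd hδk
    (a := volume.real (materialPart Φ χ t u₀ σ r' δ ε s))
    (by
      have := measureReal_mono hIA ((measure_mono hAO).trans_lt fO).ne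
      rwa [volume_real_slab hσ (by linarith) (by linarith), sub_zero] at this)
    (by
      have := measureReal_mono hAO fO.ne
      rwa [volume_real_slab hσ (by linarith) (by linarith), sub_zero] at this)
  have volOI := slab_volume_diff hm0 hmε hhε.le
  rw [volume_real_slab hσ (by linarith) (by linarith), volume_real_slab hσ (by linarith)
    (by linarith), sub_zero, sub_zero, volB] at hmain
  exact volume_term_arith hδ0.le hε2.le K.coe_nonneg hk0' hmain volA volOI

end VolumeTerm

/-! ### Asymptotics for small flat boxes -/

/-- The quantity `f δ ε` belonging to a flat box of half side lengths `ε, ε, δ ε` is `c` times the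
area `4 ε²` of the parameter square, up to an error of relative size `O(δ)` for small `ε`. -/
def IsApprox (f : ℝ → ℝ → ℝ) (c : ℝ) : Prop :=
  ∃ C, ∀ δ ∈ Ioo (0 : ℝ) 1, ∀ᶠ ε in 𝓝[>] (0 : ℝ), |f δ ε - c * (4 * ε ^ 2)| ≤ C * δ * ε ^ 2

lemma IsApprox.add {f g : ℝ → ℝ → ℝ} {a b : ℝ} (hf : IsApprox f a) (hg : IsApprox g b) :
    IsApprox (fun δ ε => f δ ε + g δ ε) (a + b) := by
  obtain ⟨C, hC⟩ := hf
  obtain ⟨D, hD⟩ := hg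
  refine ⟨C + D, fun δ hδ => ?_⟩
  filter_upwards [hC δ hδ, hD δ hδ] with ε h1 h2
  have h3 : f δ ε + g δ ε - (a + b) * (4 * ε ^ 2)
      = (f δ ε - a * (4 * ε ^ 2)) + (g δ ε - b * (4 * ε ^ 2)) := by ring
  rw [h3]
  exact (abs_add_le _ _).trans ((add_le_add h1 h2).trans (le_of_eq (by ring)))

lemma IsApprox.neg {f : ℝ → ℝ → ℝ} {a : ℝ} (hf : IsApprox f a) :
    IsApprox (fun δ ε => -f δ ε) (-a) := by
  obtain ⟨C, hC⟩ := hf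
  refine ⟨C, fun δ hδ => ?_⟩
  filter_upwards [hC δ hδ] with ε h1
  rw [← abs_neg]
  convert h1 using 2
  ring

lemma IsApprox.unique {f : ℝ → ℝ → ℝ} {a b : ℝ} (hf : IsApprox f a) (hg : IsApprox f b) :
    a = b := by
  obtain ⟨C, hC⟩ := hf
  obtain ⟨D, hD⟩ := hg
  have key : ∀ δ ∈ Ioo (0 : ℝ) 1, |a - b| * 4 ≤ (C + D) * δ := by
    intro δ hδ
    obtain ⟨ε, ⟨h1, h2⟩, h3⟩ := (((hC δ hδ).and (hD δ hδ)).and self_mem_nhdsWithin).exists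
    have hε : 0 < ε := h3
    have h4 : |(a - b) * (4 * ε ^ 2)| ≤ (C + D) * δ * ε ^ 2 := by
      have h5 : (a - b) * (4 * ε ^ 2)
          = (f δ ε - b * (4 * ε ^ 2)) - (f δ ε - a * (4 * ε ^ 2)) := by ring
      rw [h5]
      exact (abs_sub _ _).trans ((add_le_add h2 h1).trans (le_of_eq (by ring)))
    rw [abs_mul, abs_of_pos (show 0 < 4 * ε ^ 2 by positivity)] at h4
    have hε2 : 0 < ε ^ 2 := by positivity
    refine le_of_mul_le_mul_right ?_ hε2
    linarith
  have hlim : Tendsto (fun δ : ℝ => (C + D) * δ) (𝓝[>] 0) (𝓝 0) := by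
    refine Tendsto.mono_left ?_ nhdsWithin_le_nhds
    exact Continuous.tendsto' (by fun_prop) _ _ (by simp)
  have h0 : |a - b| * 4 ≤ 0 := ge_of_tendsto hlim (by
    filter_upwards [Ioo_mem_nhdsGT (show (0 : ℝ) < 1 by norm_num)] with δ hδ using key δ hδ)
  have := abs_nonneg (a - b)
  exact sub_eq_zero.1 (abs_eq_zero.1 (by linarith))

lemma isApprox_of_eventually_le {f : ℝ → ℝ → ℝ} {c : ℝ} (C : ℝ)
    (h : ∀ δ ∈ Ioo (0 : ℝ) 1, ∀ᶠ ε in 𝓝[>] (0 : ℝ), |f δ ε - c * (4 * ε ^ 2)| ≤ δ * (C * ε ^ 2)) :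
    IsApprox f c :=
  ⟨C, fun δ hδ => (h δ hδ).mono fun ε hε => hε.trans (le_of_eq (by ring))⟩

lemma IsApprox.sum {ι : Type*} (s : Finset ι) {f : ι → ℝ → ℝ → ℝ} {a : ι → ℝ}
    (h : ∀ i ∈ s, IsApprox (f i) (a i)) :
    IsApprox (fun δ ε => ∑ i ∈ s, f i δ ε) (∑ i ∈ s, a i) := by
  classical
  induction s using Finset.induction_on with
  | empty => exact ⟨0, fun δ _ => Eventually.of_forall fun ε => by simp⟩
  | insert i s hi ih =>
    simp only [Finset.sum_insert hi]
    exact (h i (Finset.mem_insert_self i s)).add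
      (ih fun k hk => h k (Finset.mem_insert_of_mem hk))

lemma abs_sub_le_of_hasDerivAt {F : ℝ → ℝ} {t D A B : ℝ} (h : HasDerivAt F D t)
    (hF : ∀ᶠ s in 𝓝 t, |F s - F t - (s - t) * A| ≤ B * |s - t|) : |D - A| ≤ B := by
  have h1 := (hasDerivAt_iff_tendsto_slope.1 h).sub_const A
  refine le_of_tendsto h1.abs ?_
  filter_upwards [nhdsWithin_le_nhds hF, self_mem_nhdsWithin] with s hs hne
  have hst : s - t ≠ 0 := sub_ne_zero.2 hne
  rw [slope_def_field]
  have e : (F s - F t) / (s - t) - A = (F s - F t - (s - t) * A) / (s - t) := by field_simp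
  rw [e, abs_div]
  exact (div_le_iff₀ (abs_pos.2 hst)).2 hs

lemma abs_setIntegral_sub_const_le {α : Type*} [MeasurableSpace α] {μ : Measure α} {S : Set α}
    {f : α → ℝ} {c η : ℝ} (hfin : μ S < ⊤) (hf : IntegrableOn f S μ)
    (h : ∀ x ∈ S, |f x - c| ≤ η) :
    |(∫ x in S, f x ∂μ) - c * μ.real S| ≤ η * μ.real S := by
  have hc : IntegrableOn (fun _ => c) S μ := integrableOn_const hfin.ne
  have e : (∫ x in S, (f x - c) ∂μ) = (∫ x in S, f x ∂μ) - c * μ.real S := by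
    rw [integral_sub hf hc, setIntegral_const, smul_eq_mul, mul_comm]
  rw [← e, ← Real.norm_eq_abs]
  exact norm_setIntegral_le_of_norm_le_const hfin h

lemma closure_square_subset_ball {u₀ : P2} {ε ρ : ℝ} (hε : 0 < ε) (h : 2 * ε < ρ) :
    closure (square u₀ ε) ⊆ Metric.ball u₀ ρ := by
  intro u hu
  rw [closure_square u₀ hε] at hu
  rw [Metric.mem_ball, dist_eq_norm]
  refine lt_of_le_of_lt ?_ h
  rw [EuclideanSpace.norm_eq, Real.sqrt_le_left (by positivity), Fin.sum_univ_two]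
  have h' : ∀ i, ‖(u - u₀) i‖ ^ 2 ≤ ε ^ 2 := fun i =>
    pow_le_pow_left₀ (norm_nonneg _) (hu i) 2
  nlinarith [h' 0, h' 1]

lemma integrableOn_square {u₀ : P2} {ε ρ : ℝ} (hε : 0 < ε) (h : 2 * ε < ρ) {f : P2 → ℝ}
    (hf : ∀ u ∈ Metric.ball u₀ ρ, ContinuousAt f u) : IntegrableOn f (square u₀ ε) :=
  (ContinuousOn.integrableOn_compact (isCompact_closure_square u₀ hε) fun u hu =>
    (hf u (closure_square_subset_ball hε h hu)).continuousWithinAt).mono_set subset_closure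

lemma eventually_small {ρ : ℝ} (hρ : 0 < ρ) : ∀ᶠ ε in 𝓝[>] (0 : ℝ), 0 < ε ∧ 2 * ε < ρ := by
  filter_upwards [Ioo_mem_nhdsGT (show 0 < ρ / 2 by positivity)] with ε hε
  exact ⟨hε.1, by linarith [hε.2]⟩

lemma isApprox_integral_square {u₀ : P2} {f : P2 → ℝ} (hf : ∀ᶠ u in 𝓝 u₀, ContinuousAt f u) :
    IsApprox (fun _ ε => ∫ u in square u₀ ε, f u) (f u₀) := by
  refine isApprox_of_eventually_le 4 fun δ hδ => ?_
  have h0 : ContinuousAt f u₀ := hf.self_of_nhds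
  have h1 : ∀ᶠ u in 𝓝 u₀, |f u - f u₀| ≤ δ := by
    simpa [Real.dist_eq] using h0.eventually (Metric.closedBall_mem_nhds _ hδ.1)
  obtain ⟨ρ, hρ, hb⟩ := Metric.eventually_nhds_iff_ball.1 (hf.and h1)
  filter_upwards [eventually_small hρ] with ε hε
  have h2 := abs_setIntegral_sub_const_le
    (volume_square_lt_top u₀ ε) (integrableOn_square hε.1 hε.2 fun u hu => (hb u hu).1)
    (fun u hu => (hb u (closure_square_subset_ball hε.1 hε.2 (subset_closure hu))).2)
  rwa [volume_real_square u₀ hε.1.le] at h2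

/-- The rate of change of an integral over a small parameter square. -/
lemma square_integral_rate {t : ℝ} {u₀ : P2} {f : ℝ × P2 → ℝ} (hf : ContDiffAt ℝ 1 f (t, u₀))
    {c : ℝ} (hc : HasDerivAt (fun s => f (s, u₀)) c t) :
    ∀ δ ∈ Ioo (0 : ℝ) 1, ∀ᶠ ε in 𝓝[>] (0 : ℝ), ∀ᶠ s in 𝓝 t,
      |(∫ u in square u₀ ε, f (s, u)) - (∫ u in square u₀ ε, f (t, u)) - (s - t) * (c * (4 * ε ^ 2))|
        ≤ 4 * δ * ε ^ 2 * |s - t| := by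
  intro δ hδ
  have hs := hf.hasStrictFDerivAt (by norm_num)
  have hcf : fderiv ℝ f (t, u₀) (1, 0) = c := (hasDerivAt_slice hs.hasFDerivAt).unique hc
  have e1 := hs.isLittleO.def hδ.1
  rw [nhds_prod_eq] at e1
  have e2 : ∀ᶠ p in 𝓝 (t, u₀), ContinuousAt f p :=
    (hf.eventually (by simp)).mono fun p hp => hp.continuousAt
  obtain ⟨N, hN, hN'⟩ := eventually_prod_self_iff'.1 e1
  obtain ⟨ρ, hρ, hb⟩ := Metric.eventually_nhds_iff_ball.1 (e2.and (mem_nhds_iff.2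
    (mem_nhds_iff.1 hN) : ∀ᶠ p in 𝓝 (t, u₀), p ∈ N))
  filter_upwards [eventually_small hρ] with ε hε
  filter_upwards [Metric.ball_mem_nhds t hρ] with s hsρ
  have hmem : ∀ z u, z ∈ Metric.ball t ρ → u ∈ Metric.ball u₀ ρ →
      (z, u) ∈ Metric.ball (t, u₀) ρ := fun z u h1 h2 => by
    rw [Metric.mem_ball, Prod.dist_eq]; exact max_lt h1 h2
  have hint : ∀ z ∈ Metric.ball t ρ, IntegrableOn (fun u => f (z, u)) (square u₀ ε) := fun z hz =>
    integrableOn_square hε.1 hε.2 fun u hu =>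
      ContinuousAt.comp (f := fun u : P2 => (z, u)) (hb _ (hmem z u hz hu)).1 (by fun_prop)
  have ht := Metric.mem_ball_self (x := t) hρ
  have h2 := abs_setIntegral_sub_const_le (c := (s - t) * c) (η := δ * |s - t|)
    (volume_square_lt_top u₀ ε) ((hint s hsρ).sub (hint t ht)) (fun u hu => by
      have hu' := closure_square_subset_ball hε.1 hε.2 (subset_closure hu)
      have h3 := hN' (s, u) (hb _ (hmem s u hsρ hu')).2 (t, u) (hb _ (hmem t u ht hu')).2
      have h4 : ((s, u) : ℝ × P2) - (t, u) = (s - t) • ((1, 0) : ℝ × P2) := by simp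
      rw [h4, map_smul, hcf, norm_smul] at h3
      simpa [Prod.norm_def] using h3)
  simp only [Pi.sub_apply] at h2
  rw [volume_real_square u₀ hε.1.le, integral_sub (hint s hsρ) (hint t ht)] at h2
  refine le_trans (le_of_eq ?_) (h2.trans (le_of_eq ?_))
  · congr 1; ring
  · ring

/-! ### The flux through the boundary curve of the surface piece -/

lemma apply_rotate (L : P2 →L[ℝ] E3) (p : P2) :
    L p = p 0 • L (EuclideanSpace.single 0 1) + p 1 • L (EuclideanSpace.single 1 1) := by
  conv_lhs => rw [show p = p 0 • EuclideanSpace.single 0 1 + p 1 • EuclideanSpace.single 1 1 from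
    ext_two (by simp) (by simp)]
  rw [map_add, map_smul, map_smul]

/-- The flux of the field `a` along the surface `X` through the four sides of the image of a
square. -/
def squareFlux (X a : P2 → E3) (u₀ : P2) (ε : ℝ) : ℝ :=
  ∑ k, ∫ s in (0 : ℝ)..1, inner ℝ (a (side u₀ ε k s))
    (cross (deriv (fun r => X (side u₀ ε k r)) s) (unitNormal X (side u₀ ε k s)))

lemma flux_integrand_side {X : P2 → E3} {a : P2 → E3} {u₀ : P2} {ε : ℝ} {k : Fin 4} {s : ℝ}
    (hX : DifferentiableAt ℝ X (side u₀ ε k s)) :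
    inner ℝ (a (side u₀ ε k s)) (cross (deriv (fun r => X (side u₀ ε k r)) s)
      (unitNormal X (side u₀ ε k s)))
      = 2 * ε * (rotate (sideNormal k) 0 * fluxForm X a 0 (side u₀ ε k s)
        + rotate (sideNormal k) 1 * fluxForm X a 1 (side u₀ ε k s)) := by
  have h1 := (hX.hasFDerivAt.comp_hasDerivAt s (hasDerivAt_side u₀ ε k s)).deriv
  rw [show deriv (fun r => X (side u₀ ε k r)) s = _ from h1, map_smul, apply_rotate,
    cross_smul_left, cross_add_left, cross_smul_left, cross_smul_left, inner_smul_right,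
    inner_add_right, inner_smul_right, inner_smul_right]
  rfl

/-- The flux of a tangential field out of a small square of the surface, in the limit, is its
surface divergence. -/
theorem isApprox_squareFlux {X : P2 → E3} {a : P2 → E3} {u₀ : P2}
    (hX : ∀ᶠ u in 𝓝 u₀, ContDiffAt ℝ 2 X u) (hN : normalVec X u₀ ≠ 0) (ha : ContDiffAt ℝ 1 a u₀) :
    IsApprox (fun _ ε => squareFlux X a u₀ ε)
      (areaDensity X u₀ * surfDiv X (tangentialPart X a) u₀) := by
  have hA : ∀ β, ContDiffAt ℝ 1 (fluxForm X a β) u₀ := fun β =>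
    contDiffAt_fluxForm hX.self_of_nhds hN ha β
  rw [← pd_fluxForm_sub hX.self_of_nhds hN ha]
  -- `16 ε²` arises from two pairs of opposite sides of length `2 ε` and of distance at most `4 ε`
  refine isApprox_of_eventually_le 16 fun δ hδ => ?_
  have hs : ∀ β, ∀ᶠ p in 𝓝 u₀ ×ˢ 𝓝 u₀, |fluxForm X a β p.1 - fluxForm X a β p.2
      - fderiv ℝ (fluxForm X a β) u₀ (p.1 - p.2)| ≤ δ * ‖p.1 - p.2‖ := fun β => by
    rw [← nhds_prod_eq]
    simpa using ((hA β).hasStrictFDerivAt (by norm_num)).isLittleO.def hδ.1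
  have hcont : ∀ β, ∀ᶠ u in 𝓝 u₀, ContinuousAt (fluxForm X a β) u := fun β =>
    ((hA β).eventually (by simp)).mono fun p hp => hp.continuousAt
  obtain ⟨N₀, hN₀, hN₀'⟩ := eventually_prod_self_iff'.1 (hs 0)
  obtain ⟨N₁, hN₁, hN₁'⟩ := eventually_prod_self_iff'.1 (hs 1)
  have hN₀e : ∀ᶠ u in 𝓝 u₀, u ∈ N₀ := hN₀
  have hN₁e : ∀ᶠ u in 𝓝 u₀, u ∈ N₁ := hN₁
  obtain ⟨ρ, hρ, hb⟩ := Metric.eventually_nhds_iff_ball.1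
    ((hX.and ((hcont 0).and (hcont 1))).and (hN₀e.and hN₁e))
  filter_upwards [eventually_small hρ] with ε hε
  obtain ⟨hε0, hερ⟩ := hε
  have hin : ∀ k, ∀ s ∈ Icc (0 : ℝ) 1, side u₀ ε k s ∈ Metric.ball u₀ ρ := fun k s hs =>
    closure_square_subset_ball hε0 hερ (side_mem_closure_square u₀ hε0 k hs)
  set I : Fin 4 → ℝ → ℝ := fun k s => 2 * ε * (rotate (sideNormal k) 0 *
    fluxForm X a 0 (side u₀ ε k s) + rotate (sideNormal k) 1 * fluxForm X a 1 (side u₀ ε k s))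
    with hI
  have hIc : ∀ k, ContinuousOn (I k) (Icc 0 1) := by
    intro k s hs
    have hc : ContinuousAt (side u₀ ε k) s := (contDiff_side u₀ ε k).continuous.continuousAt
    have h0 : ContinuousAt (fun s => fluxForm X a 0 (side u₀ ε k s)) s :=
      ContinuousAt.comp (f := side u₀ ε k) (hb _ (hin k s hs)).1.2.1 hc
    have h1 : ContinuousAt (fun s => fluxForm X a 1 (side u₀ ε k s)) s :=
      ContinuousAt.comp (f := side u₀ ε k) (hb _ (hin k s hs)).1.2.2 hc
    exact (continuousAt_const.mul ((continuousAt_const.mul h0).add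
      (continuousAt_const.mul h1))).continuousWithinAt
  have hIi : ∀ k, IntervalIntegrable (I k) volume 0 1 := fun k =>
    ContinuousOn.intervalIntegrable (by rw [uIcc_of_le zero_le_one]; exact hIc k)
  have e1 : squareFlux X a u₀ ε = ∫ s in (0 : ℝ)..1, ∑ k, I k s := by
    rw [squareFlux, intervalIntegral.integral_finsetSum fun k _ => hIi k]
    refine Finset.sum_congr rfl fun k _ => intervalIntegral.integral_congr fun s hs => ?_
    rw [uIcc_of_le zero_le_one] at hs
    exact flux_integrand_side ((hb _ (hin k s hs)).1.1.differentiableAt (by norm_num))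
  rw [e1]
  set c := pd 0 (fluxForm X a 1) u₀ - pd 1 (fluxForm X a 0) u₀ with hc
  set c' := pd 1 (fluxForm X a 1) u₀ + pd 0 (fluxForm X a 0) u₀ with hc'
  -- the part which is odd in the position along the side cancels in the integral
  have hodd : (∫ s in (0 : ℝ)..1, (c + (2 * s - 1) * c') * (4 * ε ^ 2)) = c * (4 * ε ^ 2) := by
    have hd : ∀ s ∈ uIcc (0 : ℝ) 1, HasDerivAt (fun s : ℝ => (c * s + (s ^ 2 - s) * c') * (4 * ε ^ 2))
        ((c + (2 * s - 1) * c') * (4 * ε ^ 2)) s := fun s _ => by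
      have h1 := (((hasDerivAt_id s).const_mul c).add
        ((((hasDerivAt_id s).pow 2).sub (hasDerivAt_id s)).mul_const c')).mul_const (4 * ε ^ 2)
      refine h1.congr_deriv ?_
      simp
    rw [intervalIntegral.integral_eq_sub_of_hasDerivAt hd
      (Continuous.intervalIntegrable (by fun_prop) _ _)]
    ring
  have hsumi : IntervalIntegrable (fun s => ∑ k, I k s) volume 0 1 := by
    refine ContinuousOn.intervalIntegrable ?_
    rw [uIcc_of_le zero_le_one]
    exact continuousOn_finsetSum _ fun k _ => hIc k
  rw [← hodd, ← intervalIntegral.integral_sub hsumi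
    (Continuous.intervalIntegrable (by fun_prop) _ _), ← Real.norm_eq_abs]
  refine (intervalIntegral.norm_integral_le_of_norm_le_const (C := δ * (16 * ε ^ 2))
    fun s hs => ?_).trans (le_of_eq (by simp))
  rw [uIoc_of_le zero_le_one] at hs
  have hs' : s ∈ Icc (0 : ℝ) 1 := ⟨hs.1.le, hs.2⟩
  set y := 2 * s - 1 with hy
  have hy1 : |y| ≤ 1 := abs_le.2 ⟨by linarith [hs'.1], by linarith [hs'.2]⟩
  have fb : ∀ β (p : P2), fderiv ℝ (fluxForm X a β) u₀ p
      = p 0 * pd 0 (fluxForm X a β) u₀ + p 1 * pd 1 (fluxForm X a β) u₀ := fun β p => by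
    conv_lhs => rw [show p = p 0 • EuclideanSpace.single 0 1 + p 1 • EuclideanSpace.single 1 1 from
      ext_two (by simp) (by simp)]
    rw [map_add, map_smul, map_smul]; rfl
  have nb : ∀ p : P2, |p 0| ≤ 2 * ε → |p 1| ≤ 2 * ε → ‖p‖ ≤ 4 * ε := fun p h0 h1 => by
    rw [EuclideanSpace.norm_eq, Real.sqrt_le_left (by positivity), Fin.sum_univ_two]
    have h' : ∀ x : ℝ, |x| ≤ 2 * ε → ‖x‖ ^ 2 ≤ (2 * ε) ^ 2 := fun x hx =>
      pow_le_pow_left₀ (norm_nonneg _) hx 2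
    nlinarith [h' _ h0, h' _ h1]
  have habs : ∀ z : ℝ, |z| ≤ 1 → |2 * ε * z| ≤ 2 * ε := fun z hz => by
    rw [abs_mul, abs_of_pos (by positivity)]
    nlinarith
  have d02 : ∀ i, (side u₀ ε 0 s - side u₀ ε 2 s) i = ![2 * ε * 1, 2 * ε * y] i := by
    intro i
    fin_cases i <;> simp [side, sideNormal, rotate, hy] <;> ring
  have d13 : ∀ i, (side u₀ ε 1 s - side u₀ ε 3 s) i = ![2 * ε * (-y), 2 * ε * 1] i := by
    intro i
    fin_cases i <;> simp [side, sideNormal, rotate, hy] <;> ring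
  have m := fun k => hb _ (hin k s hs')
  have t1 := hN₁' _ (m 0).2.2 _ (m 2).2.2
  have t0 := hN₀' _ (m 1).2.1 _ (m 3).2.1
  have n1 : ‖side u₀ ε 0 s - side u₀ ε 2 s‖ ≤ 4 * ε :=
    nb _ (by rw [d02]; exact habs _ (by simp)) (by rw [d02]; exact habs _ hy1)
  have n0 : ‖side u₀ ε 1 s - side u₀ ε 3 s‖ ≤ 4 * ε :=
    nb _ (by rw [d13]; exact habs _ (by simpa using hy1)) (by rw [d13]; exact habs _ (by simp))
  simp only at t0 t1
  rw [fb, d02, d02] at t1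
  rw [fb, d13, d13] at t0
  have t1' := t1.trans (mul_le_mul_of_nonneg_left n1 hδ.1.le)
  have t0' := t0.trans (mul_le_mul_of_nonneg_left n0 hδ.1.le)
  have esum : (∑ k, I k s) = 2 * ε * ((fluxForm X a 1 (side u₀ ε 0 s)
      - fluxForm X a 1 (side u₀ ε 2 s)) - (fluxForm X a 0 (side u₀ ε 1 s)
      - fluxForm X a 0 (side u₀ ε 3 s))) := by
    simp [hI, Fin.sum_univ_four, sideNormal, rotate]
    ring
  rw [esum, Real.norm_eq_abs]
  set A := fluxForm X a 1 (side u₀ ε 0 s) - fluxForm X a 1 (side u₀ ε 2 s)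
  set B := fluxForm X a 0 (side u₀ ε 1 s) - fluxForm X a 0 (side u₀ ε 3 s)
  simp only [Matrix.cons_val_zero, Matrix.cons_val_one] at t0' t1'
  set a10 := pd 0 (fluxForm X a 1) u₀
  set a11 := pd 1 (fluxForm X a 1) u₀
  set a00 := pd 0 (fluxForm X a 0) u₀
  set a01 := pd 1 (fluxForm X a 0) u₀
  have efin : 2 * ε * (A - B) - (c + y * c') * (4 * ε ^ 2)
      = 2 * ε * ((A - (2 * ε * 1 * a10 + 2 * ε * y * a11))
        - (B - (2 * ε * (-y) * a00 + 2 * ε * 1 * a01))) := by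
    rw [hc, hc']; ring
  rw [efin, abs_mul, abs_of_pos (show 0 < 2 * ε by positivity)]
  have h3 := (abs_sub (A - (2 * ε * 1 * a10 + 2 * ε * y * a11))
    (B - (2 * ε * (-y) * a00 + 2 * ε * 1 * a01))).trans (add_le_add t1' t0')
  refine (mul_le_mul_of_nonneg_left h3 (by positivity)).trans (le_of_eq (by ring))

/-! ### Source and flux terms of a flat box -/

lemma IsApprox.congr {f g : ℝ → ℝ → ℝ} {c : ℝ} (hf : IsApprox f c)
    (h : ∀ δ ∈ Ioo (0 : ℝ) 1, ∀ᶠ ε in 𝓝[>] (0 : ℝ), g δ ε = f δ ε) : IsApprox g c := by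
  obtain ⟨C, hC⟩ := hf
  refine ⟨C, fun δ hδ => ?_⟩
  filter_upwards [hC δ hδ, h δ hδ] with ε h1 h2
  rwa [h2]

lemma eventually_flatBox {P : E3 → Prop} (hP : ∀ᶠ q in 𝓝 (0 : E3), P q) {δ : ℝ}
    (hδ : δ ∈ Ioo (0 : ℝ) 1) :
    ∀ᶠ ε in 𝓝[>] (0 : ℝ), 0 < ε ∧ ε < 1 ∧ ∀ q ∈ cbox (flatSides δ ε), P q := by
  obtain ⟨ρ, hρ, hb⟩ := Metric.eventually_nhds_iff_ball.1 hP
  filter_upwards [eventually_small hρ, Ioo_mem_nhdsGT (show (0 : ℝ) < 1 by norm_num)] with ε hε hε1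
  exact ⟨hε.1, hε1.2, fun q hq => hb q (cbox_subset_ball (fun i => by
    linarith [hε.2, flatSides_le hδ.2 hε.1 i]) hq)⟩

lemma volume_real_flatBox {δ ε : ℝ} (hδ : 0 < δ) (hε : 0 < ε) :
    volume.real (box (flatSides δ ε)) = 8 * ε ^ 3 * δ := by
  rw [volume_real_box fun i => (flatSides_pos hδ hε i).le]
  simp [Fin.prod_univ_succ, flatSides]
  ring

/-- The integral of a bounded field over a flat box is negligible, the volume being `O(δ ε³)`. -/
lemma isApprox_source {H : E3 → E3} {r : ℝ} (hH : IsPositiveDiffeo H r) (hr : 0 < r)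
    {f : E3 → ℝ} {W : Set E3} {M : ℝ} (hf : ∀ᶠ x in 𝓝 (H 0), x ∈ W → |f x| ≤ M) :
    IsApprox (fun δ ε => ∫ x in H '' box (flatSides δ ε) ∩ W, f x) 0 := by
  have h0 : ContDiffAt ℝ 1 H 0 := hH.smooth 0 (by simpa using hr)
  set d := (fderiv ℝ H 0).det with hd
  have hd0 : 0 < d := hH.det_pos 0 (by simpa using hr)
  have e1 : ∀ᶠ q in 𝓝 (0 : E3), |(fderiv ℝ H q).det| ≤ d + 1 := by
    have h1 : ContinuousAt (fderiv ℝ H) 0 :=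
      (h0.fderiv_right (m := 0) (by norm_num)).continuousAt
    have h2 : ContinuousAt (fun q => |(fderiv ℝ H q).det|) 0 :=
      (ContinuousAt.comp (g := ContinuousLinearMap.det)
        ContinuousLinearMap.continuous_det.continuousAt h1).abs
    exact (h2.eventually (gt_mem_nhds ((abs_of_pos hd0).trans_lt (lt_add_one d)))).mono
      fun q hq => hq.le
  have e2 := h0.continuousAt.eventually hf
  have e3 : ∀ᶠ q in 𝓝 (0 : E3), ‖q‖ < r := by
    filter_upwards [Metric.ball_mem_nhds (0 : E3) hr] with q hq
    simpa using hq
  refine isApprox_of_eventually_le (8 * (|M| * (d + 1))) fun δ hδ => ?_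
  filter_upwards [eventually_flatBox ((e1.and e2).and e3) hδ] with ε hε
  obtain ⟨hε0, hε1, hb⟩ := hε
  have hbox : ∀ q ∈ box (flatSides δ ε), _ := fun q hq => hb q (box_subset_cbox _ hq)
  have hvol : volume (H '' box (flatSides δ ε))
      ≤ ENNReal.ofReal (d + 1) * volume (box (flatSides δ ε)) := by
    rw [← lintegral_abs_det_fderiv_eq_addHaar_image volume (isOpen_box _).measurableSet
      (fun q hq => ((hH.smooth q (hbox q hq).2).differentiableAt
        (by norm_num)).hasFDerivAt.hasFDerivWithinAt)
      (hH.injOn.mono fun q hq => mem_ball_zero_iff.2 (hbox q hq).2)]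
    refine (setLIntegral_mono measurable_const fun q hq =>
      ENNReal.ofReal_le_ofReal (hbox q hq).1.1).trans (le_of_eq ?_)
    rw [setLIntegral_const]
  have hfin := ENNReal.mul_lt_top (ENNReal.ofReal_lt_top (r := d + 1))
    (volume_box_lt_top (flatSides δ ε))
  have hvol' : volume.real (H '' box (flatSides δ ε) ∩ W) ≤ (d + 1) * (8 * ε ^ 3 * δ) := by
    rw [← volume_real_flatBox hδ.1 hε0]
    refine (ENNReal.toReal_mono hfin.ne ((measure_mono inter_subset_left).trans hvol)).trans
      (le_of_eq ?_)
    rw [ENNReal.toReal_mul, ENNReal.toReal_ofReal (by linarith)]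
    rfl
  have h3 := norm_setIntegral_le_of_norm_le_const (f := f) (C := |M|)
    (((measure_mono inter_subset_left).trans hvol).trans_lt hfin :
      volume (H '' box (flatSides δ ε) ∩ W) < ⊤) (by
    rintro _ ⟨⟨q, hq, rfl⟩, hW⟩
    exact ((hbox q hq).1.2 hW).trans (le_abs_self _))
  rw [zero_mul, sub_zero, ← Real.norm_eq_abs]
  refine h3.trans ((mul_le_mul_of_nonneg_left hvol' (abs_nonneg _)).trans ?_)
  have h4 : ε ^ 3 ≤ ε ^ 2 := pow_le_pow_of_le_one hε0.le hε1.le (by norm_num)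
  have h5 : 0 ≤ |M| * (d + 1) * δ * 8 :=
    mul_nonneg (mul_nonneg (mul_nonneg (abs_nonneg _) (by linarith)) hδ.1.le) (by norm_num)
  nlinarith [mul_le_mul_of_nonneg_left h4 h5]

lemma measurableSet_faceDomain (a : Fin 3 → ℝ) (i : Fin 3) : MeasurableSet (faceDomain a i) :=
  (isOpen_box _).measurableSet

lemma volume_faceDomain_lt_top (a : Fin 3 → ℝ) (i : Fin 3) : volume (faceDomain a i) < ⊤ :=
  volume_box_lt_top _

lemma volume_real_faceDomain {δ ε : ℝ} (hδ : 0 < δ) (hε : 0 < ε) (i : Fin 3) :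
    volume.real (faceDomain (flatSides δ ε) i)
      = 4 * (flatSides δ ε (i + 1) * flatSides δ ε (i + 2)) := by
  rw [faceDomain, volume_real_box (by
    simp [Fin.forall_fin_two, (flatSides_pos hδ hε _).le])]
  simp
  ring

/-- The integral over the top or the bottom face sees only the value of the integrand at the centre. -/
lemma isApprox_top_face {h : E3 → ℝ} (hh : ∀ᶠ q in 𝓝 (0 : E3), ContinuousAt h q) {σ : ℝ}
    (hσ : |σ| = 1) :
    IsApprox (fun δ ε => ∫ p in faceDomain (flatSides δ ε) 2, h (face (flatSides δ ε) 2 σ p))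
      (h 0) := by
  refine isApprox_of_eventually_le 4 fun δ hδ => ?_
  have h1 : ∀ᶠ q in 𝓝 (0 : E3), |h q - h 0| ≤ δ := by
    simpa [Real.dist_eq] using hh.self_of_nhds.eventually (Metric.closedBall_mem_nhds _ hδ.1)
  filter_upwards [eventually_flatBox (hh.and h1) hδ] with ε hε
  obtain ⟨hε0, -, hb⟩ := hε
  have ha := flatSides_pos hδ.1 hε0
  have hmem : ∀ p ∈ closure (faceDomain (flatSides δ ε) 2), _ := fun p hp =>
    hb _ (face_mem_cbox hσ ha hp)
  have hint : IntegrableOn (fun p => h (face (flatSides δ ε) 2 σ p))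
      (faceDomain (flatSides δ ε) 2) := by
    have hc : IsCompact (closure (faceDomain (flatSides δ ε) 2)) := by
      rw [faceDomain, closure_box (by simp [Fin.forall_fin_two, ha])]
      exact isCompact_cbox _
    refine (ContinuousOn.integrableOn_compact hc fun p hp => ?_).mono_set subset_closure
    exact (ContinuousAt.comp (f := face (flatSides δ ε) 2 σ) (hmem p hp).1
      (contDiff_face _ _ _ (k := 0)).continuous.continuousAt).continuousWithinAt
  have h2 := abs_setIntegral_sub_const_le (volume_faceDomain_lt_top _ _) hint
    fun p hp => (hmem p (subset_closure hp)).2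
  have h3 : volume.real (faceDomain (flatSides δ ε) 2) = 4 * ε ^ 2 := by
    rw [volume_real_faceDomain hδ.1 hε0]; simp [flatSides]; ring
  rwa [h3] at h2

lemma volume_coord_eq_zero (k : Fin 2) : volume {p : P2 | p k = 0} = 0 := by
  have h := Measure.addHaar_submodule (volume : Measure P2)
    (LinearMap.ker (EuclideanSpace.proj k : P2 →L[ℝ] ℝ).toLinearMap) (by
      intro h
      have h1 : EuclideanSpace.single k (1 : ℝ) ∈
        LinearMap.ker (EuclideanSpace.proj k : P2 →L[ℝ] ℝ).toLinearMap := h ▸ Submodule.mem_top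
      simp at h1)
  convert h using 2
  ext p
  simp

/-- The flux through the lateral faces of a flat box is negligible, their area being `O(δ ε²)`. -/
lemma isApprox_lateral_face {h : E3 → ℝ} {M : ℝ}
    (hh : ∀ᶠ q in 𝓝 (0 : E3), q 2 ≠ 0 → |h q| ≤ M) {σ : ℝ} (hσ : |σ| = 1) {i : Fin 3}
    (hi : i ≠ 2) :
    IsApprox (fun δ ε => ∫ p in faceDomain (flatSides δ ε) i, h (face (flatSides δ ε) i σ p)) 0 := by
  refine isApprox_of_eventually_le (4 * |M|) fun δ hδ => ?_
  filter_upwards [eventually_flatBox hh hδ] with ε hε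
  obtain ⟨hε0, -, hb⟩ := hε
  have ha := flatSides_pos hδ.1 hε0
  -- the face meets the surface in a null set
  have hnull : ∃ k : Fin 2, ∀ p : P2, face (flatSides δ ε) i σ p 2 = 0 → p k = 0 := by
    have hσ0 : σ ≠ 0 := by rintro rfl; simp at hσ
    fin_cases i
    · refine ⟨1, fun p hp => ?_⟩
      have := face_apply_two (flatSides δ ε) 0 σ p
      rw [show ((0 : Fin 3) + 2) = 2 from rfl] at this
      exact (mul_eq_zero.1 (this.symm.trans hp)).resolve_left hσ0
    · exact ⟨0, fun p hp => (face_apply_one (flatSides δ ε) 1 σ p).symm.trans hp⟩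
    · exact absurd rfl hi
  obtain ⟨k, hk⟩ := hnull
  have hae : ∀ᵐ p ∂volume.restrict (faceDomain (flatSides δ ε) i),
      ‖h (face (flatSides δ ε) i σ p)‖ ≤ |M| := by
    rw [ae_restrict_iff' (measurableSet_faceDomain _ _)]
    filter_upwards [measure_eq_zero_iff_ae_notMem.1 (volume_coord_eq_zero k)] with p hp hpm
    exact (hb _ (face_mem_cbox hσ ha (subset_closure hpm)) fun h0 => hp (hk p h0)).trans
      (le_abs_self _)
  have h2 := norm_setIntegral_le_of_norm_le_const_ae
    (volume_faceDomain_lt_top (flatSides δ ε) i) hae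
  have h3 : volume.real (faceDomain (flatSides δ ε) i) = 4 * (δ * ε ^ 2) := by
    rw [volume_real_faceDomain hδ.1 hε0]
    fin_cases i <;> simp [flatSides] at hi ⊢ <;> ring
  rw [zero_mul, sub_zero, ← Real.norm_eq_abs]
  exact h2.trans (le_of_eq (by rw [h3]; ring))

/-- The flux of a field out of a flat box, for small boxes, is the flux of its jump through the
surface. -/
theorem isApprox_box_flux {H : E3 → E3} (hH : ContDiffAt ℝ 1 H 0) {F : E3 → E3}
    {G : Fin 2 → E3 → E3} (hG : ∀ k, ∀ᶠ x in 𝓝 (H 0), ContinuousAt (G k) x)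
    (hF : ∀ k, ∀ᶠ q in 𝓝 (0 : E3), 0 < faceSign k * q 2 → F (H q) = G k (H q)) :
    IsApprox (fun δ ε => ∑ i : Fin 3, ∑ k : Fin 2, ∫ p in faceDomain (flatSides δ ε) i,
      inner ℝ (F (H (face (flatSides δ ε) i (faceSign k) p)))
        (normalVec (H ∘ face (flatSides δ ε) i (faceSign k)) p))
      (inner ℝ (G 0 (H 0) - G 1 (H 0)) (cross (fderiv ℝ H 0 (e3 0)) (fderiv ℝ H 0 (e3 1)))) := by
  set N : Fin 3 → E3 → E3 := fun i q =>
    cross (fderiv ℝ H q (e3 (i + 1))) (fderiv ℝ H q (e3 (i + 2))) with hN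
  have eH : ∀ᶠ q in 𝓝 (0 : E3), ContDiffAt ℝ 1 H q := hH.eventually (by simp)
  have hNc : ∀ i, ∀ᶠ q in 𝓝 (0 : E3), ContinuousAt (N i) q := by
    intro i
    filter_upwards [eH] with q hq
    have h1 : ContDiffAt ℝ 0 (fderiv ℝ H) q := hq.fderiv_right (by norm_num)
    exact (contDiffAt_cross (h1.clm_apply contDiffAt_const)
      (h1.clm_apply contDiffAt_const)).continuousAt
  -- the integrals, as integrals of functions in space over the faces of the coordinate box
  have hcongr : ∀ i k, ∀ δ ∈ Ioo (0 : ℝ) 1, ∀ᶠ ε in 𝓝[>] (0 : ℝ),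
      (∫ p in faceDomain (flatSides δ ε) i,
        inner ℝ (F (H (face (flatSides δ ε) i (faceSign k) p)))
          (normalVec (H ∘ face (flatSides δ ε) i (faceSign k)) p))
      = ∫ p in faceDomain (flatSides δ ε) i, (fun q => faceSign k * inner ℝ (F (H q)) (N i q))
          (face (flatSides δ ε) i (faceSign k) p) := by
    intro i k δ hδ
    filter_upwards [eventually_flatBox eH hδ] with ε hε
    refine setIntegral_congr_fun (measurableSet_faceDomain _ _) fun p hp => ?_
    have hm := face_mem_cbox (abs_faceSign k) (flatSides_pos hδ.1 hε.1) (subset_closure hp)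
    rw [normalVec_comp_face ((hε.2.2 _ hm).differentiableAt (by norm_num)), inner_smul_right]
  have hlat : ∀ i k, i ≠ 2 → IsApprox (fun δ ε => ∫ p in faceDomain (flatSides δ ε) i,
      inner ℝ (F (H (face (flatSides δ ε) i (faceSign k) p)))
        (normalVec (H ∘ face (flatSides δ ε) i (faceSign k)) p)) 0 := by
    intro i k hi
    refine IsApprox.congr (isApprox_lateral_face
      (h := fun q => faceSign k * inner ℝ (F (H q)) (N i q))
      (M := (‖G 0 (H 0)‖ + 1 + (‖G 1 (H 0)‖ + 1)) * (‖N i 0‖ + 1)) ?_ (abs_faceSign k) hi)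
      (hcongr i k)
    have eN : ∀ᶠ q in 𝓝 (0 : E3), ‖N i q‖ < ‖N i 0‖ + 1 :=
      (hNc i).self_of_nhds.norm.eventually (gt_mem_nhds (lt_add_one _))
    have eG : ∀ k, ∀ᶠ q in 𝓝 (0 : E3), ‖G k (H q)‖ < ‖G k (H 0)‖ + 1 := fun k =>
      (ContinuousAt.comp (f := H) (g := G k) (hG k).self_of_nhds
        hH.continuousAt).norm.eventually (gt_mem_nhds (lt_add_one _))
    filter_upwards [eN, eG 0, eG 1, hF 0, hF 1] with q h1 h2 h3 h4 h5 hq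
    have h6 : ‖F (H q)‖ ≤ ‖G 0 (H 0)‖ + 1 + (‖G 1 (H 0)‖ + 1) := by
      rcases lt_or_gt_of_ne hq with h | h
      · rw [h5 (by simpa [faceSign] using h)]
        linarith [norm_nonneg (G 0 (H 0))]
      · rw [h4 (by simpa [faceSign] using h)]
        linarith [norm_nonneg (G 1 (H 0))]
    rw [abs_mul, abs_faceSign, one_mul]
    exact (abs_real_inner_le_norm _ _).trans
      (mul_le_mul h6 h1.le (norm_nonneg _) (by positivity))
  have htop : ∀ k, IsApprox (fun δ ε => ∫ p in faceDomain (flatSides δ ε) 2,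
      inner ℝ (F (H (face (flatSides δ ε) 2 (faceSign k) p)))
        (normalVec (H ∘ face (flatSides δ ε) 2 (faceSign k)) p))
      (faceSign k * inner ℝ (G k (H 0)) (N 2 0)) := by
    intro k
    have hc : ∀ᶠ q in 𝓝 (0 : E3),
        ContinuousAt (fun q => faceSign k * inner ℝ (G k (H q)) (N 2 q)) q := by
      filter_upwards [hNc 2, eH, hH.continuousAt.eventually (hG k)] with q h1 h2 h3
      exact continuousAt_const.mul
        ((ContinuousAt.comp (f := H) (g := G k) h3 h2.continuousAt).inner h1)
    refine IsApprox.congr (isApprox_top_face hc (abs_faceSign k)) fun δ hδ => ?_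
    filter_upwards [hcongr 2 k δ hδ, eventually_flatBox (hF k) hδ] with ε h1 hε
    rw [h1]
    refine setIntegral_congr_fun (measurableSet_faceDomain _ _) fun p hp => ?_
    have ha := flatSides_pos hδ.1 hε.1
    have hm := face_mem_cbox (abs_faceSign k) ha (subset_closure hp)
    rw [hε.2.2 _ hm]
    rw [face_apply, ← mul_assoc, ← abs_mul_abs_self, abs_faceSign, one_mul, one_mul]
    exact ha 2
  have hsum := IsApprox.sum Finset.univ fun i _ => IsApprox.sum Finset.univ fun k _ =>
    (show IsApprox (fun δ ε => ∫ p in faceDomain (flatSides δ ε) i,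
      inner ℝ (F (H (face (flatSides δ ε) i (faceSign k) p)))
        (normalVec (H ∘ face (flatSides δ ε) i (faceSign k)) p))
      (if i = 2 then faceSign k * inner ℝ (G k (H 0)) (N 2 0) else 0) by
        split_ifs with hi
        · subst hi; exact htop k
        · exact hlat i k hi)
  convert hsum using 1
  simp [faceSign, hN, inner_sub_left]
  ring

/-! ### Flat boxes as control volumes -/

section Balance

variable {T : ℝ} {U : Set P2} {Φ : ℝ → P2 → E3} {V₁ V₂ : ℝ → Set E3} {t : ℝ} {u₀ : P2}
  {π : ℝ × E3 → E3} {r δ ε : ℝ}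

lemma add_proj_mem_square {q : E3} (hq : q ∈ box (flatSides δ ε)) : u₀ + proj q ∈ square u₀ ε := by
  rw [mem_flatBox] at hq
  simp [square, Fin.forall_fin_two, hq.1, hq.2.1]

lemma add_proj_mem_closure_square (hε : 0 < ε) {q : E3} (hq : q ∈ cbox (flatSides δ ε)) :
    u₀ + proj q ∈ closure (square u₀ ε) := by
  rw [closure_square u₀ hε]
  have h0 := hq 0
  have h1 := hq 1
  simp only [flatSides, Matrix.cons_val_zero, Matrix.cons_val_one] at h0 h1
  simp [Fin.forall_fin_two, h0, h1]

lemma exists_proj_eq (u : P2) : ∃ q : E3, q 2 = 0 ∧ u₀ + proj q = u :=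
  ⟨!₂[(u - u₀) 0, (u - u₀) 1, 0], by simp, ext_two (by simp) (by simp)⟩

lemma mem_box_of_square (hδ : 0 < δ) (hε : 0 < ε) {q : E3} (h0 : q 2 = 0)
    (hq : u₀ + proj q ∈ square u₀ ε) : q ∈ box (flatSides δ ε) := by
  have h1 := hq 0
  have h2 := hq 1
  rw [add_sub_cancel_left] at h1 h2
  exact mem_flatBox.2 ⟨h1, h2, by rw [h0, abs_zero]; positivity⟩

lemma mem_cbox_of_closure_square (hδ : 0 < δ) (hε : 0 < ε) {q : E3} (h0 : q 2 = 0)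
    (hq : u₀ + proj q ∈ closure (square u₀ ε)) : q ∈ cbox (flatSides δ ε) := by
  rw [closure_square u₀ hε] at hq
  have h1 := hq 0
  have h2 := hq 1
  rw [add_sub_cancel_left] at h1 h2
  intro i
  fin_cases i
  · exact h1
  · exact h2
  · change |q 2| ≤ δ * ε
    rw [h0, abs_zero]; positivity

lemma IsChart.mem_surface_iff (hS : IsSingularSurface T U Φ V₁ V₂)
    (hπ : IsChart T U Φ V₁ V₂ t u₀ π r) {q : E3} (hq : ‖q‖ < r) :
    chart Φ u₀ (unitNormal (Φ t) u₀) (t, q) ∈ Φ t '' U ↔ q 2 = 0 := by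
  have ht : |t - t| < r := by simpa using hπ.pos
  have hT := hπ.mem_time t ht
  refine ⟨fun h => ?_, chart_mem_surface (hπ.mem_param q hq)⟩
  rcases lt_trichotomy (q 2) 0 with h0 | h0 | h0
  · exact absurd h (Set.disjoint_left.1 (hS.disjoint₁ t hT) (hπ.side₁ t q ht hq h0))
  · exact h0
  · exact absurd h (Set.disjoint_left.1 (hS.disjoint₂ t hT) (hπ.side₂ t q ht hq h0))

lemma chart_of_apply_two_eq_zero {n q : E3} {s : ℝ} (h0 : q 2 = 0) :
    chart Φ u₀ n (s, q) = Φ s (u₀ + proj q) := by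
  simp [chart, h0]

/-- A small flat curvilinear box is a control volume, which the surface meets in the image of a
square. -/
def pillboxVolume (hS : IsSingularSurface T U Φ V₁ V₂) (hπ : IsChart T U Φ V₁ V₂ t u₀ π r)
    (hδ : δ ∈ Ioo (0 : ℝ) 1) (hε : 0 < ε) (hεr : 2 * ε < r) :
    ControlVolume (Φ t) U (V₁ t) (V₂ t) (pillbox Φ t u₀ δ ε) :=
  have ht : |t - t| < r := by simpa using hπ.pos
  have hH := hπ.isPositiveDiffeo hS ht
  have hr : ∀ i, 2 * flatSides δ ε i < r := fun i => by linarith [flatSides_le hδ.2 hε i]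
  have ha := flatSides_pos hδ.1 hε
  have hball : ∀ q ∈ cbox (flatSides δ ε), ‖q‖ < r := fun q hq =>
    mem_ball_zero_iff.1 (cbox_subset_ball hr hq)
  have hcl : closure (pillbox Φ t u₀ δ ε)
      = (fun q => chart Φ u₀ (unitNormal (Φ t) u₀) (t, q)) '' cbox (flatSides δ ε) :=
    hH.closure_image_box ha hr
  have hcU : closure (square u₀ ε) ⊆ U := fun u hu => by
    obtain ⟨q, hq0, rfl⟩ := exists_proj_eq (u₀ := u₀) u
    exact hπ.mem_param q (hball q (mem_cbox_of_closure_square hδ.1 hε hq0 hu))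
  { isOpen := isOpen_pillbox hS hπ hδ.2 hε hεr
    isBounded := by
      refine Bornology.IsBounded.subset ?_ subset_closure
      rw [hcl]
      exact ((isCompact_cbox _).image_of_continuousOn
        (hH.continuousOn.mono (cbox_subset_ball hr))).isBounded
    closure_subset := by
      rw [hcl]
      rintro _ ⟨q, hq, rfl⟩
      rcases lt_trichotomy (q 2) 0 with h0 | h0 | h0
      · exact Or.inl (Or.inl (hπ.side₁ t q ht (hball q hq) h0))
      · exact Or.inl (Or.inr ((hπ.mem_surface_iff hS (hball q hq)).2 h0))
      · exact Or.inr (hπ.side₂ t q ht (hball q hq) h0)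
    boundary := boxBoundary hH ha hr
    D := square u₀ ε
    isOpen_piece := isOpen_square u₀ ε
    isCompact_closure_piece := isCompact_closure_square u₀ hε
    closure_piece_subset := hcU
    inter_surface := by
      ext x
      constructor
      · rintro ⟨⟨q, hq, rfl⟩, hx⟩
        have h0 := (hπ.mem_surface_iff hS (hball q (box_subset_cbox _ hq))).1 hx
        exact ⟨u₀ + proj q, add_proj_mem_square hq, (chart_of_apply_two_eq_zero h0).symm⟩
      · rintro ⟨u, hu, rfl⟩
        refine ⟨?_, u, hcU (subset_closure hu), rfl⟩
        obtain ⟨q, hq0, rfl⟩ := exists_proj_eq (u₀ := u₀) u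
        exact ⟨q, mem_box_of_square hδ.1 hε hq0 hu, chart_of_apply_two_eq_zero hq0⟩
    closure_inter_surface := by
      rw [hcl]
      ext x
      constructor
      · rintro ⟨⟨q, hq, rfl⟩, hx⟩
        have h0 := (hπ.mem_surface_iff hS (hball q hq)).1 hx
        exact ⟨u₀ + proj q, add_proj_mem_closure_square hε hq, (chart_of_apply_two_eq_zero h0).symm⟩
      · rintro ⟨u, hu, rfl⟩
        refine ⟨?_, u, hcU hu, rfl⟩
        obtain ⟨q, hq0, rfl⟩ := exists_proj_eq (u₀ := u₀) u
        exact ⟨q, mem_cbox_of_closure_square hδ.1 hε hq0 hu, chart_of_apply_two_eq_zero hq0⟩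
    curve := squareBoundary u₀ hε }

/-- The balance law for a control volume which is not given as the image of its initial
configuration. -/
lemma hasDerivAt_of_integralBalance {χ : ℝ → E3 ≃ₜ E3} {ψ ξ : ℝ → E3 → ℝ} {j : ℝ → E3 → E3}
    {ψS ξS : ℝ → E3 → ℝ} {jS : ℝ → E3 → E3}
    (h : ∀ (R : Set E3) (C : ControlVolume (Φ t) U (V₁ t) (V₂ t) (χ t '' R)),
      IntegralBalance U Φ V₁ V₂ χ ψ ξ j ψS ξS jS t R C)
    {K : Set E3} (C : ControlVolume (Φ t) U (V₁ t) (V₂ t) K) :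
    HasDerivAt (fun s => (∫ x in (χ s '' (χ t ⁻¹' K)) ∩ (V₁ s ∪ V₂ s), ψ s x)
        + surfaceIntegral (Φ s) C.D (ψS s))
      (-C.boundary.flux (j t) - C.curve.flux (Φ t) (jS t)
        + (∫ x in K ∩ (V₁ t ∪ V₂ t), ξ t x) + surfaceIntegral (Φ t) C.D (ξS t)) t := by
  obtain ⟨R, rfl⟩ : ∃ R, K = χ t '' R :=
    ⟨χ t ⁻¹' K, (Set.image_preimage_eq K (χ t).surjective).symm⟩
  rw [Set.preimage_image_eq R (χ t).injective]
  exact h R C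

/-! ### One-sided limits of piecewise smooth fields -/

lemma SmoothUpTo.exists_extension {F : Type*} [NormedAddCommGroup F] [NormedSpace ℝ F] {k : ℕ}
    {V : ℝ → Set E3} {f : ℝ → E3 → F}
    (h : SmoothUpTo k (spaceTime T V) (spaceTime T fun t => Φ t '' U) (fun p => f p.1 p.2))
    (ht : t ∈ Ioo 0 T) (hu : u₀ ∈ U) :
    ∃ g : ℝ × E3 → F, ContDiffAt ℝ k g (t, Φ t u₀) ∧
      ∀ᶠ p in 𝓝 (t, Φ t u₀), p ∈ spaceTime T V → f p.1 p.2 = g p := by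
  obtain ⟨g, hg, he⟩ := h (t, Φ t u₀) (Or.inr ⟨ht, u₀, hu, rfl⟩)
  exact ⟨g, hg, eventually_nhdsWithin_iff.1 he⟩

lemma eventually_slice {P : ℝ × E3 → Prop} {x : E3} (h : ∀ᶠ p in 𝓝 (t, x), P p) :
    ∀ᶠ x' in 𝓝 x, P (t, x') :=
  (Continuous.tendsto' (by fun_prop : Continuous fun x' : E3 => (t, x')) x (t, x) rfl).eventually h

lemma tendsto_side {F : Type*} [TopologicalSpace F] {V : ℝ → Set E3} {f : ℝ → E3 → F}
    {g : ℝ × E3 → F} {x : E3} (ht : t ∈ Ioo 0 T) (hg : ContinuousAt g (t, x))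
    (h : ∀ᶠ p in 𝓝 (t, x), p ∈ spaceTime T V → f p.1 p.2 = g p) :
    Tendsto (f t) (𝓝[V t] x) (𝓝 (g (t, x))) := by
  have h1 : ContinuousAt (fun x' => g (t, x')) x :=
    ContinuousAt.comp (f := fun x' : E3 => (t, x')) hg (by fun_prop)
  refine (h1.tendsto.mono_left nhdsWithin_le_nhds).congr' ?_
  filter_upwards [nhdsWithin_le_nhds (eventually_slice h), self_mem_nhdsWithin] with x' h2 h3
  exact (h2 ⟨ht, h3⟩).symm

lemma IsSingularSurface.neBot (hS : IsSingularSurface T U Φ V₁ V₂) (ht : t ∈ Ioo 0 T)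
    (hu : u₀ ∈ U) : (𝓝[V₁ t] Φ t u₀).NeBot ∧ (𝓝[V₂ t] Φ t u₀).NeBot := by
  have hn := hS.normal_direction t ht u₀ hu
  have h0 : ∀ σ : ℝ, Tendsto (fun l : ℝ => Φ t u₀ + (σ * l) • unitNormal (Φ t) u₀) (𝓝[>] 0)
      (𝓝 (Φ t u₀)) := fun σ => by
    refine Tendsto.mono_left ?_ nhdsWithin_le_nhds
    exact Continuous.tendsto' (by fun_prop) _ _ (by simp)
  constructor
  · refine mem_closure_iff_nhdsWithin_neBot.1 (mem_closure_of_tendsto (h0 (-1)) ?_)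
    filter_upwards [hn] with l hl
    simpa [sub_eq_add_neg] using hl.2
  · refine mem_closure_iff_nhdsWithin_neBot.1 (mem_closure_of_tendsto (h0 1) ?_)
    filter_upwards [hn] with l hl
    simpa using hl.1

lemma isOpen_slice {V : ℝ → Set E3} (h : IsOpen (spaceTime T V)) (ht : t ∈ Ioo 0 T) :
    IsOpen (V t) := by
  convert h.preimage (by fun_prop : Continuous fun x : E3 => (t, x)) using 1
  ext x
  simp only [mem_preimage, spaceTime, mem_ofPred_eq]
  exact ⟨fun hx => ⟨ht, hx⟩, fun hx => hx.2⟩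

/-! ### The jump condition -/

/-- The surface point adheres to both sides, so that the one-sided limits in `jump` are no junk
values. -/
lemma jump_eq {F : Type*} [NormedAddCommGroup F] (hS : IsSingularSurface T U Φ V₁ V₂)
    (ht : t ∈ Ioo 0 T) (hu : u₀ ∈ U) {f : E3 → F} {l₁ l₂ : F}
    (h₁ : Tendsto f (𝓝[V₁ t] Φ t u₀) (𝓝 l₁)) (h₂ : Tendsto f (𝓝[V₂ t] Φ t u₀) (𝓝 l₂)) :
    jump (V₁ t) (V₂ t) f (Φ t u₀) = l₂ - l₁ := by
  obtain ⟨nb₁, nb₂⟩ := hS.neBot ht hu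
  rw [jump, sideLimit, sideLimit, h₁.limUnder_eq, h₂.limUnder_eq]

/-- The flux of `F` through the six faces of the flat box. -/
def pillboxFlux (Φ : ℝ → P2 → E3) (t : ℝ) (u₀ : P2) (F : E3 → E3) (δ ε : ℝ) : ℝ :=
  ∑ i : Fin 3, ∑ k : Fin 2, ∫ p in faceDomain (flatSides δ ε) i,
    inner ℝ (F (chart Φ u₀ (unitNormal (Φ t) u₀) (t, face (flatSides δ ε) i (faceSign k) p)))
      (normalVec ((fun q => chart Φ u₀ (unitNormal (Φ t) u₀) (t, q)) ∘
        face (flatSides δ ε) i (faceSign k)) p)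

lemma isApprox_pillboxFlux (hS : IsSingularSurface T U Φ V₁ V₂)
    (hπ : IsChart T U Φ V₁ V₂ t u₀ π r) (ht : t ∈ Ioo 0 T) (hu : u₀ ∈ U) {j : ℝ → E3 → E3}
    {g₁ g₂ : ℝ × E3 → E3} (hg₁ : ContDiffAt ℝ 0 g₁ (t, Φ t u₀)) (hg₂ : ContDiffAt ℝ 0 g₂ (t, Φ t u₀))
    (h₁ : ∀ᶠ p in 𝓝 (t, Φ t u₀), p ∈ spaceTime T V₁ → j p.1 p.2 = g₁ p)
    (h₂ : ∀ᶠ p in 𝓝 (t, Φ t u₀), p ∈ spaceTime T V₂ → j p.1 p.2 = g₂ p) :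
    IsApprox (pillboxFlux Φ t u₀ (j t)) (areaDensity (Φ t) u₀ *
      inner ℝ (g₂ (t, Φ t u₀) - g₁ (t, Φ t u₀)) (unitNormal (Φ t) u₀)) := by
  set n := unitNormal (Φ t) u₀ with hn
  have hr0 : |t - t| < r := by simpa using hπ.pos
  have hHd : DifferentiableAt ℝ (Φ t) (u₀ + proj 0) := by
    simpa using (hS.contDiffAt_slice ht hu).differentiableAt (by norm_num)
  have hH0 : chart Φ u₀ n (t, 0) = Φ t u₀ := chart_zero _ _ _
  have hH1 : ContDiffAt ℝ 1 (fun q => chart Φ u₀ n (t, q)) 0 :=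
    (hπ.isPositiveDiffeo hS hr0).smooth 0 (by simpa using hπ.pos)
  have hnear : ∀ᶠ q in 𝓝 (0 : E3), ‖q‖ < r := by
    filter_upwards [Metric.ball_mem_nhds (0 : E3) hπ.pos] with q hq
    simpa using hq
  have hcont : Tendsto (fun q => chart Φ u₀ n (t, q)) (𝓝 0) (𝓝 (Φ t u₀)) := by
    have := hH1.continuousAt.tendsto
    beta_reduce at this
    rwa [hH0] at this
  have hG : ∀ g : ℝ × E3 → E3, ContDiffAt ℝ 0 g (t, Φ t u₀) →
      ∀ᶠ x in 𝓝 (Φ t u₀), ContinuousAt (fun x => g (t, x)) x := fun g hg => by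
    filter_upwards [eventually_slice (hg.eventually (by simp))] with x hx
    exact ContinuousAt.comp (f := fun x : E3 => (t, x)) hx.continuousAt (by fun_prop)
  have h1 := isApprox_box_flux (H := fun q => chart Φ u₀ n (t, q)) hH1 (F := j t)
    (G := ![fun x => g₂ (t, x), fun x => g₁ (t, x)])
    (by
      beta_reduce
      rw [hH0, Fin.forall_fin_two]
      exact ⟨hG _ hg₂, hG _ hg₁⟩)
    (by
      rw [Fin.forall_fin_two]
      constructor
      · filter_upwards [hcont.eventually (eventually_slice h₂), hnear] with q h1 h2 h3
        exact h1 ⟨ht, ((hπ.isSide₂ hS).mem_iff t q hr0 h2).2 h3⟩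
      · filter_upwards [hcont.eventually (eventually_slice h₁), hnear] with q h1 h2 h3
        exact h1 ⟨ht, ((hπ.isSide₁ hS).mem_iff t q hr0 h2).2 h3⟩)
  obtain ⟨d0, d1, -⟩ := fderiv_chart_slice_apply (n := n) hHd
  beta_reduce at h1
  rw [d0, d1, hH0, map_zero, add_zero] at h1
  have e : areaDensity (Φ t) u₀ * inner ℝ (g₂ (t, Φ t u₀) - g₁ (t, Φ t u₀)) n
      = inner ℝ (g₂ (t, Φ t u₀) - g₁ (t, Φ t u₀)) (normalVec (Φ t) u₀) := by
    rw [normalVec_eq_smul, inner_smul_right]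
  rw [e]
  exact h1

lemma isApprox_pillbox_source (hS : IsSingularSurface T U Φ V₁ V₂)
    (hπ : IsChart T U Φ V₁ V₂ t u₀ π r) (ht : t ∈ Ioo 0 T) {ξ : ℝ → E3 → ℝ}
    {g₁ g₂ : ℝ × E3 → ℝ} (hg₁ : ContinuousAt g₁ (t, Φ t u₀)) (hg₂ : ContinuousAt g₂ (t, Φ t u₀))
    (h₁ : ∀ᶠ p in 𝓝 (t, Φ t u₀), p ∈ spaceTime T V₁ → ξ p.1 p.2 = g₁ p)
    (h₂ : ∀ᶠ p in 𝓝 (t, Φ t u₀), p ∈ spaceTime T V₂ → ξ p.1 p.2 = g₂ p) :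
    IsApprox (fun δ ε => ∫ x in pillbox Φ t u₀ δ ε ∩ (V₁ t ∪ V₂ t), ξ t x) 0 := by
  refine isApprox_source (hπ.isPositiveDiffeo hS (by simpa using hπ.pos)) hπ.pos
    (M := |g₁ (t, Φ t u₀)| + 1 + (|g₂ (t, Φ t u₀)| + 1)) ?_
  have hb : ∀ g : ℝ × E3 → ℝ, ContinuousAt g (t, Φ t u₀) →
      ∀ᶠ p in 𝓝 (t, Φ t u₀), |g p| < |g (t, Φ t u₀)| + 1 := fun g hg =>
    hg.abs.eventually (gt_mem_nhds (lt_add_one _))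
  beta_reduce
  rw [chart_zero]
  filter_upwards [eventually_slice h₁, eventually_slice h₂, eventually_slice (hb _ hg₁),
    eventually_slice (hb _ hg₂)] with x h1 h2 h3 h4 hx
  rcases hx with hx | hx
  · rw [h1 ⟨ht, hx⟩]
    linarith [abs_nonneg (g₂ (t, Φ t u₀))]
  · rw [h2 ⟨ht, hx⟩]
    linarith [abs_nonneg (g₁ (t, Φ t u₀))]

/-- The rate of change of the content of a small flat box, as given by the balance law, consists of
the transport of `ψ` from either side into the surface and of the rate of change of the surface
content. -/
lemma isApprox_rate (hS : IsSingularSurface T U Φ V₁ V₂) {χ : ℝ → E3 ≃ₜ E3} {v : ℝ → E3 → E3}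
    (hχ : IsMotion T U Φ V₁ V₂ χ v) (hπ : IsChart T U Φ V₁ V₂ t u₀ π r) (ht : t ∈ Ioo 0 T)
    (hu : u₀ ∈ U) {ψ ξ : ℝ → E3 → ℝ} {j : ℝ → E3 → E3} {ψS ξS : ℝ → E3 → ℝ} {jS : ℝ → E3 → E3}
    {gv₁ gv₂ : ℝ × E3 → E3} {g₁ g₂ : ℝ × E3 → ℝ}
    (hgv₁ : ContinuousAt gv₁ (t, Φ t u₀)) (hgv₂ : ContinuousAt gv₂ (t, Φ t u₀))
    (hv₁ : ∀ᶠ p in 𝓝 (t, Φ t u₀), p ∈ spaceTime T V₁ → v p.1 p.2 = gv₁ p)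
    (hv₂ : ∀ᶠ p in 𝓝 (t, Φ t u₀), p ∈ spaceTime T V₂ → v p.1 p.2 = gv₂ p)
    (hg₁ : ContDiffAt ℝ 1 g₁ (t, Φ t u₀)) (hg₂ : ContDiffAt ℝ 1 g₂ (t, Φ t u₀))
    (hψ₁ : ∀ᶠ p in 𝓝 (t, Φ t u₀), p ∈ spaceTime T V₁ → ψ p.1 p.2 = g₁ p)
    (hψ₂ : ∀ᶠ p in 𝓝 (t, Φ t u₀), p ∈ spaceTime T V₂ → ψ p.1 p.2 = g₂ p)
    (hψS : ContDiffAt ℝ 1 (fun p : ℝ × P2 => ψS p.1 (Φ p.1 p.2)) (t, u₀))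
    (hbal : ∀ (R : Set E3) (C : ControlVolume (Φ t) U (V₁ t) (V₂ t) (χ t '' R)),
      IntegralBalance U Φ V₁ V₂ χ ψ ξ j ψS ξS jS t R C) :
    IsApprox (fun δ ε => -pillboxFlux Φ t u₀ (j t) δ ε
        + -squareFlux (Φ t) (fun u => jS t (Φ t u)) u₀ ε
        + (∫ x in pillbox Φ t u₀ δ ε ∩ (V₁ t ∪ V₂ t), ξ t x)
        + ∫ u in square u₀ ε, ξS t (Φ t u) * areaDensity (Φ t) u)
      (-1 * (areaDensity (Φ t) u₀ * g₁ (t, Φ t u₀)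
          * (inner ℝ (unitNormal (Φ t) u₀) (gv₁ (t, Φ t u₀)) - normalVelocity Φ t u₀))
        + 1 * (areaDensity (Φ t) u₀ * g₂ (t, Φ t u₀)
          * (inner ℝ (unitNormal (Φ t) u₀) (gv₂ (t, Φ t u₀)) - normalVelocity Φ t u₀))
        + (deriv (fun s => ψS s (Φ s u₀)) t * areaDensity (Φ t) u₀
          + ψS t (Φ t u₀) * (areaDensity (Φ t) u₀ * surfDiv (Φ t) (surfVelocity Φ t) u₀))) := by
  have hN := hS.normalVec_ne_zero ht hu
  have hC := hS.contDiffAt ht hu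
  obtain ⟨C₁, hC₁⟩ := volume_term hS hχ ht hu hπ (fun s => subset_union_left) (hπ.isSide₁ hS)
    hgv₁ hv₁ hg₁ hψ₁
  obtain ⟨C₂, hC₂⟩ := volume_term hS hχ ht hu hπ (fun s => subset_union_right) (hπ.isSide₂ hS)
    hgv₂ hv₂ hg₂ hψ₂
  have hψd : HasDerivAt (fun s => ψS s (Φ s u₀)) (deriv (fun s => ψS s (Φ s u₀)) t) t :=
    (hasDerivAt_slice
      (hψS.differentiableAt (by norm_num)).hasFDerivAt).differentiableAt.hasDerivAt
  have hrate := square_integral_rate (hψS.mul (contDiffAt_areaDensity_uncurry hC hN))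
    (hψd.mul (hasDerivAt_areaDensity hC hN))
  generalize deriv (fun s => ψS s (Φ s u₀)) t * areaDensity (Φ t) u₀ + ψS t (Φ t u₀) *
    (areaDensity (Φ t) u₀ * surfDiv (Φ t) (surfVelocity Φ t) u₀) = c at *
  generalize -1 * (areaDensity (Φ t) u₀ * g₁ (t, Φ t u₀)
    * (inner ℝ (unitNormal (Φ t) u₀) (gv₁ (t, Φ t u₀)) - normalVelocity Φ t u₀)) = A₁ at *
  generalize 1 * (areaDensity (Φ t) u₀ * g₂ (t, Φ t u₀)
    * (inner ℝ (unitNormal (Φ t) u₀) (gv₂ (t, Φ t u₀)) - normalVelocity Φ t u₀)) = A₂ at *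
  refine ⟨C₁ + C₂ + 4, fun δ hδ => ?_⟩
  filter_upwards [hC₁ δ hδ, hC₂ δ hδ, hrate δ hδ, eventually_small hπ.pos] with ε h1 h2 h3 hε
  have hK := isOpen_pillbox hS hπ hδ.2 hε.1 hε.2
  have hd := hasDerivAt_of_integralBalance hbal (pillboxVolume hS hπ hδ hε.1 hε.2)
  have hflux : (pillboxVolume hS hπ hδ hε.1 hε.2).boundary.flux (j t)
      = pillboxFlux Φ t u₀ (j t) δ ε :=
    flux_boxBoundary (hπ.isPositiveDiffeo hS (by simpa using hπ.pos)) (flatSides_pos hδ.1 hε.1)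
      (fun i => by linarith [flatSides_le hδ.2 hε.1 i, hε.2]) _
  have hcurve : (pillboxVolume hS hπ hδ hε.1 hε.2).curve.flux (Φ t) (jS t)
      = squareFlux (Φ t) (fun u => jS t (Φ t u)) u₀ ε := rfl
  rw [hflux, hcurve, sub_eq_add_neg] at hd
  have hsplit : ∀ᶠ s in 𝓝 t,
      (∫ x in (χ s '' (χ t ⁻¹' pillbox Φ t u₀ δ ε)) ∩ (V₁ s ∪ V₂ s), ψ s x)
      = (∫ x in χ s '' (χ t ⁻¹' pillbox Φ t u₀ δ ε) ∩ V₁ s, ψ s x)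
        + ∫ x in χ s '' (χ t ⁻¹' pillbox Φ t u₀ δ ε) ∩ V₂ s, ψ s x := by
    filter_upwards [h1, h2, isOpen_Ioo.mem_nhds ht] with s h1 h2 hs
    rw [inter_union_distrib_left]
    exact setIntegral_union
      ((hS.disjoint₁₂ s hs).mono inter_subset_right inter_subset_right)
      (((χ s).isOpenMap _ (hK.preimage (χ t).continuous)).inter
        (isOpen_slice hS.isOpen₂ hs)).measurableSet h1.1 h2.1
  refine abs_sub_le_of_hasDerivAt hd ?_
  filter_upwards [h1, h2, h3, hsplit] with s h1 h2 h3 h4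
  rw [h4, hsplit.self_of_nhds]
  have h5 := (abs_add_three _ _ _).trans (add_le_add (add_le_add h1.2 h2.2) h3)
  refine le_trans (le_of_eq ?_) (h5.trans (le_of_eq (by ring)))
  congr 1
  simp only [surfaceIntegral, pillboxVolume]
  ring

/-- The Lagrangian form of the surface balance. -/
theorem jump_condition (hS : IsSingularSurface T U Φ V₁ V₂) {χ : ℝ → E3 ≃ₜ E3} {v : ℝ → E3 → E3}
    (hχ : IsMotion T U Φ V₁ V₂ χ v) {ψ ξ : ℝ → E3 → ℝ} {j : ℝ → E3 → E3}
    (hv : IsPiecewiseSmooth 1 T U Φ V₁ V₂ v) (hψ : IsPiecewiseSmooth 1 T U Φ V₁ V₂ ψ)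
    (hξ : IsPiecewiseSmooth 0 T U Φ V₁ V₂ ξ) (hj : IsPiecewiseSmooth 0 T U Φ V₁ V₂ j)
    {ψS ξS : ℝ → E3 → ℝ} {jS : ℝ → E3 → E3}
    (hψS : ContDiffOn ℝ 1 (fun p : ℝ × P2 => ψS p.1 (Φ p.1 p.2)) (Ioo 0 T ×ˢ U))
    (ht : t ∈ Ioo 0 T) (hξS : ContinuousOn (fun u => ξS t (Φ t u)) U)
    (hjS : ContDiffOn ℝ 1 (fun u => jS t (Φ t u)) U)
    (hbal : ∀ (R : Set E3) (C : ControlVolume (Φ t) U (V₁ t) (V₂ t) (χ t '' R)),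
      IntegralBalance U Φ V₁ V₂ χ ψ ξ j ψS ξS jS t R C) (hu : u₀ ∈ U) :
    deriv (fun s => ψS s (Φ s u₀)) t + ψS t (Φ t u₀) * surfDiv (Φ t) (surfVelocity Φ t) u₀
        + surfDiv (Φ t) (tangentialPart (Φ t) (fun u => jS t (Φ t u))) u₀ - ξS t (Φ t u₀)
      = jump (V₁ t) (V₂ t) (ψ t) (Φ t u₀) * normalVelocity Φ t u₀
        - inner ℝ (jump (V₁ t) (V₂ t) (fun x => ψ t x • v t x + j t x) (Φ t u₀))
            (unitNormal (Φ t) u₀) := by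
  obtain ⟨π, r, hπ⟩ := exists_isChart hS ht hu
  have hN := hS.normalVec_ne_zero ht hu
  have ha0 : areaDensity (Φ t) u₀ ≠ 0 := norm_ne_zero_iff.2 hN
  obtain ⟨gv₁, hgv₁, hv₁⟩ := hv.1.exists_extension ht hu
  obtain ⟨gv₂, hgv₂, hv₂⟩ := hv.2.exists_extension ht hu
  obtain ⟨gψ₁, hgψ₁, hψ₁⟩ := hψ.1.exists_extension ht hu
  obtain ⟨gψ₂, hgψ₂, hψ₂⟩ := hψ.2.exists_extension ht hu
  obtain ⟨gξ₁, hgξ₁, hξ₁⟩ := hξ.1.exists_extension ht hu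
  obtain ⟨gξ₂, hgξ₂, hξ₂⟩ := hξ.2.exists_extension ht hu
  obtain ⟨gj₁, hgj₁, hj₁⟩ := hj.1.exists_extension ht hu
  obtain ⟨gj₂, hgj₂, hj₂⟩ := hj.2.exists_extension ht hu
  have hUn : ∀ᶠ u in 𝓝 u₀, u ∈ U := hS.isOpen_param.mem_nhds hu
  have tψ₁ := tendsto_side ht hgψ₁.continuousAt hψ₁
  have tψ₂ := tendsto_side ht hgψ₂.continuousAt hψ₂
  have hjψ := jump_eq hS ht hu tψ₁ tψ₂
  have hjf := jump_eq hS ht hu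
    ((tψ₁.smul (tendsto_side ht hgv₁.continuousAt hv₁)).add
      (tendsto_side ht hgj₁.continuousAt hj₁))
    ((tψ₂.smul (tendsto_side ht hgv₂.continuousAt hv₂)).add
      (tendsto_side ht hgj₂.continuousAt hj₂))
  have hrate := isApprox_rate hS hχ hπ ht hu hgv₁.continuousAt hgv₂.continuousAt hv₁ hv₂ hgψ₁ hgψ₂
    hψ₁ hψ₂ (hψS.contDiffAt ((isOpen_Ioo.prod hS.isOpen_param).mem_nhds ⟨ht, hu⟩)) hbal
  have hcurve : IsApprox (fun _ ε => squareFlux (Φ t) (fun u => jS t (Φ t u)) u₀ ε)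
      (areaDensity (Φ t) u₀ * surfDiv (Φ t) (tangentialPart (Φ t) fun u => jS t (Φ t u)) u₀) := by
    refine isApprox_squareFlux (a := fun u => jS t (Φ t u)) ?_ hN (hjS.contDiffAt (hS.isOpen_param.mem_nhds hu))
    filter_upwards [hUn] with u hu'
    exact hS.contDiffAt_slice ht hu'
  have hsource : IsApprox
      (fun _ ε => ∫ u in square u₀ ε, ξS t (Φ t u) * areaDensity (Φ t) u)
      (ξS t (Φ t u₀) * areaDensity (Φ t) u₀) := by
    refine isApprox_integral_square (f := fun u => ξS t (Φ t u) * areaDensity (Φ t) u) ?_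
    filter_upwards [hUn] with u hu'
    exact (hξS.continuousAt (hS.isOpen_param.mem_nhds hu')).mul
      (contDiffAt_normalVec (hS.contDiffAt_slice ht hu')).continuousAt.norm
  have hflux := isApprox_pillboxFlux hS hπ ht hu (by exact_mod_cast hgj₁) (by exact_mod_cast hgj₂)
    hj₁ hj₂
  have hvol := isApprox_pillbox_source hS hπ ht hgξ₁.continuousAt hgξ₂.continuousAt hξ₁ hξ₂
  have hright := ((hflux.neg.add hcurve.neg).add hvol).add hsource
  have heq := hrate.unique hright
  rw [hjψ, hjf]
  -- the constants on the two sides of the balance law carry the factor `areaDensity (Φ t) u₀`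
  refine mul_left_cancel₀ ha0 ?_
  simp only [inner_sub_left, inner_add_left, inner_smul_left,
    real_inner_comm _ (unitNormal (Φ t) u₀), conj_trivial] at heq ⊢
  linarith

end Balance

end SurfaceBalance

end

theorem mainTheorem2
    (T : ℝ) (U : Set SurfaceBalance.P2) (Φ : ℝ → SurfaceBalance.P2 → SurfaceBalance.E3)
    (V₁ V₂ : ℝ → Set SurfaceBalance.E3)
    (hSurf : SurfaceBalance.IsSingularSurface T U Φ V₁ V₂)
    (χ : ℝ → SurfaceBalance.E3 ≃ₜ SurfaceBalance.E3)
    (v : ℝ → SurfaceBalance.E3 → SurfaceBalance.E3)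
    (hχ : SurfaceBalance.IsMotion T U Φ V₁ V₂ χ v)
    -- volume density, source and flux
    (ψ ξ : ℝ → SurfaceBalance.E3 → ℝ) (j : ℝ → SurfaceBalance.E3 → SurfaceBalance.E3)
    (hv : SurfaceBalance.IsPiecewiseSmooth 1 T U Φ V₁ V₂ v)
    (hψ : SurfaceBalance.IsPiecewiseSmooth 1 T U Φ V₁ V₂ ψ)
    (hξ : SurfaceBalance.IsPiecewiseSmooth 0 T U Φ V₁ V₂ ξ)
    (hj : SurfaceBalance.IsPiecewiseSmooth 0 T U Φ V₁ V₂ j)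
    -- surface density, source and flux: only their values on the surface matter
    (ψS ξS : ℝ → SurfaceBalance.E3 → ℝ) (jS : ℝ → SurfaceBalance.E3 → SurfaceBalance.E3)
    (hψS : ContDiffOn ℝ 1 (fun p : ℝ × SurfaceBalance.P2 => ψS p.1 (Φ p.1 p.2))
      (Set.Ioo 0 T ×ˢ U))
    (hξS : ∀ t ∈ Set.Ioo 0 T, ContinuousOn (fun u => ξS t (Φ t u)) U)
    (hjS : ∀ t ∈ Set.Ioo 0 T, ContDiffOn ℝ 1 (fun u => jS t (Φ t u)) U)
    (hbalance : ∀ t ∈ Set.Ioo 0 T, ∀ (R : Set SurfaceBalance.E3)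
      (C : SurfaceBalance.ControlVolume (Φ t) U (V₁ t) (V₂ t) (χ t '' R)),
      SurfaceBalance.IntegralBalance U Φ V₁ V₂ χ ψ ξ j ψS ξS jS t R C) :
    ∀ t ∈ Set.Ioo 0 T, ∀ u ∈ U,
      -- the Lagrangian form
      deriv (fun s => ψS s (Φ s u)) t
          + ψS t (Φ t u) * SurfaceBalance.surfDiv (Φ t) (SurfaceBalance.surfVelocity Φ t) u
          + SurfaceBalance.surfDiv (Φ t)
              (SurfaceBalance.tangentialPart (Φ t) (fun u' => jS t (Φ t u'))) u
          - ξS t (Φ t u)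
        = SurfaceBalance.jump (V₁ t) (V₂ t) (ψ t) (Φ t u) * SurfaceBalance.normalVelocity Φ t u
          - inner ℝ (SurfaceBalance.jump (V₁ t) (V₂ t) (fun x => ψ t x • v t x + j t x) (Φ t u))
              (SurfaceBalance.unitNormal (Φ t) u)
      ∧
      -- the form with the partial time derivative, where `ψS` is defined in the surrounding space
      (DifferentiableAt ℝ (fun p : ℝ × SurfaceBalance.E3 => ψS p.1 p.2) (t, Φ t u) →
        deriv (fun s => ψS s (Φ t u)) t
          + SurfaceBalance.surfDiv (Φ t)
              (fun u' => ψS t (Φ t u') • SurfaceBalance.tangentialPart (Φ t)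
                (SurfaceBalance.surfVelocity Φ t) u') u
          + (inner ℝ (gradient (ψS t) (Φ t u)) (SurfaceBalance.unitNormal (Φ t) u)
              - 2 * SurfaceBalance.meanCurvature (Φ t) u * ψS t (Φ t u))
            * SurfaceBalance.normalVelocity Φ t u
          + SurfaceBalance.surfDiv (Φ t)
              (SurfaceBalance.tangentialPart (Φ t) (fun u' => jS t (Φ t u'))) u
          - ξS t (Φ t u)
        = SurfaceBalance.jump (V₁ t) (V₂ t) (ψ t) (Φ t u) * SurfaceBalance.normalVelocity Φ t u
          - inner ℝ (SurfaceBalance.jump (V₁ t) (V₂ t) (fun x => ψ t x • v t x + j t x) (Φ t u))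
              (SurfaceBalance.unitNormal (Φ t) u)) := by
  intro t ht u hu
  have h := SurfaceBalance.jump_condition hSurf hχ hv hψ hξ hj hψS ht (hξS t ht) (hjS t ht)
    (hbalance t ht) hu
  refine ⟨h, fun hd => ?_⟩
  rw [← h, SurfaceBalance.lagrangian_eq_eulerian (hSurf.contDiffAt ht hu)
    (hSurf.normalVec_ne_zero ht hu) hd]
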